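/- Let $d\ge 1$, and use the Fourier transform $\widehat u(\xi)=\int u(y)e^{-i\xi\cdot y}\,dy$. Let $V\in\mathscr S'(\mathbb R^d)$ be a real and even tempered distribution whose Fourier transform $\widehat V$ is a smooth function, bounded together with all its derivatives. For $\varepsilon>0$ let $V_\varepsilon$ be defined by $\widehat{V_\varepsilon}(\xi)=\widehat V(\varepsilon\xi)$, and consider the Wigner equation for $f=f(t,x,v)$, $(x,v)\in\mathbb R^d\times\mathbb R^d$, $$\partial_t f+v\cdot\nabla_x f+B_\varepsilon[\rho_f,f]=0,\qquad f|_{t=0}=f^0,\qquad \rho_f(t,x)=\int_{\mathbb R^d}f(t,x,v)\,dv,$$ where $$B_\varepsilon[\rho,f](x,v)=\frac{i}{(2\pi)^d}\int_{\mathbb R^d}e^{iv\cdot\xi}\,\frac1\varepsilon\Big((V_\varepsilon*\rho)\big(x-\tfrac{\varepsilon\xi}{2}\big)-(V_\varepsilon*\rho)\big(x+\tfrac{\varepsilon\xi}{2}\big)\Big)\Big(\int_{\mathbb R^d}e^{-i\xi\cdot w}f(x,w)\,dw\Big)\,d\xi .$$ Let $V_\pm=\varepsilon\nabla_x\pm 2iv$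 and $X_\pm=\varepsilon\nabla_v\pm 2ix$. For $m,r\in\mathbb N$ let $\mathcal H^m_r$ be the space of complex-valued $f\in L^2(\mathbb R^{2d})$ with finite norm $$\|f\|_{\mathcal H^m_r}=\sum_{|\alpha|\le m}\ \sum_{\substack{|\beta|+|\beta'|\le r\\ |\gamma|+|\gamma'|\le r}}\big\|V_+^{\beta}X_-^{\beta'}V_-^{\gamma}X_+^{\gamma'}\partial^\alpha_{x,v}f\big\|_{L^2(\mathbb R^{2d})},$$ where $\alpha\in\mathbb N^{2d}$, $\beta,\beta',\gamma,\gamma'\in\mathbb N^d$, and derivatives are taken in the sense of distributions. Then for all integers $m,r>d/2$, every $\varepsilon>0$ and every $f^0\in\mathcal H^m_r$ there exists $T>0$ (which may depend on $\varepsilon$ and $f^0$) such that the Wigner equation with initial datum $f^0$ has a unique solution $f\in C([0,T];\mathcal H^m_r)$. (The equation is understood in the sense of tempered distributions in $(x,v)$, for every $t\in[0,T]$.) Moreover, if $f^0$ is real-valued, then $f(t)$ is real-valued for every $t\in[0,T]$. -/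

import Mathlib

open MeasureTheory SchwartzMap LineDeriv
open scoped FourierTransform ENNReal Topology ContDiff InnerProductSpace

noncomputable section

namespace Wigner

/-- The position (or velocity) space `ℝ^d`, with its Euclidean norm. -/
abbrev Pos (d : ℕ) : Type := EuclideanSpace ℝ (Fin d)

/-- The phase space `ℝ^d × ℝ^d` of pairs `z = (x, v)`, with Lebesgue measure. -/
abbrev Phase (d : ℕ) : Type := Pos d × Pos d

/-- The complex space `L²(ℝ^{2d})`. -/
abbrev L2Phase (d : ℕ) : Type := Lp ℂ 2 (volume : Measure (Phase d))

instance instHasTemperateGrowthPhase (d : ℕ) :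
    (volume : Measure (Phase d)).HasTemperateGrowth := by
  have : (volume : Measure (Phase d)).IsAddHaarMeasure :=
    Measure.prod.instIsAddHaarMeasure volume volume
  infer_instance

/-- Tempered distributions on `ℝ^{2d}`. -/
abbrev Dist (d : ℕ) : Type := 𝓢'(Phase d, ℂ)

/-! ### Vector fields and weighted Sobolev norms -/

/-- The distributional derivative `∂_{x_j}`. -/
def dX {d : ℕ} (j : Fin d) : Dist d →L[ℂ] Dist d :=
  lineDerivOpCLM ℂ (Dist d) ((EuclideanSpace.single j (1 : ℝ), 0) : Phase d)

/-- The distributional derivative `∂_{v_j}`. -/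
def dV {d : ℕ} (j : Fin d) : Dist d →L[ℂ] Dist d :=
  lineDerivOpCLM ℂ (Dist d) ((0, EuclideanSpace.single j (1 : ℝ)) : Phase d)

/-- Multiplication of a tempered distribution by the coordinate `x_j`. -/
def mulX {d : ℕ} (j : Fin d) : Dist d →L[ℂ] Dist d :=
  TemperedDistribution.smulLeftCLM ℂ (fun z : Phase d => ((z.1 j : ℝ) : ℂ))

/-- Multiplication of a tempered distribution by the coordinate `v_j`. -/
def mulV {d : ℕ} (j : Fin d) : Dist d →L[ℂ] Dist d :=
  TemperedDistribution.smulLeftCLM ℂ (fun z : Phase d => ((z.2 j : ℝ) : ℂ))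

/-- `V_+ = ε ∇_x + 2 i v`, component `j`. -/
def vPlus {d : ℕ} (ε : ℝ) (j : Fin d) : Dist d →L[ℂ] Dist d :=
  (ε : ℂ) • dX j + (2 * Complex.I) • mulV j

/-- `V_- = ε ∇_x - 2 i v`, component `j`. -/
def vMinus {d : ℕ} (ε : ℝ) (j : Fin d) : Dist d →L[ℂ] Dist d :=
  (ε : ℂ) • dX j - (2 * Complex.I) • mulV j

/-- `X_+ = ε ∇_v + 2 i x`, component `j`. -/
def xPlus {d : ℕ} (ε : ℝ) (j : Fin d) : Dist d →L[ℂ] Dist d :=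
  (ε : ℂ) • dV j + (2 * Complex.I) • mulX j

/-- `X_- = ε ∇_v - 2 i x`, component `j`. -/
def xMinus {d : ℕ} (ε : ℝ) (j : Fin d) : Dist d →L[ℂ] Dist d :=
  (ε : ℂ) • dV j - (2 * Complex.I) • mulX j

/-- The power `A^β = A_1^{β_1} ⋯ A_d^{β_d}` (the components of each of the families used below
commute with each other). -/
def multiPow {d : ℕ} (A : Fin d → (Dist d →L[ℂ] Dist d)) (β : Fin d → ℕ) :
    Dist d →L[ℂ] Dist d :=
  (List.ofFn fun j => A j ^ β j).prod

/-- The finite set of pairs of multi-indices `(β, β') ∈ ℕ^d × ℕ^d` with `|β| + |β'| ≤ n`. -/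
def multiIdx (d n : ℕ) : Finset ((Fin d → ℕ) × (Fin d → ℕ)) :=
  ((Fintype.piFinset fun _ => Finset.range (n + 1)) ×ˢ
    (Fintype.piFinset fun _ => Finset.range (n + 1))).filter
      fun p => ∑ j, p.1 j + ∑ j, p.2 j ≤ n

theorem mem_multiIdx {d n : ℕ} (p : (Fin d → ℕ) × (Fin d → ℕ)) :
    p ∈ multiIdx d n ↔ ∑ j, p.1 j + ∑ j, p.2 j ≤ n := by
  simp only [multiIdx, Finset.mem_filter, Finset.mem_product, Fintype.mem_piFinset,
    Finset.mem_range, and_iff_right_iff_imp]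
  intro h
  have h1 : ∀ j, p.1 j ≤ ∑ i, p.1 i := fun j =>
    Finset.single_le_sum (f := p.1) (fun i _ => Nat.zero_le _) (Finset.mem_univ j)
  have h2 : ∀ j, p.2 j ≤ ∑ i, p.2 i := fun j =>
    Finset.single_le_sum (f := p.2) (fun i _ => Nat.zero_le _) (Finset.mem_univ j)
  exact ⟨fun j => by have := h1 j; omega, fun j => by have := h2 j; omega⟩

/-- The `L²(ℝ^{2d})` norm of a tempered distribution: the norm of the `L²` function that
represents it (which is unique), and `∞` if there is none. -/
def l2Norm {d : ℕ} (u : Dist d) : ℝ≥0∞ :=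
  ⨅ g : L2Phase d, ⨅ _ : (g : Dist d) = u, ‖g‖ₑ

/-- The norm of `𝓗^0_r`: the sum of `‖V_+^β X_-^{β'} V_-^γ X_+^{γ'} u‖_{L²}` over
`|β| + |β'| ≤ r` and `|γ| + |γ'| ≤ r`. -/
def hNormZero {d : ℕ} (ε : ℝ) (r : ℕ) (u : Dist d) : ℝ≥0∞ :=
  ∑ b ∈ multiIdx d r, ∑ c ∈ multiIdx d r,
    l2Norm (multiPow (vPlus ε) b.1 (multiPow (xMinus ε) b.2
      (multiPow (vMinus ε) c.1 (multiPow (xPlus ε) c.2 u))))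

/-- The norm of `𝓗^m_r`: the sum of `‖∂_{x,v}^α u‖_{𝓗^0_r}` over `|α| ≤ m`. -/
def hNorm {d : ℕ} (ε : ℝ) (m r : ℕ) (u : Dist d) : ℝ≥0∞ :=
  ∑ a ∈ multiIdx d m, hNormZero ε r (multiPow dX a.1 (multiPow dV a.2 u))

/-- Membership in `𝓗^m_r`. -/
def MemH {d : ℕ} (ε : ℝ) (m r : ℕ) (f : L2Phase d) : Prop :=
  hNorm ε m r (f : Dist d) < ⊤

/-- `f ∈ C([0, T]; 𝓗^m_r)`. -/
def ContinuousH {d : ℕ} (ε : ℝ) (m r : ℕ) (T : ℝ) (f : ℝ → L2Phase d) : Prop :=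
  ∀ t ∈ Set.Icc 0 T, MemH ε m r (f t) ∧
    Filter.Tendsto (fun s => hNorm ε m r ((f s - f t : L2Phase d) : Dist d))
      (𝓝[Set.Icc 0 T] t) (𝓝 0)

/-! ### The interaction potential

The Fourier transform is normalised as `û(ξ) = ∫ u(y) e^{-i ξ·y} dy`; Mathlib's transform `𝓕`
uses `e^{-2π i ζ·y}`, so that `(𝓕 u)(ζ) = û(2πζ)`. -/

/-- `V` is a real and even tempered distribution on `ℝ^d` whose Fourier transform (in the
normalisation `e^{-i ξ·y}`) is the function `Vhat`, and `Vhat` is smooth and bounded together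
with all its derivatives. -/
structure IsShortRange {d : ℕ} (V : 𝓢'(Pos d, ℂ)) (Vhat : Pos d → ℂ) : Prop where
  real : ∀ φ : 𝓢(Pos d, ℂ), (∀ x, (φ x).im = 0) → (V φ).im = 0
  even : ∀ φ ψ : 𝓢(Pos d, ℂ), (∀ x, ψ x = φ (-x)) → V ψ = V φ
  fourier : ∀ φ : 𝓢(Pos d, ℂ), (𝓕 V) φ = ∫ ζ, φ ζ * Vhat ((2 * Real.pi) • ζ)
  smooth : ContDiff ℝ ∞ Vhat
  bounded : ∀ n : ℕ, ∃ C : ℝ, ∀ ξ, ‖iteratedFDeriv ℝ n Vhat ξ‖ ≤ C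

/-- The convolution `V_ε ∗ ρ`, where `V_ε` has Fourier transform `ξ ↦ Vhat (ε ξ)`: it is
`y ↦ (2π)^{-d} ∫ e^{i y·η} Vhat (ε η) ρ̂(η) dη`, written with `η = 2πζ` and the `L²` Fourier
transform `𝓕 ρ`. The integral converges absolutely for `ρ ∈ H^s(ℝ^d)`, `s > d/2`. -/
def potential {d : ℕ} (ε : ℝ) (Vhat : Pos d → ℂ) (ρ : Lp ℂ 2 (volume : Measure (Pos d)))
    (y : Pos d) : ℂ :=
  ∫ ζ, Complex.exp (2 * Real.pi * Complex.I * (⟪y, ζ⟫_ℝ : ℝ)) *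
    Vhat ((2 * Real.pi * ε) • ζ) * (𝓕 ρ) ζ

/-! ### The Wigner equation -/

/-- The density `ρ_f(x) = ∫ f(x, v) dv`. -/
def density {d : ℕ} (f : Phase d → ℂ) (x : Pos d) : ℂ := ∫ v, f (x, v)

open Classical in
/-- The density as an element of `L²(ℝ^d)` (which it is for `f ∈ 𝓗^0_r`, `r > d/2`). -/
def densityL2 {d : ℕ} (f : L2Phase d) : Lp ℂ 2 (volume : Measure (Pos d)) :=
  if h : MemLp (density (f : Phase d → ℂ)) 2 volume then h.toLp _ else 0

/-- The partial Fourier transform `(𝓕_v f)(x, ξ) = ∫ e^{-i ξ·v} f(x, v) dv`. -/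
def fourierV {d : ℕ} (f : Phase d → ℂ) (x ξ : Pos d) : ℂ :=
  ∫ v, Complex.exp (-Complex.I * (⟪ξ, v⟫_ℝ : ℝ)) * f (x, v)

/-- The interaction term
`B_ε[ρ, f](x, v) = i (2π)^{-d} ∫ e^{i v·ξ} ε^{-1} (U(x - εξ/2) - U(x + εξ/2)) (𝓕_v f)(x, ξ) dξ`
with `U = V_ε ∗ ρ`. -/
def wignerB {d : ℕ} (ε : ℝ) (Vhat : Pos d → ℂ) (ρ : Lp ℂ 2 (volume : Measure (Pos d)))
    (f : Phase d → ℂ) (z : Phase d) : ℂ :=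
  Complex.I / (2 * Real.pi) ^ d *
    ∫ ξ, Complex.exp (Complex.I * (⟪z.2, ξ⟫_ℝ : ℝ)) *
      ((1 / ε : ℂ) * (potential ε Vhat ρ (z.1 - (ε / 2) • ξ) -
        potential ε Vhat ρ (z.1 + (ε / 2) • ξ))) *
      fourierV f z.1 ξ

/-- `f ∈ C([0, T]; 𝓗^m_r)` is a solution on `[0, T]`, with initial datum `f0`, of
`∂_t f + v·∇_x f + B_ε[ρ_f, f] = 0`, the equation being understood in the sense of tempered
distributions in `(x, v)`: for every test function `φ` and every `t ∈ [0, T]`,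
`d/dt ∫ f(t) φ = ∫ f(t) v·∇_x φ - ∫ B_ε[ρ_{f(t)}, f(t)] φ`
(one-sided derivatives at the end points). -/
structure IsSolution {d : ℕ} (ε : ℝ) (Vhat : Pos d → ℂ) (m r : ℕ) (T : ℝ) (f0 : L2Phase d)
    (f : ℝ → L2Phase d) : Prop where
  continuousH : ContinuousH ε m r T f
  initial : f 0 = f0
  equation : ∀ φ : 𝓢(Phase d, ℂ), ∀ t ∈ Set.Icc 0 T,
    HasDerivWithinAt (fun s => ∫ z, f s z * φ z)
      ((∫ z, f t z * fderiv ℝ φ z (z.2, 0)) -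
        ∫ z, wignerB ε Vhat (densityL2 (f t)) (f t) z * φ z)
      (Set.Icc 0 T) t

end Wigner

end

open MeasureTheory SchwartzMap LineDeriv
open scoped FourierTransform ENNReal Topology ContDiff InnerProductSpace

noncomputable section

namespace Wigner

/-! ### Spans of monomials in letters with scalar commutators -/

section Letters

variable {A : Type*} [Ring A] [Algebra ℂ A]

/-! Let F be the partial Fourier transform in x, with frequency ζ. Under F the operators ∂_x and V_±
become multiplication by 2πiζ and i w_±, where w_± = 2πεζ ± 2v, while ∂_v and X_± commute with all
modulations in x and all translations in v. Since the Fourier transform of ρ_f at ζ is ∫ (Ff)(ζ, w)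
dw, the interaction term is a difference of two twisted convolutions: B_ε[ρ_f, f] is i/ε times the
difference of ∫∫ U(ζ, w) e^{2πiζ·x} f(x, v ∓ πεζ) dζ dw, with U(ζ, w) = Vhat(2πεζ) (Ff)(ζ, w)
(`twistConv`, `ae_wignerB_eq`). The condition m > d/2 serves this identity: it makes the Fourier
transform of f in v integrable for almost every x, so that the integral defining B_ε converges and
Fourier inversion in v applies.

The bilinear form so obtained is bounded on 𝓗^m_r when r > d/2. All first order operators involved
have scalar commutators, so every operator in the norm can be rearranged, up to linear combinations,
as a product of horizontal letters (∂_x, V_±) followed by vertical ones (∂_v, X_±). The vertical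
letters pass through the twisted convolution; the horizontal ones leave a weighted L² estimate on
the Fourier side (`memLp_weight_twistConv`). There the twisted convolution superposes shifts along
(ζ, ±πεζ), each of which fixes one of w_+ and w_- and moves the other by 4πεζ. A Cauchy–Schwarz
argument with the factor (1 + |·|)^{-r}, square integrable for r > d/2, closes the estimate.
Continuity is then deduced from well-definedness by the closed graph theorem (`exists_lift`,
`exists_interaction`).

Free transport S_t is a strongly continuous group on 𝓗^m_r: it fixes ∂_x and V_±, and turns X_∓ into
X_∓ - tV_± and ∂_v into ∂_v - t∂_x (`opSpan_le_pathIntertwine`). For y(t) = S_{-t} f(t) the equation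
becomes an ordinary differential equation in a Banach space with a quadratic, hence locally
Lipschitz, field. Picard–Lindelöf gives existence. Every weak solution in C([0, T]; 𝓗^m_r) lifts to
this equation (`IsSolution.exists_lift`), which gives uniqueness. Since V is real, Vhat is Hermitian
and complex conjugation commutes with the field, so real data stay real by uniqueness. -/

/-- The span of `1` and of a family of letters. -/
def letterSpan {ι : Type*} (a : ι → A) : Submodule ℂ A :=
  Submodule.span ℂ (insert 1 (Set.range a))

theorem one_mem_letterSpan {ι : Type*} (a : ι → A) : (1 : A) ∈ letterSpan a :=
  Submodule.subset_span (Set.mem_insert _ _)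

theorem mem_letterSpan {ι : Type*} (a : ι → A) (i : ι) : a i ∈ letterSpan a :=
  Submodule.subset_span (Set.mem_insert_of_mem _ ⟨i, rfl⟩)

theorem one_le_letterSpan {ι : Type*} (a : ι → A) : 1 ≤ letterSpan a :=
  Submodule.one_le.2 (one_mem_letterSpan a)

/-- Both spans contain 1, so the scalar commutator in a_i b_j = b_j a_i + c·1·1 is absorbed. Letters
that commute only up to scalars thus have spans that commute exactly, and reordering needs no
bookkeeping of lower order terms. -/
theorem letterSpan_mul_le {ι κ : Type*} {a : ι → A} {b : κ → A}
    (h : ∀ i j, ∃ c : ℂ, a i * b j - b j * a i = algebraMap ℂ A c) :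
    letterSpan a * letterSpan b ≤ letterSpan b * letterSpan a := by
  rw [letterSpan, letterSpan, Submodule.span_mul_span, Submodule.span_le]
  have hl : ∀ x ∈ letterSpan b, ∀ y ∈ letterSpan a, x * y ∈ letterSpan b * letterSpan a :=
    fun x hx y hy => Submodule.mul_mem_mul hx hy
  rintro _ ⟨x, (rfl | ⟨i, rfl⟩), y, (rfl | ⟨j, rfl⟩), rfl⟩
  · exact hl 1 (one_mem_letterSpan b) 1 (one_mem_letterSpan a)
  · simpa [letterSpan] using hl _ (mem_letterSpan b j) 1 (one_mem_letterSpan a)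
  · simpa [letterSpan] using hl 1 (one_mem_letterSpan b) _ (mem_letterSpan a i)
  · obtain ⟨c, hc⟩ := h i j
    have : a i * b j = b j * a i + c • (1 * 1 : A) := by
      rw [mul_one, ← Algebra.algebraMap_eq_smul_one, ← hc]; abel
    simp only [this]
    exact add_mem (hl _ (mem_letterSpan b j) _ (mem_letterSpan a i))
      (Submodule.smul_mem _ _ (hl 1 (one_mem_letterSpan b) 1 (one_mem_letterSpan a)))

theorem letterSpan_commute {ι κ : Type*} {a : ι → A} {b : κ → A}
    (h : ∀ i j, ∃ c : ℂ, a i * b j - b j * a i = algebraMap ℂ A c) :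
    Commute (letterSpan a) (letterSpan b) := by
  refine le_antisymm (letterSpan_mul_le h) (letterSpan_mul_le fun j i => ?_)
  obtain ⟨c, hc⟩ := h i j
  exact ⟨-c, by rw [map_neg, ← hc]; abel⟩

/-- The binomial theorem in the semiring of submodules. Addition there is the supremum, hence
idempotent, so the binomial coefficients are at most 1 and drop out. -/
theorem add_pow_le_sum {M N : Submodule ℂ A} (h : Commute M N) (n : ℕ) :
    (M + N) ^ n ≤ ∑ i ∈ Finset.range (n + 1), M ^ i * N ^ (n - i) := by
  rw [h.add_pow]
  refine Finset.sum_le_sum fun i _ => ?_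
  have hc : ((n.choose i : ℕ) : Submodule ℂ A) ≤ 1 := by
    generalize n.choose i = k
    induction k with
    | zero => simp
    | succ k ih => rw [Nat.cast_succ]; exact sup_le ih le_rfl
  exact (mul_le_mul' le_rfl hc).trans (mul_one _).le

/-- The ordered monomial `a_1^{β_1} ⋯ a_d^{β_d}`. -/
def monomialProd {d : ℕ} (a : Fin d → A) (β : Fin d → ℕ) : A :=
  (List.ofFn fun j => a j ^ β j).prod

theorem monomialProd_mem {d : ℕ} (a : Fin d → A) {M : Submodule ℂ A} (ha : ∀ j, a j ∈ M)
    (β : Fin d → ℕ) : monomialProd a β ∈ M ^ (∑ j, β j) := by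
  induction d with
  | zero => simpa [monomialProd] using ⟨1, map_one _⟩
  | succ d ih =>
    rw [Fin.sum_univ_succ, pow_add, monomialProd, List.ofFn_succ, List.prod_cons]
    exact Submodule.mul_mem_mul (Submodule.pow_mem_pow _ (ha 0) _)
      (ih (fun j => a j.succ) (fun j => ha _) fun j => β j.succ)

theorem mul_monomialProd {d : ℕ} (a : Fin d → A) (ha : ∀ i j, Commute (a i) (a j)) (j : Fin d)
    (β : Fin d → ℕ) : a j * monomialProd a β = monomialProd a (β + Pi.single j 1) := by
  induction d with
  | zero => exact j.elim0
  | succ d ih =>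
    simp only [monomialProd, List.ofFn_succ, List.prod_cons]
    refine Fin.cases ?_ (fun j => ?_) j
    · simp [pow_succ', mul_assoc]
    · have := ih (fun i => a i.succ) (fun _ _ => ha _ _) j fun i => β i.succ
      simp only [monomialProd] at this
      rw [← mul_assoc, ((ha j.succ 0).pow_right _).eq, mul_assoc, this]
      congr 4
      funext i
      congr 2
      simp [Pi.single_apply]

/-- Letters of one family commute, so every word can be sorted. This leads back from powers of spans
to the ordered monomials of the norm. -/
theorem letterSpan_pow_le {d : ℕ} (a : Fin d → A) (ha : ∀ i j, Commute (a i) (a j)) (n : ℕ) :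
    letterSpan a ^ n ≤ Submodule.span ℂ {x | ∃ β : Fin d → ℕ, ∑ j, β j ≤ n ∧
      monomialProd a β = x} := by
  induction n with
  | zero =>
    rw [pow_zero, Submodule.one_le]
    exact Submodule.subset_span ⟨0, by simp, by simp [monomialProd]⟩
  | succ n ih =>
    rw [pow_succ']
    refine (mul_le_mul' le_rfl ih).trans ?_
    rw [letterSpan, Submodule.span_mul_span, Submodule.span_le]
    rintro _ ⟨x, (rfl | ⟨j, rfl⟩), _, ⟨β, hβ, rfl⟩, rfl⟩
    · exact Submodule.subset_span ⟨β, hβ.trans n.le_succ, (one_mul _).symm⟩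
    · refine Submodule.subset_span ⟨β + Pi.single j 1, ?_, (mul_monomialProd a ha j β).symm⟩
      simpa [Finset.sum_add_distrib] using hβ

theorem add_pow_le_span {d : ℕ} (a b : Fin d → A) (ha : ∀ i j, Commute (a i) (a j))
    (hb : ∀ i j, Commute (b i) (b j))
    (h : ∀ i j, ∃ c : ℂ, a i * b j - b j * a i = algebraMap ℂ A c) (n : ℕ) :
    (letterSpan a + letterSpan b) ^ n ≤ Submodule.span ℂ {x | ∃ p ∈ multiIdx d n,
      monomialProd a p.1 * monomialProd b p.2 = x} := by
  refine (add_pow_le_sum (letterSpan_commute h) n).trans ?_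
  refine Finset.sum_induction _ (· ≤ _) (fun _ _ => sup_le) bot_le fun i hi => ?_
  refine (mul_le_mul' (letterSpan_pow_le a ha i) (letterSpan_pow_le b hb (n - i))).trans ?_
  rw [Submodule.span_mul_span, Submodule.span_le]
  rintro _ ⟨_, ⟨β, hβ, rfl⟩, _, ⟨γ, hγ, rfl⟩, rfl⟩
  refine Submodule.subset_span ⟨(β, γ), (mem_multiIdx _).2 ?_, rfl⟩
  have := Finset.mem_range.1 hi
  simp only; omega

theorem monomialProd_mul_mem {d : ℕ} (a b : Fin d → A) {n : ℕ} {p : (Fin d → ℕ) × (Fin d → ℕ)}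
    (hp : p ∈ multiIdx d n) :
    monomialProd a p.1 * monomialProd b p.2 ∈ (letterSpan a + letterSpan b) ^ n := by
  have h1 : 1 ≤ letterSpan a + letterSpan b := (one_le_letterSpan a).trans le_sup_left
  refine pow_le_pow_right' h1 ((mem_multiIdx p).1 hp) ?_
  rw [pow_add]
  exact Submodule.mul_mem_mul
    (monomialProd_mem a (fun j => (le_sup_left : letterSpan a ≤ _) (mem_letterSpan a j)) _)
    (monomialProd_mem b (fun j => (le_sup_right : letterSpan b ≤ _) (mem_letterSpan b j)) _)

theorem mul_reorder {S : Type*} [Semigroup S] {x1 x2 y1 y2 z1 z2 : S} (e1 : Commute x2 y1)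
    (e2 : Commute y2 z1) (e3 : Commute x2 z1) (e5 : Commute y1 z1) (e4 : Commute x1 z1) :
    x1 * x2 * (y1 * y2) * (z1 * z2) = z1 * x1 * y1 * (x2 * y2 * z2) :=
  calc x1 * x2 * (y1 * y2) * (z1 * z2) = x1 * (x2 * y1) * (y2 * z1) * z2 := by
        simp only [mul_assoc]
    _ = x1 * y1 * (x2 * z1) * y2 * z2 := by rw [e1.eq, e2.eq]; simp only [mul_assoc]
    _ = x1 * (y1 * z1) * (x2 * y2 * z2) := by rw [e3.eq]; simp only [mul_assoc]
    _ = (x1 * z1) * y1 * (x2 * y2 * z2) := by rw [e5.eq]; simp only [mul_assoc]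
    _ = z1 * x1 * y1 * (x2 * y2 * z2) := by rw [e4.eq]

/-- Separation of two groups of commuting letters in a product of three powers of sums. -/
theorem prod_add_pow_le {K L M K' L' M' : Submodule ℂ A} (h1 : Commute L L') (h2 : Commute M M')
    (h3 : Commute K K') (hLM : Commute L' M) (hLK : Commute L' K) (hMK : Commute M' K)
    (hLK' : Commute L K) (hMK' : Commute M K) (l k : ℕ) {C : Submodule ℂ A}
    (hC : ∀ i ≤ l, ∀ j ≤ l, ∀ n ≤ k,
      (K ^ n * L ^ i * M ^ j) * (L' ^ (l - i) * M' ^ (l - j) * K' ^ (k - n)) ≤ C) :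
    (L + L') ^ l * (M + M') ^ l * (K + K') ^ k ≤ C := by
  refine (mul_le_mul' (mul_le_mul' (add_pow_le_sum h1 l) (add_pow_le_sum h2 l))
    (add_pow_le_sum h3 k)).trans ?_
  rw [Finset.sum_mul_sum, Finset.sum_mul]
  refine Finset.sum_induction _ (· ≤ C) (fun _ _ => sup_le) bot_le fun i hi => ?_
  rw [Finset.sum_mul]
  refine Finset.sum_induction _ (· ≤ C) (fun _ _ => sup_le) bot_le fun j hj => ?_
  rw [Finset.mul_sum]
  refine Finset.sum_induction _ (· ≤ C) (fun _ _ => sup_le) bot_le fun n hn => ?_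
  refine le_of_eq_of_le ?_ (hC i (Nat.lt_succ_iff.1 (Finset.mem_range.1 hi)) j
    (Nat.lt_succ_iff.1 (Finset.mem_range.1 hj)) n (Nat.lt_succ_iff.1 (Finset.mem_range.1 hn)))
  exact mul_reorder (hLM.pow_pow _ _) (hMK.pow_pow _ _) (hLK.pow_pow _ _) (hMK'.pow_pow _ _)
    (hLK'.pow_pow _ _)

/-- The inclusion opposite to `prod_add_pow_le`: each separated product is one of the products that
occur on expanding the powers of the sums. -/
theorem mul_mem_prod_add_pow {K L M K' L' M' : Submodule ℂ A}
    (hLM : Commute L' M) (hLK : Commute L' K) (hMK : Commute M' K)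
    (hLK' : Commute L K) (hMK' : Commute M K) {l k i j n : ℕ} (hi : i ≤ l) (hj : j ≤ l)
    (hn : n ≤ k) :
    (K ^ n * L ^ i * M ^ j) * (L' ^ (l - i) * M' ^ (l - j) * K' ^ (k - n)) ≤
      (L + L') ^ l * (M + M') ^ l * (K + K') ^ k := by
  have key : ∀ (M N : Submodule ℂ A) {i l : ℕ}, i ≤ l → M ^ i * N ^ (l - i) ≤ (M + N) ^ l := by
    intro M N i l hi
    calc _ ≤ (M + N) ^ i * (M + N) ^ (l - i) :=
          mul_le_mul' (pow_le_pow_left' le_sup_left _) (pow_le_pow_left' le_sup_right _)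
      _ = _ := by rw [← pow_add, Nat.add_sub_cancel' hi]
  refine le_of_eq_of_le ?_ (mul_le_mul' (mul_le_mul' (key L L' hi) (key M M' hj)) (key K K' hn))
  exact (mul_reorder (hLM.pow_pow _ _) (hMK.pow_pow _ _) (hLK.pow_pow _ _) (hMK'.pow_pow _ _)
    (hLK'.pow_pow _ _)).symm

end Letters

/-! ### Commutation relations of the vector fields -/

/-- Continuous linear endomorphisms of the space of tempered distributions. -/
abbrev DistOp (d : ℕ) : Type := Dist d →L[ℂ] Dist d

variable {d : ℕ}

/-- The coordinate `x_j`, as a complex-valued linear form on phase space. -/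
def coordX (j : Fin d) : Phase d →L[ℝ] ℂ :=
  Complex.ofRealCLM ∘L (EuclideanSpace.proj j : Pos d →L[ℝ] ℝ) ∘L
    ContinuousLinearMap.fst ℝ (Pos d) (Pos d)

/-- The coordinate `v_j`, as a complex-valued linear form on phase space. -/
def coordV (j : Fin d) : Phase d →L[ℝ] ℂ :=
  Complex.ofRealCLM ∘L (EuclideanSpace.proj j : Pos d →L[ℝ] ℝ) ∘L
    ContinuousLinearMap.snd ℝ (Pos d) (Pos d)

@[simp] theorem coordX_apply (j : Fin d) (z : Phase d) : coordX j z = ((z.1 j : ℝ) : ℂ) := rfl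

@[simp] theorem coordV_apply (j : Fin d) (z : Phase d) : coordV j z = ((z.2 j : ℝ) : ℂ) := rfl

/-- The first order operator `a ∂_e + b L` on tempered distributions. -/
def letter (a : ℂ) (e : Phase d) (b : ℂ) (L : Phase d →L[ℝ] ℂ) : DistOp d :=
  a • lineDerivOpCLM ℂ (Dist d) e + b • TemperedDistribution.smulLeftCLM ℂ L

/-- The transpose of `letter a e b L`, acting on test functions. -/
def letterT (a : ℂ) (e : Phase d) (b : ℂ) (L : Phase d →L[ℝ] ℂ) (φ : 𝓢(Phase d, ℂ)) :
    𝓢(Phase d, ℂ) :=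
  -(a • ∂_{e} φ) + b • SchwartzMap.smulLeftCLM ℂ L φ

theorem letter_apply (a : ℂ) (e : Phase d) (b : ℂ) (L : Phase d →L[ℝ] ℂ) (u : Dist d)
    (φ : 𝓢(Phase d, ℂ)) : letter a e b L u φ = u (letterT a e b L φ) := by
  simp [letter, letterT]

theorem letterT_apply (a : ℂ) (e : Phase d) (b : ℂ) (L : Phase d →L[ℝ] ℂ) (φ : 𝓢(Phase d, ℂ))
    (z : Phase d) : letterT a e b L φ z = -(a * fderiv ℝ φ z e) + b * (L z * φ z) := by
  simp [letterT, SchwartzMap.smulLeftCLM_apply_apply L.hasTemperateGrowth,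
    SchwartzMap.lineDerivOp_apply_eq_fderiv]

theorem lineDeriv_smulLeft (L : Phase d →L[ℝ] ℂ) (e : Phase d) (φ : 𝓢(Phase d, ℂ)) :
    ∂_{e} (SchwartzMap.smulLeftCLM ℂ L φ) =
      L e • φ + SchwartzMap.smulLeftCLM ℂ L (∂_{e} φ) := by
  ext z
  have h1 : (SchwartzMap.smulLeftCLM ℂ L φ : Phase d → ℂ) = fun z => L z • φ z :=
    SchwartzMap.smulLeftCLM_apply L.hasTemperateGrowth φ
  rw [SchwartzMap.lineDerivOp_apply_eq_fderiv, h1,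
    fderiv_fun_smul L.differentiableAt φ.differentiableAt]
  simp [SchwartzMap.smulLeftCLM_apply_apply L.hasTemperateGrowth,
    SchwartzMap.lineDerivOp_apply_eq_fderiv]
  ring

theorem lineDeriv_commutator (L : Phase d →L[ℝ] ℂ) (e : Phase d) :
    (lineDerivOpCLM ℂ (Dist d) e : DistOp d) * TemperedDistribution.smulLeftCLM ℂ L =
      TemperedDistribution.smulLeftCLM ℂ L * (lineDerivOpCLM ℂ (Dist d) e : DistOp d) +
      algebraMap ℂ (DistOp d) (L e) := by
  ext u φ
  simp [lineDeriv_smulLeft L, Algebra.algebraMap_eq_smul_one]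

theorem lineDeriv_commute (e e' : Phase d) :
    (lineDerivOpCLM ℂ (Dist d) e : DistOp d) * lineDerivOpCLM ℂ (Dist d) e' =
      lineDerivOpCLM ℂ (Dist d) e' * lineDerivOpCLM ℂ (Dist d) e := by
  ext u φ
  have : ∂_{e'} (∂_{e} φ) = ∂_{e} (∂_{e'} φ) := by
    ext z
    simp only [SchwartzMap.lineDerivOp_apply_eq_fderiv]
    have h : ∀ a : Phase d, ((∂_{a} φ : 𝓢(Phase d, ℂ)) : Phase d → ℂ) = fun z => fderiv ℝ φ z a := fun a => by
      ext z; exact SchwartzMap.lineDerivOp_apply_eq_fderiv ..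
    have hd : DifferentiableAt ℝ (fderiv ℝ φ) z :=
      ((φ.smooth 2).fderiv_right (m := 1) (by norm_num)).differentiable (by norm_num) z
    have hs : IsSymmSndFDerivAt ℝ φ z :=
      (φ.smooth 2).contDiffAt.isSymmSndFDerivAt (by simp)
    rw [h, h, fderiv_clm_apply hd (by fun_prop), fderiv_clm_apply hd (by fun_prop)]
    simpa using hs e' e
  simp [this]

theorem smulLeft_commute (L L' : Phase d →L[ℝ] ℂ) :
    (TemperedDistribution.smulLeftCLM ℂ L : DistOp d) * TemperedDistribution.smulLeftCLM ℂ L' =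
      TemperedDistribution.smulLeftCLM ℂ L' * TemperedDistribution.smulLeftCLM ℂ L := by
  ext u φ
  simp [L.hasTemperateGrowth, L'.hasTemperateGrowth, mul_comm]

/-- The Heisenberg relations: derivatives commute with each other, multiplications commute with each
other, and a derivative and a linear form commute up to a constant. -/
theorem letter_commutator (a : ℂ) (e : Phase d) (b : ℂ) (L : Phase d →L[ℝ] ℂ)
    (a' : ℂ) (e' : Phase d) (b' : ℂ) (L' : Phase d →L[ℝ] ℂ) :
    letter a e b L * letter a' e' b' L' - letter a' e' b' L' * letter a e b L =
      algebraMap ℂ (DistOp d) (a * b' * L' e - b * a' * L e') := by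
  simp only [letter, add_mul, mul_add, smul_mul_smul, lineDeriv_commutator, lineDeriv_commute e e',
    smulLeft_commute L L', Algebra.algebraMap_eq_smul_one, sub_smul, smul_add, smul_smul,
    mul_comm a' a, mul_comm b' b, mul_comm a' b, mul_comm b' a]
  abel

theorem dX_eq (j : Fin d) :
    dX j = letter 1 ((EuclideanSpace.single j (1 : ℝ), 0) : Phase d) 0 0 := by
  simp [dX, letter]

theorem dV_eq (j : Fin d) :
    dV j = letter 1 ((0, EuclideanSpace.single j (1 : ℝ)) : Phase d) 0 0 := by
  simp [dV, letter]

theorem vPlus_eq (ε : ℝ) (j : Fin d) : vPlus ε j =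
    letter ε ((EuclideanSpace.single j (1 : ℝ), 0) : Phase d) (2 * Complex.I) (coordV j) := rfl

theorem vMinus_eq (ε : ℝ) (j : Fin d) : vMinus ε j =
    letter ε ((EuclideanSpace.single j (1 : ℝ), 0) : Phase d) (-(2 * Complex.I)) (coordV j) := by
  rw [vMinus, sub_eq_add_neg, ← neg_smul]; rfl

theorem xPlus_eq (ε : ℝ) (j : Fin d) : xPlus ε j =
    letter ε ((0, EuclideanSpace.single j (1 : ℝ)) : Phase d) (2 * Complex.I) (coordX j) := rfl

theorem xMinus_eq (ε : ℝ) (j : Fin d) : xMinus ε j =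
    letter ε ((0, EuclideanSpace.single j (1 : ℝ)) : Phase d) (-(2 * Complex.I)) (coordX j) := by
  rw [xMinus, sub_eq_add_neg, ← neg_smul]; rfl

theorem letter_commute {a : ℂ} {e : Phase d} {b : ℂ} {L : Phase d →L[ℝ] ℂ}
    {a' : ℂ} {e' : Phase d} {b' : ℂ} {L' : Phase d →L[ℝ] ℂ}
    (h : a * b' * L' e - b * a' * L e' = 0) :
    Commute (letter a e b L) (letter a' e' b' L') := by
  rw [commute_iff_eq, ← sub_eq_zero, letter_commutator, h, map_zero]

section Commute
variable (ε : ℝ) (i j : Fin d)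

theorem dX_commute : Commute (dX i) (dX j : DistOp d) := by
  simp only [dX_eq]; exact letter_commute (by simp)

theorem dV_commute : Commute (dV i) (dV j : DistOp d) := by
  simp only [dV_eq]; exact letter_commute (by simp)

theorem vPlus_commute : Commute (vPlus ε i) (vPlus ε j : DistOp d) := by
  simp only [vPlus_eq]; exact letter_commute (by simp)

theorem vMinus_commute : Commute (vMinus ε i) (vMinus ε j : DistOp d) := by
  simp only [vMinus_eq]; exact letter_commute (by simp)

theorem xPlus_commute : Commute (xPlus ε i) (xPlus ε j : DistOp d) := by
  simp only [xPlus_eq]; exact letter_commute (by simp)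

theorem xMinus_commute : Commute (xMinus ε i) (xMinus ε j : DistOp d) := by
  simp only [xMinus_eq]; exact letter_commute (by simp)

end Commute

/-- A family of first order operators. -/
def IsLetterFamily {ι : Type*} (a : ι → DistOp d) : Prop :=
  ∀ i, ∃ (α : ℂ) (e : Phase d) (b : ℂ) (L : Phase d →L[ℝ] ℂ), a i = letter α e b L

theorem isLetterFamily_dX : IsLetterFamily (dX : Fin d → DistOp d) := fun j => ⟨_, _, _, _, dX_eq j⟩
theorem isLetterFamily_dV : IsLetterFamily (dV : Fin d → DistOp d) := fun j => ⟨_, _, _, _, dV_eq j⟩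
theorem isLetterFamily_vPlus (ε : ℝ) : IsLetterFamily (vPlus ε : Fin d → DistOp d) :=
  fun j => ⟨_, _, _, _, vPlus_eq ε j⟩
theorem isLetterFamily_vMinus (ε : ℝ) : IsLetterFamily (vMinus ε : Fin d → DistOp d) :=
  fun j => ⟨_, _, _, _, vMinus_eq ε j⟩
theorem isLetterFamily_xPlus (ε : ℝ) : IsLetterFamily (xPlus ε : Fin d → DistOp d) :=
  fun j => ⟨_, _, _, _, xPlus_eq ε j⟩
theorem isLetterFamily_xMinus (ε : ℝ) : IsLetterFamily (xMinus ε : Fin d → DistOp d) :=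
  fun j => ⟨_, _, _, _, xMinus_eq ε j⟩

theorem IsLetterFamily.commutator {ι κ : Type*} {a : ι → DistOp d} {b : κ → DistOp d}
    (ha : IsLetterFamily a) (hb : IsLetterFamily b) (i : ι) (j : κ) :
    ∃ c : ℂ, a i * b j - b j * a i = algebraMap ℂ (DistOp d) c := by
  obtain ⟨_, _, _, _, h1⟩ := ha i
  obtain ⟨_, _, _, _, h2⟩ := hb j
  exact ⟨_, by rw [h1, h2, letter_commutator]⟩

theorem IsLetterFamily.commute {ι κ : Type*} {a : ι → DistOp d} {b : κ → DistOp d}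
    (ha : IsLetterFamily a) (hb : IsLetterFamily b) :
    Commute (letterSpan a) (letterSpan b) :=
  letterSpan_commute (ha.commutator hb)

/-! ### The space `𝓗^m_r` -/

/-- The operators of which the norm of `𝓗^m_r` is made, up to linear combinations. -/
def opSpan (d : ℕ) (ε : ℝ) (m r : ℕ) : Submodule ℂ (DistOp d) :=
  (letterSpan (vPlus ε) + letterSpan (xMinus ε)) ^ r *
    (letterSpan (vMinus ε) + letterSpan (xPlus ε)) ^ r * (letterSpan dX + letterSpan dV) ^ m

/-- The index set of the sum that defines the norm of `𝓗^m_r`. -/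
abbrev Idx (d m r : ℕ) : Type := multiIdx d m × multiIdx d r × multiIdx d r

/-- The operator `V_+^β X_-^{β'} V_-^γ X_+^{γ'} ∂^α`. -/
def word (ε : ℝ) {m r : ℕ} (i : Idx d m r) : DistOp d :=
  multiPow (vPlus ε) i.2.1.1.1 * multiPow (xMinus ε) i.2.1.1.2 *
    (multiPow (vMinus ε) i.2.2.1.1 * multiPow (xPlus ε) i.2.2.1.2) *
    (multiPow dX i.1.1.1 * multiPow dV i.1.1.2)

theorem word_mem (ε : ℝ) {m r : ℕ} (i : Idx d m r) : word ε i ∈ opSpan d ε m r :=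
  Submodule.mul_mem_mul (Submodule.mul_mem_mul
    (monomialProd_mul_mem (vPlus ε) (xMinus ε) i.2.1.2)
    (monomialProd_mul_mem (vMinus ε) (xPlus ε) i.2.2.2)) (monomialProd_mul_mem dX dV i.1.2)

/-- With `word_mem` this identifies `opSpan` with the span of the operators in the norm. From here
on only the submodule matters, and it is insensitive to the order of the letters. -/
theorem opSpan_le (ε : ℝ) (m r : ℕ) :
    opSpan d ε m r ≤ Submodule.span ℂ (Set.range (word (d := d) (m := m) (r := r) ε)) := by
  have h1 := add_pow_le_span (vPlus ε) (xMinus ε) (vPlus_commute (d := d) ε) (xMinus_commute ε)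
    ((isLetterFamily_vPlus ε).commutator (isLetterFamily_xMinus ε)) r
  have h2 := add_pow_le_span (vMinus ε) (xPlus ε) (vMinus_commute (d := d) ε) (xPlus_commute ε)
    ((isLetterFamily_vMinus ε).commutator (isLetterFamily_xPlus ε)) r
  have h3 := add_pow_le_span dX dV (dX_commute (d := d)) dV_commute
    (isLetterFamily_dX.commutator isLetterFamily_dV) m
  refine (mul_le_mul' (mul_le_mul' h1 h2) h3).trans ?_
  rw [Submodule.span_mul_span, Submodule.span_mul_span, Submodule.span_le]
  rintro _ ⟨_, ⟨_, ⟨b, hb, rfl⟩, _, ⟨c, hc, rfl⟩, rfl⟩, _, ⟨a, ha, rfl⟩, rfl⟩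
  exact Submodule.subset_span ⟨(⟨a, ha⟩, ⟨b, hb⟩, ⟨c, hc⟩), rfl⟩

/-- The embedding of `L²` into the tempered distributions. -/
def toDist (d : ℕ) : L2Phase d →L[ℂ] Dist d := Lp.toTemperedDistributionCLM ℂ volume 2

theorem toDist_eq (f : L2Phase d) : toDist d f = (f : Dist d) := rfl

theorem toDist_apply (f : L2Phase d) (φ : 𝓢(Phase d, ℂ)) :
    toDist d f φ = ∫ z, f z * φ z := by
  rw [toDist_eq, Lp.toTemperedDistribution_apply]
  simp only [smul_eq_mul, mul_comm]

instance instIsAddHaarMeasurePhase (d : ℕ) : (volume : Measure (Phase d)).IsAddHaarMeasure :=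
  Measure.prod.instIsAddHaarMeasure volume volume

theorem toDist_injective : Function.Injective (toDist d) :=
  LinearMap.ker_eq_bot.1 Lp.ker_toTemperedDistributionCLM_eq_bot

/-- The tempered distributions that are square integrable functions. -/
def l2Range (d : ℕ) : Submodule ℂ (Dist d) := LinearMap.range (toDist d : L2Phase d →ₗ[ℂ] Dist d)

theorem l2Norm_toDist (g : L2Phase d) : l2Norm (toDist d g) = ‖g‖ₑ := by
  refine le_antisymm (iInf₂_le (f := fun h (_ : toDist d h = toDist d g) => ‖h‖ₑ) g rfl) (le_iInf₂ fun h hh => ?_)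
  rw [toDist_injective (d := d) hh]

theorem l2Norm_lt_top {u : Dist d} : l2Norm u < ⊤ ↔ u ∈ l2Range d := by
  constructor
  · intro h
    simp only [l2Norm, iInf_lt_iff] at h
    obtain ⟨g, hg, -⟩ := h
    exact ⟨g, hg⟩
  · rintro ⟨g, rfl⟩
    exact (l2Norm_toDist g).trans_lt enorm_lt_top

theorem hNorm_eq_sum (ε : ℝ) (m r : ℕ) (u : Dist d) :
    hNorm ε m r u = ∑ i : Idx d m r, l2Norm (word ε i u) := by
  rw [Fintype.sum_prod_type, hNorm, ← Finset.sum_coe_sort]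
  refine Finset.sum_congr rfl fun a _ => ?_
  rw [Fintype.sum_prod_type, hNormZero, ← Finset.sum_coe_sort]
  refine Finset.sum_congr rfl fun b _ => ?_
  rw [← Finset.sum_coe_sort]
  rfl

/-- Evaluation of an operator at a given distribution. -/
def evalAt (u : Dist d) : DistOp d →ₗ[ℂ] Dist d where
  toFun D := D u
  map_add' _ _ := rfl
  map_smul' _ _ := rfl

theorem memH_iff_word {ε : ℝ} {m r : ℕ} {f : L2Phase d} :
    MemH ε m r f ↔ ∀ i : Idx d m r, word ε i (toDist d f) ∈ l2Range d := by
  rw [MemH, hNorm_eq_sum, ENNReal.sum_lt_top]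
  simp [← toDist_eq, l2Norm_lt_top]

/-- The square integrable distributions form a subspace, so a condition on the words extends to
their linear span. -/
theorem memH_iff {ε : ℝ} {m r : ℕ} {f : L2Phase d} :
    MemH ε m r f ↔ ∀ D ∈ opSpan d ε m r, D (toDist d f) ∈ l2Range d := by
  rw [memH_iff_word]
  refine ⟨fun h D hD => ?_, fun h i => h _ (word_mem ε i)⟩
  have : opSpan d ε m r ≤ (l2Range d).comap
      (evalAt (toDist d f)) := by
    refine (opSpan_le ε m r).trans (Submodule.span_le.2 ?_)
    rintro _ ⟨i, rfl⟩
    exact h i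
  exact this hD

/-! ### `𝓗^m_r` as a Banach space -/

section Lift

variable {𝕜 : Type*} [NontriviallyNormedField 𝕜] {X Y H K : Type*}
  [NormedAddCommGroup X] [NormedSpace 𝕜 X] [CompleteSpace X]
  [NormedAddCommGroup Y] [NormedSpace 𝕜 Y]
  [NormedAddCommGroup H] [NormedSpace 𝕜 H] [CompleteSpace H]
  [NormedAddCommGroup K] [NormedSpace 𝕜 K]

/-- Factorisation of a continuous linear map through an injective one, by the closed graph
theorem. -/
theorem exists_lift {J : H →L[𝕜] K} (hJ : Function.Injective J) (Φ : X →L[𝕜] K)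
    (h : ∀ x, ∃ y, J y = Φ x) : ∃ Ψ : X →L[𝕜] H, ∀ x, J (Ψ x) = Φ x := by
  choose f hf using h
  let L : X →ₗ[𝕜] H :=
    { toFun := f
      map_add' := fun x y => hJ (by simp [hf])
      map_smul' := fun c x => hJ (by simp [hf]) }
  refine ⟨ContinuousLinearMap.ofSeqClosedGraph (g := L) fun u x y hx hy => hJ ?_, hf⟩
  -- Closedness of the graph: along the sequence, J of the values equals Φ, and both sides have
  -- limits because J and Φ are continuous.
  have h1 := (J.continuous.tendsto y).comp hy
  have h2 := (Φ.continuous.tendsto x).comp hx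
  have h3 : J ∘ (L ∘ u) = Φ ∘ u := funext fun n => hf (u n)
  rw [h3] at h1
  exact (tendsto_nhds_unique h1 h2).trans (hf x).symm

/-- The closed graph theorem used twice: first for each fixed x, then for the injective map "compose
with J" between spaces of operators. A bilinear map into K with values in the range of J is thereby
bounded into H, without an explicit estimate. -/
theorem exists_lift₂ {J : H →L[𝕜] K} (hJ : Function.Injective J) [CompleteSpace Y]
    (Φ : X →L[𝕜] Y →L[𝕜] K) (h : ∀ x y, ∃ z, J z = Φ x y) :
    ∃ Ψ : X →L[𝕜] Y →L[𝕜] H, ∀ x y, J (Ψ x y) = Φ x y := by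
  have hJ' : Function.Injective (ContinuousLinearMap.compL 𝕜 Y H K J) := fun S T hST =>
    ContinuousLinearMap.ext fun y => hJ (DFunLike.congr_fun hST y)
  obtain ⟨Ψ, hΨ⟩ := exists_lift hJ' Φ fun x => by
    obtain ⟨Ψ, hΨ⟩ := exists_lift hJ (Φ x) (h x)
    exact ⟨Ψ, ContinuousLinearMap.ext hΨ⟩
  exact ⟨Ψ, fun x y => DFunLike.congr_fun (hΨ x) y⟩

end Lift

/-- `𝓗^m_r` as a space of families of square integrable functions: a function together with its
images under the operators of which the norm is made. -/
def hSubmodule (d : ℕ) (ε : ℝ) (m r : ℕ) :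
    Submodule ℂ (L2Phase d × (Idx d m r → L2Phase d)) where
  carrier := {p | ∀ i, toDist d (p.2 i) = word ε i (toDist d p.1)}
  add_mem' {p q} hp hq i := by simp [hp i, hq i]
  zero_mem' i := by simp
  smul_mem' c p hp i := by simp [hp i]

/-- The words are continuous on tempered distributions, and L² convergence implies distributional
convergence, so the defining relations pass to limits. Completeness of 𝓗^m_r rests on this. -/
theorem isClosed_hSubmodule (d : ℕ) (ε : ℝ) (m r : ℕ) :
    IsClosed (hSubmodule d ε m r : Set (L2Phase d × (Idx d m r → L2Phase d))) := by
  have : (hSubmodule d ε m r : Set (L2Phase d × (Idx d m r → L2Phase d))) =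
      ⋂ i, {p | toDist d (p.2 i) = word ε i (toDist d p.1)} := by
    ext p; simp [hSubmodule]
  rw [this]
  exact isClosed_iInter fun i => isClosed_eq (by fun_prop) (by fun_prop)

/-- The Banach space `𝓗^m_r`. -/
abbrev HSpace (d : ℕ) (ε : ℝ) (m r : ℕ) : Type := hSubmodule d ε m r

instance instCompleteSpaceHSpace (d : ℕ) (ε : ℝ) (m r : ℕ) : CompleteSpace (HSpace d ε m r) :=
  (isClosed_hSubmodule d ε m r).completeSpace_coe

/-- The embedding `𝓗^m_r ⊆ L²`. -/
def toL2 (d : ℕ) (ε : ℝ) (m r : ℕ) : HSpace d ε m r →L[ℂ] L2Phase d :=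
  ContinuousLinearMap.fst ℂ _ _ ∘L (hSubmodule d ε m r).subtypeL

variable {ε : ℝ} {m r : ℕ}

theorem toDist_snd (p : HSpace d ε m r) (i : Idx d m r) :
    toDist d (p.1.2 i) = word ε i (toDist d (toL2 d ε m r p)) := p.2 i

theorem toL2_injective : Function.Injective (toL2 d ε m r) := by
  intro p q h
  refine Subtype.ext (Prod.ext h (funext fun i => toDist_injective (d := d) ?_))
  rw [toDist_snd, toDist_snd, h]

theorem memH_toL2 (p : HSpace d ε m r) : MemH ε m r (toL2 d ε m r p) :=
  memH_iff_word.2 fun i => ⟨_, toDist_snd p i⟩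

theorem exists_toL2_eq {f : L2Phase d} (hf : MemH ε m r f) : ∃ p, toL2 d ε m r p = f := by
  choose g hg using memH_iff_word.1 hf
  exact ⟨⟨(f, g), hg⟩, rfl⟩

theorem hNorm_toL2 (p : HSpace d ε m r) :
    hNorm ε m r (toDist d (toL2 d ε m r p)) = ∑ i, ‖p.1.2 i‖ₑ := by
  rw [hNorm_eq_sum]
  exact Finset.sum_congr rfl fun i _ => by rw [← toDist_snd, l2Norm_toDist]

theorem hNorm_toL2_le (p : HSpace d ε m r) :
    hNorm ε m r (toDist d (toL2 d ε m r p)) ≤ Fintype.card (Idx d m r) * ‖p‖ₑ := by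
  rw [hNorm_toL2]
  refine (Finset.sum_le_card_nsmul _ _ ‖p‖ₑ fun i _ => ?_).trans (by simp)
  rw [enorm_le_iff_norm_le]
  exact (norm_le_pi_norm p.1.2 i).trans (norm_snd_le p.1)

theorem enorm_le_hNorm (p : HSpace d ε m r) :
    ‖p‖ₑ ≤ hNorm ε m r (toDist d (toL2 d ε m r p)) := by
  -- The word with all exponents zero is the identity, so the sum over the words also controls the
  -- function itself.
  have h0 : ∀ n, ((0, 0) : (Fin d → ℕ) × (Fin d → ℕ)) ∈ multiIdx d n :=
    fun n => (mem_multiIdx _).2 (by simp)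
  have h1 : p.1.2 (⟨_, h0 m⟩, ⟨_, h0 r⟩, ⟨_, h0 r⟩) = p.1.1 :=
    toDist_injective (d := d) (by rw [toDist_snd]; simp [word, multiPow]; rfl)
  rw [hNorm_toL2]
  have hle : ∀ i, ‖p.1.2 i‖ₑ ≤ ∑ i, ‖p.1.2 i‖ₑ := fun i =>
    Finset.single_le_sum (f := fun i => ‖p.1.2 i‖ₑ) (fun _ _ => zero_le) (Finset.mem_univ i)
  have hfin : ∑ i, ‖p.1.2 i‖ₑ ≠ ⊤ := by simp [ENNReal.sum_eq_top]
  have hle' : ∀ i, ‖p.1.2 i‖ ≤ (∑ i, ‖p.1.2 i‖ₑ).toReal := fun i => by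
    simpa using ENNReal.toReal_mono hfin (hle i)
  rw [← ofReal_norm]
  refine ENNReal.ofReal_le_of_le_toReal ?_
  refine max_le (h1 ▸ hle' _) ((pi_norm_le_iff_of_nonneg ENNReal.toReal_nonneg).2 hle')

/-- The sum norm of the statement and the maximum norm of `HSpace` differ at most by the number of
words, so they define the same convergence. -/
theorem tendsto_hNorm_iff {α : Type*} {l : Filter α} {F : α → HSpace d ε m r}
    {p : HSpace d ε m r} :
    Filter.Tendsto (fun s => hNorm ε m r
      ((toL2 d ε m r (F s) - toL2 d ε m r p : L2Phase d) : Dist d)) l (𝓝 0) ↔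
      Filter.Tendsto F l (𝓝 p) := by
  rw [tendsto_iff_edist_tendsto_0]
  have h : ∀ s, edist (F s) p = ‖F s - p‖ₑ := fun s => by rw [edist_eq_enorm_sub]
  simp only [h, ← map_sub, ← toDist_eq]
  constructor
  · intro H
    exact tendsto_of_tendsto_of_tendsto_of_le_of_le tendsto_const_nhds H (fun _ => zero_le)
      fun s => enorm_le_hNorm _
  · intro H
    have := ENNReal.Tendsto.const_mul (a := (Fintype.card (Idx d m r) : ℝ≥0∞)) H
      (Or.inr (ENNReal.natCast_ne_top _))
    rw [mul_zero] at this
    exact tendsto_of_tendsto_of_tendsto_of_le_of_le tendsto_const_nhds this (fun _ => zero_le)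
      fun s => hNorm_toL2_le _

/-! ### The partial Fourier transform in the position variable -/

/-- The bilinear pairing `∫ f g` on `L²`. -/
def pairL2 (d : ℕ) : L2Phase d →L[ℂ] L2Phase d →L[ℂ] ℂ :=
  (ContinuousLinearMap.mul ℂ ℂ).lpPairing volume 2 2

theorem pairL2_apply (f g : L2Phase d) : pairL2 d f g = ∫ z, f z * g z := by
  simp [pairL2, ContinuousLinearMap.lpPairing_eq_integral]

theorem pairL2_comm (f g : L2Phase d) : pairL2 d f g = pairL2 d g f := by
  simp only [pairL2_apply, mul_comm]

/-- Schwartz functions as elements of `L²`. -/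
def schwartzL2 (d : ℕ) : 𝓢(Phase d, ℂ) →L[ℂ] L2Phase d := SchwartzMap.toLpCLM ℂ ℂ 2 volume

theorem coeFn_schwartzL2 (φ : 𝓢(Phase d, ℂ)) : schwartzL2 d φ =ᵐ[volume] φ :=
  φ.coeFn_toLp 2 volume

theorem denseRange_schwartzL2 : DenseRange (schwartzL2 d) :=
  SchwartzMap.denseRange_toLpCLM ENNReal.ofNat_ne_top

theorem pairL2_schwartz (f : L2Phase d) (φ : 𝓢(Phase d, ℂ)) :
    pairL2 d f (schwartzL2 d φ) = toDist d f φ := by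
  rw [pairL2_apply, toDist_apply]
  refine integral_congr_ae ?_
  filter_upwards [coeFn_schwartzL2 φ] with z hz
  rw [hz]

theorem ext_pairL2 {f g : L2Phase d}
    (h : ∀ φ : 𝓢(Phase d, ℂ), pairL2 d f (schwartzL2 d φ) = pairL2 d g (schwartzL2 d φ)) :
    f = g :=
  toDist_injective (d := d) (by ext φ; simpa only [pairL2_schwartz] using h φ)

theorem norm_fst_le_norm_prodMk (x v : Pos d) : ‖x‖ ≤ ‖(x, v)‖ := norm_fst_le (x, v)

theorem hasTemperateGrowth_prodMk_left (v : Pos d) :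
    Function.HasTemperateGrowth (fun x : Pos d => (x, v)) := by
  have h1 := (ContinuousLinearMap.inl ℝ (Pos d) (Pos d)).hasTemperateGrowth
  have h2 := Function.HasTemperateGrowth.const (E := Pos d) ((0, v) : Phase d)
  convert h1.add h2 using 1
  ext x <;> simp

/-- The restriction of a Schwartz function on phase space to a fixed velocity. -/
def slice (φ : 𝓢(Phase d, ℂ)) (v : Pos d) : 𝓢(Pos d, ℂ) :=
  SchwartzMap.compCLM ℂ (hasTemperateGrowth_prodMk_left v)
    ⟨1, 1, fun x => by
      have := norm_fst_le_norm_prodMk x v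
      rw [pow_one, one_mul]; linarith⟩ φ

@[simp] theorem slice_apply (φ : 𝓢(Phase d, ℂ)) (v x : Pos d) : slice φ v x = φ (x, v) := rfl

/-- The partial Fourier integral in the position variable. -/
def fourierX (f : Phase d → ℂ) (z : Phase d) : ℂ := 𝓕 (fun x => f (x, z.2)) z.1

theorem fourierX_schwartz (φ : 𝓢(Phase d, ℂ)) (z : Phase d) :
    fourierX φ z = (𝓕 (slice φ z.2)) z.1 := rfl

theorem aestronglyMeasurable_fourierX {f : Phase d → ℂ} (hf : AEStronglyMeasurable f) :
    AEStronglyMeasurable (fourierX f) := by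
  have hq : Measure.QuasiMeasurePreserving (fun p : Phase d × Pos d => (p.2, p.1.2)) := by
    have h1 : Measure.QuasiMeasurePreserving (fun p : Phase d × Pos d => p.1.2) :=
      Measure.quasiMeasurePreserving_snd.comp Measure.quasiMeasurePreserving_fst
    have : (fun p : Phase d × Pos d => (p.2, p.1.2)) =
        Prod.swap ∘ (Prod.map Prod.snd id) := rfl
    rw [this]
    exact (Measure.measurePreserving_swap.quasiMeasurePreserving).comp
      (MeasureTheory.QuasiMeasurePreserving.prodMap Measure.quasiMeasurePreserving_snd
        (Measure.QuasiMeasurePreserving.id _))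
  have h := (hf.comp_quasiMeasurePreserving hq)
  have hc : Continuous fun p : Phase d × Pos d => (𝐞 (-⟪p.2, p.1.1⟫_ℝ) : Circle) :=
    Real.continuous_fourierChar.comp (by fun_prop)
  have h' : AEStronglyMeasurable (fun p : Phase d × Pos d =>
      𝐞 (-⟪p.2, p.1.1⟫_ℝ) • f (p.2, p.1.2)) :=
    hc.aestronglyMeasurable.smul h
  have := h'.integral_prod_right'
  have he : fourierX f = fun z : Phase d => ∫ x, 𝐞 (-⟪x, z.1⟫_ℝ) • f (x, z.2) := by
    ext z; rw [fourierX, Real.fourier_eq]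
  rw [he]
  exact this

theorem eLpNorm_two_rpow {α : Type*} [MeasurableSpace α] (μ : Measure α) (f : α → ℂ) :
    eLpNorm f 2 μ ^ (2 : ℝ) = ∫⁻ z, ‖f z‖ₑ ^ (2 : ℝ) ∂μ := by
  have := eLpNorm_nnreal_pow_eq_lintegral (μ := μ) (f := f) (p := 2) two_ne_zero
  simpa using this

/-- Plancherel's theorem on each slice of fixed velocity, integrated over the velocity by Tonelli's
theorem. -/
theorem eLpNorm_fourierX (φ : 𝓢(Phase d, ℂ)) :
    eLpNorm (fourierX φ) 2 volume = eLpNorm φ 2 volume := by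
  have hm := aestronglyMeasurable_fourierX φ.continuous.aestronglyMeasurable
  have hinj : Function.Injective fun x : ℝ≥0∞ => x ^ (2 : ℝ) :=
    ENNReal.rpow_left_injective two_ne_zero
  refine hinj ?_
  simp only [eLpNorm_two_rpow]
  rw [Measure.volume_eq_prod, lintegral_prod_symm _ (by fun_prop),
    lintegral_prod_symm _ (by fun_prop)]
  refine lintegral_congr fun v => ?_
  have h1 : eLpNorm (𝓕 (slice φ v) : 𝓢(Pos d, ℂ)) 2 volume = eLpNorm (slice φ v) 2 volume := by
    have := SchwartzMap.norm_fourier_toL2_eq (slice φ v)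
    rw [SchwartzMap.norm_toLp, SchwartzMap.norm_toLp] at this
    have ht : ∀ ψ : 𝓢(Pos d, ℂ), eLpNorm ψ 2 volume ≠ ⊤ := fun ψ =>
      (ψ.memLp 2 volume).eLpNorm_ne_top
    exact (ENNReal.toReal_eq_toReal_iff' (ht _) (ht _)).1 this
  have h2 := congrArg (fun x : ℝ≥0∞ => x ^ (2 : ℝ)) h1
  simp only [eLpNorm_two_rpow, slice_apply] at h2
  simp only [fourierX_schwartz]
  exact h2

theorem memLp_fourierX (φ : 𝓢(Phase d, ℂ)) : MemLp (fourierX φ) 2 volume := by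
  refine ⟨aestronglyMeasurable_fourierX φ.continuous.aestronglyMeasurable, ?_⟩
  rw [eLpNorm_fourierX]
  exact (φ.memLp 2 volume).eLpNorm_lt_top

/-- The partial Fourier transform of Schwartz functions, with values in `L²`. -/
def fourierXSchwartz (d : ℕ) : 𝓢(Phase d, ℂ) →ₗ[ℂ] L2Phase d where
  toFun φ := (memLp_fourierX φ).toLp _
  map_add' φ ψ := by
    rw [← MemLp.toLp_add]
    congr 1
    ext z
    simp only [fourierX_schwartz, Pi.add_apply]
    rw [show slice (φ + ψ) z.2 = slice φ z.2 + slice ψ z.2 from rfl, FourierTransform.fourier_add]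
    rfl
  map_smul' c φ := by
    rw [RingHom.id_apply, ← MemLp.toLp_const_smul]
    congr 1
    ext z
    simp only [fourierX_schwartz, Pi.smul_apply]
    rw [show slice (c • φ) z.2 = c • slice φ z.2 from rfl, FourierTransform.fourier_smul]
    rfl

theorem norm_fourierXSchwartz (φ : 𝓢(Phase d, ℂ)) :
    ‖fourierXSchwartz d φ‖ = ‖schwartzL2 d φ‖ := by
  have h1 : ‖fourierXSchwartz d φ‖ = (eLpNorm (fourierX φ) 2 volume).toReal := Lp.norm_toLp (fourierX φ) (memLp_fourierX φ)
  have h2 : ‖schwartzL2 d φ‖ = (eLpNorm φ 2 volume).toReal := SchwartzMap.norm_toLp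
  rw [h1, h2, eLpNorm_fourierX]

/-- The partial Fourier transform in the position variable, on `L²`. -/
def fourierL2 (d : ℕ) : L2Phase d →L[ℂ] L2Phase d :=
  (fourierXSchwartz d).extendOfNorm (schwartzL2 d).toLinearMap

theorem fourierL2_schwartz (φ : 𝓢(Phase d, ℂ)) :
    fourierL2 d (schwartzL2 d φ) = fourierXSchwartz d φ :=
  LinearMap.extendOfNorm_eq denseRange_schwartzL2
    ⟨1, fun φ => by rw [one_mul]; exact (norm_fourierXSchwartz φ).le⟩ φ

theorem coeFn_fourierL2_schwartz (φ : 𝓢(Phase d, ℂ)) :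
    fourierL2 d (schwartzL2 d φ) =ᵐ[volume] fourierX φ := by
  rw [fourierL2_schwartz]
  exact (memLp_fourierX φ).coeFn_toLp

theorem norm_fourierL2 (f : L2Phase d) : ‖fourierL2 d f‖ = ‖f‖ := by
  refine denseRange_schwartzL2.induction_on (p := fun f => ‖fourierL2 d f‖ = ‖f‖) f
    (isClosed_eq (by fun_prop) (by fun_prop)) fun φ => ?_
  rw [fourierL2_schwartz, norm_fourierXSchwartz]

theorem integrable_mul_of_memLp {α : Type*} [MeasurableSpace α] {μ : Measure α} {f g : α → ℂ}
    (hf : MemLp f 2 μ) (hg : MemLp g 2 μ) : Integrable (fun z => f z * g z) μ :=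
  hf.integrable_mul hg

theorem integral_phase_eq {f : Phase d → ℂ} (hf : Integrable f) :
    ∫ z, f z = ∫ v, ∫ x, f (x, v) := by
  rw [Measure.volume_eq_prod] at hf ⊢
  exact integral_prod_symm f hf

theorem pairL2_fourierL2_schwartz (φ ψ : 𝓢(Phase d, ℂ)) :
    pairL2 d (fourierL2 d (schwartzL2 d φ)) (schwartzL2 d ψ) =
      pairL2 d (schwartzL2 d φ) (fourierL2 d (schwartzL2 d ψ)) := by
  have h1 : pairL2 d (fourierL2 d (schwartzL2 d φ)) (schwartzL2 d ψ) =
      ∫ z, fourierX φ z * ψ z := by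
    rw [pairL2_apply]
    refine integral_congr_ae ?_
    filter_upwards [coeFn_schwartzL2 ψ, coeFn_fourierL2_schwartz φ] with z h1 h2
    rw [h1, h2]
  have h2 : pairL2 d (schwartzL2 d φ) (fourierL2 d (schwartzL2 d ψ)) =
      ∫ z, φ z * fourierX ψ z := by
    rw [pairL2_apply]
    refine integral_congr_ae ?_
    filter_upwards [coeFn_schwartzL2 φ, coeFn_fourierL2_schwartz ψ] with z h1 h2
    rw [h1, h2]
  rw [h1, h2, integral_phase_eq (integrable_mul_of_memLp (memLp_fourierX φ) (ψ.memLp 2)),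
    integral_phase_eq (integrable_mul_of_memLp (φ.memLp 2) (memLp_fourierX ψ))]
  congr 1
  ext v
  exact SchwartzMap.integral_fourier_mul_eq (slice φ v) (slice ψ v)

theorem pairL2_fourierL2 (f g : L2Phase d) :
    pairL2 d (fourierL2 d f) g = pairL2 d f (fourierL2 d g) := by
  refine denseRange_schwartzL2.induction_on₂
    (p := fun f g => pairL2 d (fourierL2 d f) g = pairL2 d f (fourierL2 d g))
    (isClosed_eq (by fun_prop) (by fun_prop)) (fun φ ψ => pairL2_fourierL2_schwartz φ ψ) f g

/-- Composition with a measure preserving map of phase space. -/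
def compL2 (g : Phase d → Phase d) (hg : MeasurePreserving g) : L2Phase d →L[ℂ] L2Phase d :=
  (Lp.compMeasurePreservingₗᵢ ℂ g hg).toContinuousLinearMap

theorem coeFn_compL2 (g : Phase d → Phase d) (hg : MeasurePreserving g) (f : L2Phase d) :
    compL2 g hg f =ᵐ[volume] f ∘ g :=
  Lp.coeFn_compMeasurePreserving f hg

/-- The reflection `(x, v) ↦ (-x, v)`. -/
def reflX (z : Phase d) : Phase d := (-z.1, z.2)

theorem measurePreserving_reflX : MeasurePreserving (reflX : Phase d → Phase d) :=
  (Measure.measurePreserving_neg (volume : Measure (Pos d))).prod (MeasurePreserving.id _)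

/-- The inverse of the partial Fourier transform in the position variable. -/
def fourierInvL2 (d : ℕ) : L2Phase d →L[ℂ] L2Phase d :=
  compL2 reflX measurePreserving_reflX ∘L fourierL2 d

/-- Slicewise, this combines the self-transposedness of the Fourier transform with Fourier
inversion. It yields that `fourierInvL2` is a right inverse; injectivity of the isometry `fourierL2`
then makes it two-sided. -/
theorem pairL2_fourierL2_fourierInvL2 (f g : L2Phase d) :
    pairL2 d (fourierL2 d f) (fourierInvL2 d g) = pairL2 d f g := by
  refine denseRange_schwartzL2.induction_on₂
    (p := fun f g => pairL2 d (fourierL2 d f) (fourierInvL2 d g) = pairL2 d f g)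
    (isClosed_eq (by fun_prop) (by fun_prop)) (fun φ ψ => ?_) f g
  have hm : MemLp (fourierX ψ ∘ reflX) 2 volume :=
    (memLp_fourierX ψ).comp_measurePreserving measurePreserving_reflX
  have h1 : pairL2 d (fourierL2 d (schwartzL2 d φ)) (fourierInvL2 d (schwartzL2 d ψ)) =
      ∫ z, fourierX φ z * (fourierX ψ ∘ reflX) z := by
    rw [pairL2_apply]
    refine integral_congr_ae ?_
    filter_upwards [coeFn_compL2 reflX measurePreserving_reflX (fourierL2 d (schwartzL2 d ψ)),
      coeFn_fourierL2_schwartz φ, measurePreserving_reflX.quasiMeasurePreserving.ae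
        (coeFn_fourierL2_schwartz ψ)] with z h1 h2 h3
    rw [h2, fourierInvL2, ContinuousLinearMap.comp_apply, h1, Function.comp_apply,
      Function.comp_apply, h3]
  have h2 : pairL2 d (schwartzL2 d φ) (schwartzL2 d ψ) = ∫ z, φ z * ψ z := by
    rw [pairL2_apply]
    refine integral_congr_ae ?_
    filter_upwards [coeFn_schwartzL2 φ, coeFn_schwartzL2 ψ] with z h1 h2
    rw [h1, h2]
  rw [h1, h2, integral_phase_eq (integrable_mul_of_memLp (memLp_fourierX φ) hm),
    integral_phase_eq (integrable_mul_of_memLp (φ.memLp 2) (ψ.memLp 2))]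
  congr 1
  ext v
  have h3 : ∀ η, (fourierX ψ ∘ reflX) (η, v) = (𝓕⁻ (slice ψ v)) η := fun η => by
    rw [SchwartzMap.fourierInv_coe, Real.fourierInv_eq_fourier_neg]; rfl
  simp only [h3]
  have := SchwartzMap.integral_fourier_mul_eq (slice φ v) (𝓕⁻ (slice ψ v))
  rw [FourierTransform.fourier_fourierInv_eq] at this
  exact this

theorem fourierL2_fourierInvL2 (f : L2Phase d) : fourierL2 d (fourierInvL2 d f) = f := by
  refine ext_pairL2 fun φ => ?_
  rw [pairL2_fourierL2, pairL2_comm, pairL2_fourierL2_fourierInvL2, pairL2_comm]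

theorem fourierL2_injective : Function.Injective (fourierL2 d) := by
  intro f g h
  rw [← sub_eq_zero, ← norm_eq_zero, ← norm_fourierL2, map_sub, h, sub_self, norm_zero]

theorem fourierInvL2_fourierL2 (f : L2Phase d) : fourierInvL2 d (fourierL2 d f) = f :=
  fourierL2_injective (fourierL2_fourierInvL2 _)

theorem integral_fourier_mul {f g : Pos d → ℂ} (hf : Integrable f) (hg : Integrable g) :
    ∫ x, 𝓕 f x * g x = ∫ x, f x * 𝓕 g x := by
  have := VectorFourier.integral_fourierIntegral_smul_eq_flip (L := innerₗ (Pos d))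
    (e := 𝐞) (μ := volume) (ν := volume) Real.continuous_fourierChar continuous_inner hf hg
  rw [flip_innerₗ] at this
  exact this

theorem integrable_prod_restrict {f : Phase d → ℂ} {R : ℝ}
    (hf : IntegrableOn f {z : Phase d | ‖z.2‖ ≤ R}) :
    Integrable f ((volume : Measure (Pos d)).prod
      ((volume : Measure (Pos d)).restrict (Metric.closedBall 0 R))) := by
  have : {z : Phase d | ‖z.2‖ ≤ R} = Set.univ ×ˢ Metric.closedBall 0 R := by
    ext z; simp
  rw [this, IntegrableOn, Measure.volume_eq_prod, ← Measure.prod_restrict,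
    Measure.restrict_univ] at hf
  exact hf

theorem ae_integrable_slice {f : Phase d → ℂ}
    (hf : ∀ R : ℝ, IntegrableOn f {z : Phase d | ‖z.2‖ ≤ R}) :
    ∀ᵐ v : Pos d, Integrable fun x => f (x, v) := by
  have h1 : ∀ n : ℕ, ∀ᵐ v : Pos d, v ∈ Metric.closedBall (0 : Pos d) n →
      Integrable fun x => f (x, v) := fun n => by
    rw [← ae_restrict_iff' Metric.isClosed_closedBall.measurableSet]
    exact (integrable_prod_restrict (hf n)).prod_left_ae
  filter_upwards [ae_all_iff.2 h1] with v hv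
  obtain ⟨n, hn⟩ := exists_nat_ge ‖v‖
  exact hv n (by simpa using hn)

theorem locallyIntegrable_fourierX {f : Phase d → ℂ} (hm : AEStronglyMeasurable f)
    (hf : ∀ R : ℝ, IntegrableOn f {z : Phase d | ‖z.2‖ ≤ R}) :
    LocallyIntegrable (fourierX f) := by
  rw [locallyIntegrable_iff]
  intro K hK
  obtain ⟨R, hR⟩ := hK.isBounded.subset_closedBall (0 : Phase d)
  refine IntegrableOn.mono_set ?_ hR
  rw [IntegrableOn, Prod.zero_eq_mk, ← closedBall_prod_same, Measure.volume_eq_prod,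
    ← Measure.prod_restrict]
  have h1 := (integrable_prod_restrict (hf R)).integral_norm_prod_right
  have : IsFiniteMeasure ((volume : Measure (Pos d)).restrict (Metric.closedBall 0 R)) :=
    ⟨by rw [Measure.restrict_apply_univ]; exact measure_closedBall_lt_top⟩
  refine Integrable.mono' (h1.comp_snd _) ?_ (.of_forall fun z => ?_)
  · have := (aestronglyMeasurable_fourierX hm).restrict
      (s := Metric.closedBall (0 : Pos d) R ×ˢ Metric.closedBall (0 : Pos d) R)
    rwa [Measure.volume_eq_prod, ← Measure.prod_restrict] at this
  · rw [fourierX]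
    exact VectorFourier.norm_fourierIntegral_le_integral_norm _ _ _ _ _

/-- The integral formula holds as soon as f is integrable on slabs of bounded velocity: test
functions have compact support, so only such slabs matter, and on almost every slice the Fourier
transform can be moved to the test function. -/
theorem coeFn_fourierL2 (f : L2Phase d)
    (hf : ∀ R : ℝ, IntegrableOn f {z : Phase d | ‖z.2‖ ≤ R}) :
    fourierL2 d f =ᵐ[volume] fourierX f := by
  have hloc := locallyIntegrable_fourierX (Lp.aestronglyMeasurable f) hf
  refine ae_eq_of_integral_contDiff_smul_eq
    ((Lp.memLp (fourierL2 d f)).locallyIntegrable one_le_two) hloc fun g hg hgc => ?_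
  have hgc' : HasCompactSupport (Complex.ofRealCLM ∘ g) := hgc.comp_left rfl
  have hg' : ContDiff ℝ ∞ (Complex.ofRealCLM ∘ g) := by fun_prop
  set φ : 𝓢(Phase d, ℂ) := hgc'.toSchwartzMap hg' with hφ
  have hφa : ∀ z, φ z = (g z : ℂ) := fun z => rfl
  calc ∫ z, g z • fourierL2 d f z = pairL2 d (fourierL2 d f) (schwartzL2 d φ) := by
        rw [pairL2_schwartz, toDist_apply]
        simp only [hφa, Complex.real_smul, mul_comm]
    _ = pairL2 d f (fourierL2 d (schwartzL2 d φ)) := pairL2_fourierL2 _ _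
    _ = ∫ z, f z * fourierX φ z := by
        rw [pairL2_apply]
        refine integral_congr_ae ?_
        filter_upwards [coeFn_fourierL2_schwartz φ] with z h
        rw [h]
    _ = ∫ v, ∫ x, f (x, v) * fourierX φ (x, v) :=
        integral_phase_eq (integrable_mul_of_memLp (Lp.memLp f) (memLp_fourierX φ))
    _ = ∫ v, ∫ x, g (x, v) • fourierX f (x, v) := by
        refine integral_congr_ae ?_
        filter_upwards [ae_integrable_slice hf] with v hv
        have := integral_fourier_mul hv (slice φ v).integrable
        simp only [slice_apply, hφa] at this
        simp only [Complex.real_smul, mul_comm (g _ : ℂ)]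
        exact this.symm
    _ = _ := (integral_phase_eq (hloc.integrable_smul_left_of_hasCompactSupport
        hg.continuous hgc)).symm

/-! ### Tensor products of Schwartz functions -/

theorem norm_iteratedFDeriv_comp_le_of_norm_le_one {E F : Type*} [NormedAddCommGroup E]
    [NormedSpace ℝ E] [NormedAddCommGroup F] [NormedSpace ℝ F] (A : 𝓢(F, ℂ)) (L : E →L[ℝ] F)
    (hL : ‖L‖ ≤ 1) (n : ℕ) (z : E) :
    ‖iteratedFDeriv ℝ n (fun z => A (L z)) z‖ ≤ ‖iteratedFDeriv ℝ n A (L z)‖ := by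
  have h := L.iteratedFDeriv_comp_right (A.smooth ⊤) z (i := n) (by exact_mod_cast le_top)
  change ‖iteratedFDeriv ℝ n (A ∘ L) z‖ ≤ _
  rw [h]
  refine (ContinuousMultilinearMap.norm_compContinuousLinearMap_le _ _).trans ?_
  rw [Finset.prod_const]
  exact mul_le_of_le_one_right (norm_nonneg _) (pow_le_one₀ (norm_nonneg _) hL)

/-- The tensor product `(x, v) ↦ a(x) b(v)` of two Schwartz functions. -/
def tensor (a b : 𝓢(Pos d, ℂ)) : 𝓢(Phase d, ℂ) where
  toFun z := a z.1 * b z.2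
  smooth' := ((a.smooth ⊤).comp contDiff_fst).mul ((b.smooth ⊤).comp contDiff_snd)
  decay' k n := by
    have ha : ∀ k i, ∃ C, ∀ x, ‖x‖ ^ k * ‖iteratedFDeriv ℝ i a x‖ ≤ C := fun k i => a.decay' k i
    have hb : ∀ k i, ∃ C, ∀ x, ‖x‖ ^ k * ‖iteratedFDeriv ℝ i b x‖ ≤ C := fun k i => b.decay' k i
    choose CA hA using ha
    choose CB hB using hb
    refine ⟨∑ i ∈ Finset.range (n + 1), (n.choose i : ℝ) *
      (CA k i * CB 0 (n - i) + CA 0 i * CB k (n - i)), fun z => ?_⟩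
    have h := norm_iteratedFDeriv_mul_le (𝕜 := ℝ) (n := n) (N := ∞)
      ((a.smooth ⊤).comp contDiff_fst) ((b.smooth ⊤).comp contDiff_snd) z
      (by exact_mod_cast le_top)
    refine (mul_le_mul_of_nonneg_left h (by positivity)).trans ?_
    rw [Finset.mul_sum]
    refine Finset.sum_le_sum fun i _ => ?_
    have h1 := norm_iteratedFDeriv_comp_le_of_norm_le_one a
      (ContinuousLinearMap.fst ℝ (Pos d) (Pos d)) (ContinuousLinearMap.norm_fst_le ..) i z
    have h2 := norm_iteratedFDeriv_comp_le_of_norm_le_one b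
      (ContinuousLinearMap.snd ℝ (Pos d) (Pos d)) (ContinuousLinearMap.norm_snd_le ..) (n - i) z
    have hA0 := hA 0 i z.1
    have hB0 := hB 0 (n - i) z.2
    rw [pow_zero, one_mul] at hA0 hB0
    have hAk := hA k i z.1
    have hBk := hB k (n - i) z.2
    have hz : ‖z‖ ^ k ≤ ‖z.1‖ ^ k + ‖z.2‖ ^ k := by
      rcases max_choice ‖z.1‖ ‖z.2‖ with h | h
      · rw [Prod.norm_def, h]; exact le_add_of_nonneg_right (by positivity)
      · rw [Prod.norm_def, h]; exact le_add_of_nonneg_left (by positivity)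
    calc ‖z‖ ^ k * ((n.choose i : ℝ) * ‖iteratedFDeriv ℝ i (fun z => a z.1) z‖ *
          ‖iteratedFDeriv ℝ (n - i) (fun z : Phase d => b z.2) z‖)
        ≤ (‖z.1‖ ^ k + ‖z.2‖ ^ k) * ((n.choose i : ℝ) * ‖iteratedFDeriv ℝ i a z.1‖ *
          ‖iteratedFDeriv ℝ (n - i) b z.2‖) := by gcongr <;> assumption
      _ = (n.choose i : ℝ) * ((‖z.1‖ ^ k * ‖iteratedFDeriv ℝ i a z.1‖) *
          ‖iteratedFDeriv ℝ (n - i) b z.2‖ + ‖iteratedFDeriv ℝ i a z.1‖ *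
          (‖z.2‖ ^ k * ‖iteratedFDeriv ℝ (n - i) b z.2‖)) := by ring
      _ ≤ _ := by
        have p1 : 0 ≤ CA k i := le_trans (by positivity) hAk
        have p2 : 0 ≤ CA 0 i := (norm_nonneg _).trans hA0
        gcongr

@[simp] theorem tensor_apply (a b : 𝓢(Pos d, ℂ)) (z : Phase d) : tensor a b z = a z.1 * b z.2 :=
  rfl

theorem integrable_smul_fst {h : Phase d → ℂ} (hh : LocallyIntegrable h) {α : Pos d → ℝ}
    (hα : Continuous α) (hαc : HasCompactSupport α) {K : Set (Pos d)} (hK : IsCompact K) :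
    Integrable (fun z : Phase d => α z.1 • h z)
      ((volume : Measure (Pos d)).prod ((volume : Measure (Pos d)).restrict K)) := by
  have h1 : IntegrableOn (fun z : Phase d => α z.1 • h z) (tsupport α ×ˢ K) := by
    refine IntegrableOn.continuousOn_smul ?_ (by fun_prop)
      ((HasCompactSupport.isCompact hαc).prod hK)
    exact hh.integrableOn_isCompact ((HasCompactSupport.isCompact hαc).prod hK)
  have h2 : IntegrableOn (fun z : Phase d => α z.1 • h z) (Set.univ ×ˢ K) := by
    refine h1.of_forall_sdiff_eq_zero (MeasurableSet.univ.prod hK.measurableSet) fun z hz => ?_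
    have : z.1 ∉ tsupport α := fun hm => hz.2 ⟨hm, hz.1.2⟩
    rw [image_eq_zero_of_notMem_tsupport this, zero_smul]
  rwa [IntegrableOn, Measure.volume_eq_prod, ← Measure.prod_restrict, Measure.restrict_univ] at h2

/-- The one-variable argument is applied twice. For fixed α the function w ↦ ∫ α(y) h(y, w) dy is
orthogonal to all β, hence vanishes almost everywhere; integrating over a ball in w and exchanging
integrals makes y ↦ ∫ h(y, w) dw orthogonal to all α. -/
theorem setIntegral_closedBall_prod_eq_zero {h : Phase d → ℂ} (hh : LocallyIntegrable h)
    (H : ∀ α β : Pos d → ℝ, ContDiff ℝ ∞ α → HasCompactSupport α → ContDiff ℝ ∞ β →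
      HasCompactSupport β → ∫ z : Phase d, (α z.1 * β z.2) • h z = 0) (x v : Pos d) (R : ℝ) :
    ∫ z in Metric.closedBall x R ×ˢ Metric.closedBall v R, h z = 0 := by
  have hB : ∀ y : Pos d, IsCompact (Metric.closedBall y R) := fun y => isCompact_closedBall y R
  have hkey : ∀ α : Pos d → ℝ, ContDiff ℝ ∞ α → HasCompactSupport α →
      ∀ᵐ w : Pos d, ∫ y, α y • h (y, w) = 0 := by
    intro α hα hαc
    refine ae_eq_zero_of_integral_contDiff_smul_eq_zero ?_ fun β hβ hβc => ?_
    · rw [locallyIntegrable_iff]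
      exact fun K hK => (integrable_smul_fst hh hα.continuous hαc hK).integral_prod_right
    · rw [← H α β hα hαc hβ hβc]
      have hc : HasCompactSupport fun z : Phase d => α z.1 * β z.2 := by
        refine HasCompactSupport.of_support_subset_isCompact
          ((HasCompactSupport.isCompact hαc).prod (HasCompactSupport.isCompact hβc)) ?_
        intro z hz
        rw [Function.mem_support] at hz
        exact ⟨subset_tsupport _ (left_ne_zero_of_mul hz),
          subset_tsupport _ (right_ne_zero_of_mul hz)⟩
      have hi := hh.integrable_smul_left_of_hasCompactSupport
        (by have := hα.continuous; have := hβ.continuous; fun_prop) hc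
      rw [integral_phase_eq hi]
      refine integral_congr_ae (.of_forall fun w => ?_)
      simp only [← integral_smul, smul_smul, mul_comm (β w)]
  have hk : ∀ᵐ y : Pos d, ∫ w in Metric.closedBall v R, h (y, w) = 0 := by
    refine ae_eq_zero_of_integral_contDiff_smul_eq_zero ?_ fun α hα hαc => ?_
    · rw [locallyIntegrable_iff]
      intro K hK
      have := hh.integrableOn_isCompact (hK.prod (hB v))
      rw [IntegrableOn, Measure.volume_eq_prod, ← Measure.prod_restrict] at this
      exact this.integral_prod_left
    · have h1 := integrable_smul_fst hh hα.continuous hαc (hB v)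
      simp only [← integral_smul]
      rw [integral_integral_swap h1]
      refine (integral_congr_ae (ae_restrict_of_ae (hkey α hα hαc))).trans (by simp)
  have h1 := hh.integrableOn_isCompact ((hB x).prod (hB v))
  rw [Measure.volume_eq_prod] at h1 ⊢
  rw [setIntegral_prod _ h1]
  refine (integral_congr_ae (ae_restrict_of_ae hk)).trans (by simp)

/-- A locally integrable function on phase space is determined by its integrals against tensor
products. -/
theorem ae_eq_zero_of_integral_tensor {h : Phase d → ℂ} (hh : LocallyIntegrable h)
    (H : ∀ α β : Pos d → ℝ, ContDiff ℝ ∞ α → HasCompactSupport α → ContDiff ℝ ∞ β →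
      HasCompactSupport β → ∫ z : Phase d, (α z.1 * β z.2) • h z = 0) : h =ᵐ[volume] 0 := by
  -- Lebesgue differentiation: a closed ball of phase space, in the maximum norm, is a product of
  -- two closed balls, so all averages vanish.
  filter_upwards [IsUnifLocDoublingMeasure.ae_tendsto_average volume hh 1] with z hz
  have h1 := hz (l := 𝓝[>] (0 : ℝ)) (fun _ => z) id Filter.tendsto_id
    (by filter_upwards [self_mem_nhdsWithin] with R hR
        exact Metric.mem_closedBall_self (by simpa using (le_of_lt hR)))
  refine tendsto_nhds_unique h1 ?_
  have h2 : ∀ R : ℝ, ⨍ y in Metric.closedBall z R, h y = 0 := fun R => by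
    rw [setAverage_eq, show z = (z.1, z.2) from rfl, ← closedBall_prod_same,
      setIntegral_closedBall_prod_eq_zero hh H, smul_zero]
  simp only [id, h2]
  exact tendsto_const_nhds

/-! ### Horizontal operators as Fourier multipliers, and weights -/

/-- Fourier symbol of the operator `a ∂_{(e, 0)} + b L`. -/
def symbol (a : ℂ) (e : Pos d) (b : ℂ) (L : Phase d →L[ℝ] ℂ) : Phase d →L[ℝ] ℂ :=
  (2 * Real.pi * Complex.I * a) • (Complex.ofRealCLM ∘L innerSL ℝ e ∘L
    ContinuousLinearMap.fst ℝ (Pos d) (Pos d)) + b • L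

theorem symbol_apply (a : ℂ) (e : Pos d) (b : ℂ) (L : Phase d →L[ℝ] ℂ) (z : Phase d) :
    symbol a e b L z = 2 * Real.pi * Complex.I * a * (⟪e, z.1⟫_ℝ : ℝ) + b * L z := rfl

theorem hasTemperateGrowth_inner (e : Pos d) :
    Function.HasTemperateGrowth fun x : Pos d => ⟪x, e⟫_ℝ :=
  ((innerSL ℝ).flip e).hasTemperateGrowth

theorem fderiv_slice (φ : 𝓢(Phase d, ℂ)) (x v e : Pos d) :
    fderiv ℝ (slice φ v) x e = fderiv ℝ φ (x, v) (e, 0) := by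
  have h1 : HasFDerivAt (fun x : Pos d => (x, v)) (ContinuousLinearMap.inl ℝ (Pos d) (Pos d)) x :=
    hasFDerivAt_prodMk_left x v
  have h2 := (φ.hasFDerivAt (x, v)).comp x h1
  have h3 : (slice φ v : Pos d → ℂ) = φ ∘ fun x => (x, v) := rfl
  rw [h3, h2.fderiv]
  simp

/-- Transposition changes the sign of the derivative, which is the same as evaluating its symbol at
the reflected frequency; hence `reflX`. -/
theorem fourierX_letterT (a : ℂ) (e : Pos d) (b : ℂ) {L : Phase d →L[ℝ] ℂ}
    (hL : ∀ x v, L (x, v) = L (0, v)) (φ : 𝓢(Phase d, ℂ)) (z : Phase d) :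
    fourierX (letterT a (e, 0) b L φ) z = symbol a e b L (reflX z) * fourierX φ z := by
  have h1 : slice (letterT a (e, 0) b L φ) z.2 =
      -(a • ∂_{e} (slice φ z.2)) + (b * L (0, z.2)) • slice φ z.2 := by
    ext x
    simp only [slice_apply, letterT_apply, add_apply, neg_apply, smul_apply,
      SchwartzMap.lineDerivOp_apply_eq_fderiv, fderiv_slice, hL x z.2, smul_eq_mul, mul_assoc]
  rw [fourierX_schwartz, h1, FourierTransform.fourier_add, FourierTransform.fourier_neg,
    FourierTransform.fourier_smul, FourierTransform.fourier_smul,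
    SchwartzMap.fourier_lineDerivOp_eq, symbol_apply, fourierX_schwartz]
  simp only [add_apply, neg_apply, smul_apply, smul_eq_mul, reflX, hL (-z.1) z.2,
    SchwartzMap.smulLeftCLM_apply_apply (hasTemperateGrowth_inner e), inner_neg_right,
    real_inner_comm e z.1, Complex.real_smul, Complex.ofReal_neg]
  ring

/-- The dual formula, in which differentiation of a Fourier transform becomes multiplication before
the transform. The hypothesis supplies the partial transform as a Schwartz function, which for
tensor products is explicit. -/
theorem letterT_of_fourierX_eq (a : ℂ) (e : Pos d) (b : ℂ) {L : Phase d →L[ℝ] ℂ}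
    (hL : ∀ x v, L (x, v) = L (0, v)) {φ ψ : 𝓢(Phase d, ℂ)} (h : ∀ z, fourierX φ z = ψ z)
    (z : Phase d) :
    letterT a (e, 0) b L ψ z = fourierX (SchwartzMap.smulLeftCLM ℂ (symbol a e b L) φ) z := by
  have h1 : slice ψ z.2 = 𝓕 (slice φ z.2) := by
    ext x; exact (h (x, z.2)).symm
  have h2 : slice (SchwartzMap.smulLeftCLM ℂ (symbol a e b L) φ) z.2 =
      -(a • (-(2 * Real.pi * Complex.I) • SchwartzMap.smulLeftCLM ℂ (fun x => ⟪x, e⟫_ℝ)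
        (slice φ z.2))) + (b * L (0, z.2)) • slice φ z.2 := by
    ext x
    simp only [slice_apply, add_apply, neg_apply, smul_apply, smul_eq_mul,
      SchwartzMap.smulLeftCLM_apply_apply (symbol a e b L).hasTemperateGrowth, symbol_apply,
      SchwartzMap.smulLeftCLM_apply_apply (hasTemperateGrowth_inner e), hL x z.2,
      real_inner_comm e x, Complex.real_smul]
    ring
  rw [fourierX_schwartz, h2, FourierTransform.fourier_add, FourierTransform.fourier_neg,
    FourierTransform.fourier_smul (b * L (0, z.2)),
    FourierTransform.fourier_smul a (-(2 * Real.pi * Complex.I) • SchwartzMap.smulLeftCLM ℂ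
      (fun x => ⟪x, e⟫_ℝ) (slice φ z.2)),
    ← SchwartzMap.lineDerivOp_fourier_eq, letterT_apply, ← h1]
  simp only [add_apply, neg_apply, smul_apply, smul_eq_mul,
    SchwartzMap.lineDerivOp_apply_eq_fderiv, fderiv_slice, slice_apply]
  rw [show L z = L (0, z.2) from hL z.1 z.2]
  ring

/-- The operator `a ∂_{(e, 0)} + b L`, where `L` depends on the velocity only, is multiplication
by its symbol after partial Fourier transform: sufficiency. -/
theorem letter_eq_of_fourierL2 (a : ℂ) (e : Pos d) (b : ℂ) {L : Phase d →L[ℝ] ℂ}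
    (hL : ∀ x v, L (x, v) = L (0, v)) {f g : L2Phase d}
    (h : ∀ᵐ z, fourierL2 d g z = symbol a e b L z * fourierL2 d f z) :
    letter a (e, 0) b L (toDist d f) = toDist d g := by
  ext φ
  rw [letter_apply, ← pairL2_schwartz, ← pairL2_schwartz, ← pairL2_fourierL2_fourierInvL2 f,
    ← pairL2_fourierL2_fourierInvL2 g, pairL2_apply, pairL2_apply]
  have hr := measurePreserving_reflX (d := d)
  have h1 : ∀ ψ : 𝓢(Phase d, ℂ), ∀ᵐ z, fourierInvL2 d (schwartzL2 d ψ) z =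
      fourierX ψ (reflX z) := fun ψ => by
    filter_upwards [coeFn_compL2 reflX hr (fourierL2 d (schwartzL2 d ψ)),
      hr.quasiMeasurePreserving.ae (coeFn_fourierL2_schwartz ψ)] with z h1 h2
    rw [fourierInvL2, ContinuousLinearMap.comp_apply, h1, Function.comp_apply, h2]
  refine integral_congr_ae ?_
  filter_upwards [h, h1 φ, h1 (letterT a (e, 0) b L φ)] with z h2 h3 h4
  have h5 : reflX (reflX z) = z := by simp [reflX]
  rw [h2, h3, h4, fourierX_letterT a e b hL, h5]
  ring

/-- The operator `a ∂_{(e, 0)} + b L`, where `L` depends on the velocity only, is multiplication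
by its symbol after partial Fourier transform: necessity. -/
theorem fourierL2_of_letter_eq (a : ℂ) (e : Pos d) (b : ℂ) {L : Phase d →L[ℝ] ℂ}
    (hL : ∀ x v, L (x, v) = L (0, v)) {f g : L2Phase d}
    (h : letter a (e, 0) b L (toDist d f) = toDist d g) :
    ∀ᵐ z, fourierL2 d g z = symbol a e b L z * fourierL2 d f z := by
  have hl : ∀ f : L2Phase d, LocallyIntegrable f := fun f =>
    (Lp.memLp f).locallyIntegrable one_le_two
  have hl' : LocallyIntegrable fun z => symbol a e b L z * fourierL2 d f z := by
    rw [locallyIntegrable_iff]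
    intro K hK
    exact ((hl _).integrableOn_isCompact hK).continuousOn_mul
      (symbol a e b L).continuous.continuousOn hK
  -- The symbol is unbounded, so its product with an L² function is known only to be locally
  -- integrable. Tensor products suffice as test functions, and their partial Fourier transforms are
  -- again tensor products of Schwartz functions.
  have key := ae_eq_zero_of_integral_tensor ((hl (fourierL2 d g)).sub hl') ?_
  · filter_upwards [key] with z hz
    exact sub_eq_zero.1 hz
  intro α β hα hαc hβ hβc
  have hα1 : HasCompactSupport (Complex.ofRealCLM ∘ α) := hαc.comp_left rfl
  have hα2 : ContDiff ℝ ∞ (Complex.ofRealCLM ∘ α) := by fun_prop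
  have hβ1 : HasCompactSupport (Complex.ofRealCLM ∘ β) := hβc.comp_left rfl
  have hβ2 : ContDiff ℝ ∞ (Complex.ofRealCLM ∘ β) := by fun_prop
  set A : 𝓢(Pos d, ℂ) := hα1.toSchwartzMap hα2 with hA
  set B : 𝓢(Pos d, ℂ) := hβ1.toSchwartzMap hβ2 with hB
  set φ := tensor A B
  set ψ := tensor (𝓕 A) B
  have hφ : ∀ z : Phase d, φ z = ((α z.1 * β z.2 : ℝ) : ℂ) := fun z => by
    rw [Complex.ofReal_mul]; rfl
  have hψ : ∀ z, fourierX φ z = ψ z := fun z => by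
    have : slice φ z.2 = B z.2 • A := by
      ext x; simp [φ, mul_comm]
    rw [fourierX_schwartz, this, FourierTransform.fourier_smul]
    simp [ψ, mul_comm]
  have h1 : pairL2 d (fourierL2 d g) (schwartzL2 d φ) = toDist d g ψ := by
    rw [pairL2_fourierL2, ← pairL2_schwartz]
    congr 1
    refine Lp.ext ?_
    filter_upwards [coeFn_fourierL2_schwartz φ, coeFn_schwartzL2 ψ] with z h1 h2
    rw [h1, h2, hψ]
  have h2 : pairL2 d (fourierL2 d f) (schwartzL2 d (SchwartzMap.smulLeftCLM ℂ
      (symbol a e b L) φ)) = toDist d f (letterT a (e, 0) b L ψ) := by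
    rw [pairL2_fourierL2, ← pairL2_schwartz]
    congr 1
    refine Lp.ext ?_
    filter_upwards [coeFn_fourierL2_schwartz (SchwartzMap.smulLeftCLM ℂ (symbol a e b L) φ),
      coeFn_schwartzL2 (letterT a (e, 0) b L ψ)] with z h1 h2
    rw [h1, h2, letterT_of_fourierX_eq a e b hL hψ]
  rw [← letter_apply, h, ← h1, pairL2_schwartz, pairL2_schwartz, toDist_apply, toDist_apply] at h2
  have hi : ∀ (k : L2Phase d) (φ : 𝓢(Phase d, ℂ)), Integrable fun z => k z * φ z := fun k φ =>
    integrable_mul_of_memLp (Lp.memLp k) (φ.memLp 2)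
  rw [← sub_eq_zero, ← integral_sub (hi _ _) (hi _ _)] at h2
  rw [← neg_eq_zero, ← integral_neg, ← h2]
  refine integral_congr_ae (.of_forall fun z => ?_)
  simp only [SchwartzMap.smulLeftCLM_apply_apply (symbol a e b L).hasTemperateGrowth, hφ,
    Complex.real_smul, Pi.sub_apply, smul_eq_mul]
  ring

theorem submodule_mul_pow_succ {A : Type*} [Ring A] [Algebra ℂ A] (M N : Submodule ℂ A) (n : ℕ) :
    M * N ^ (n + 1) = M * N ^ n * N := by
  rw [pow_succ, mul_assoc]

/-- The operators of the submodule `W` send `f` to `L²` exactly if `w` times the partial Fourier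
transform of `f` is square integrable. -/
structure IsWeight (W : Submodule ℂ (DistOp d)) (w : Phase d → ℝ) : Prop where
  one_le_op : 1 ≤ W
  one_le : ∀ z, 1 ≤ w z
  continuous : Continuous w
  memLp_iff : ∀ f : L2Phase d, (∀ D ∈ W, D (toDist d f) ∈ l2Range d) ↔
    MemLp (fun z => (w z : ℂ) * fourierL2 d f z) 2 volume

theorem isWeight_one : IsWeight (1 : Submodule ℂ (DistOp d)) fun _ => 1 where
  one_le_op := le_rfl
  one_le _ := le_rfl
  continuous := continuous_const
  memLp_iff f := by
    refine iff_of_true (fun D hD => ?_) (by simpa using Lp.memLp (fourierL2 d f))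
    obtain ⟨c, rfl⟩ := Submodule.mem_one.1 hD
    exact ⟨c • f, by rw [map_smul]; simp [Algebra.algebraMap_eq_smul_one]⟩

/-- `s` is the symbol of `D` with respect to the partial Fourier transform. -/
def HasSymbol (D : DistOp d) (s : Phase d → ℂ) : Prop :=
  ∀ f g : L2Phase d, D (toDist d f) = toDist d g ↔
    ∀ᵐ z, fourierL2 d g z = s z * fourierL2 d f z

theorem hasSymbol_letter (a : ℂ) (e : Pos d) (b : ℂ) {L : Phase d →L[ℝ] ℂ}
    (hL : ∀ x v, L (x, v) = L (0, v)) : HasSymbol (letter a (e, 0) b L) (symbol a e b L) :=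
  fun _ _ => ⟨fourierL2_of_letter_eq a e b hL, letter_eq_of_fourierL2 a e b hL⟩

theorem memLp_mul_of_le {w : Phase d → ℝ} {F : Phase d → ℂ}
    (h : MemLp (fun z => (w z : ℂ) * F z) 2 volume) {g : Phase d → ℂ} (hg : AEStronglyMeasurable g)
    {C : ℝ} (hle : ∀ᵐ z, ‖g z‖ ≤ C * (‖w z‖ * ‖F z‖)) : MemLp g 2 volume :=
  MemLp.of_le_mul h hg (c := C) (by
    filter_upwards [hle] with z hz
    simpa using hz)

/-- A further family of letters multiplies the weight by σ, which is comparable to 1 + Σ|s_j|. The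
upper bound on σ recovers the weighted norm from those of f and of all a_j f; conversely σ dominates
both 1 and each s_j. -/
theorem IsWeight.mul_letterSpan {W : Submodule ℂ (DistOp d)} {w : Phase d → ℝ} (hW : IsWeight W w)
    {a : Fin d → DistOp d} {s : Fin d → Phase d → ℂ} (hs : ∀ j, HasSymbol (a j) (s j))
    (hsc : ∀ j, Continuous (s j)) {σ : Phase d → ℝ} (hσ : Continuous σ) (h1 : ∀ z, 1 ≤ σ z)
    {C : ℝ} (hC : ∀ z, σ z ≤ C * (1 + ∑ j, ‖s j z‖)) {C' : ℝ} (hC' : ∀ j z, ‖s j z‖ ≤ C' * σ z) :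
    IsWeight (W * letterSpan a) fun z => w z * σ z := by
  have hw0 : ∀ z, 0 ≤ w z := fun z => zero_le_one.trans (hW.one_le z)
  have hσ0 : ∀ z, 0 ≤ σ z := fun z => zero_le_one.trans (h1 z)
  have hmeas : ∀ f : L2Phase d, AEStronglyMeasurable (fourierL2 d f) := fun f =>
    Lp.aestronglyMeasurable _
  refine ⟨?_, fun z => one_le_mul_of_one_le_of_one_le (hW.one_le z) (h1 z),
    hW.continuous.mul hσ, fun f => ⟨fun h => ?_, fun h => ?_⟩⟩
  · rw [← mul_one (1 : Submodule ℂ (DistOp d))]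
    exact mul_le_mul' hW.one_le_op (one_le_letterSpan a)
  · have hf : ∀ D ∈ W, D (toDist d f) ∈ l2Range d := fun D hD => by
      simpa using h _ (Submodule.mul_mem_mul hD (one_mem_letterSpan a))
    have hj : ∀ j, ∃ g : L2Phase d, toDist d g = a j (toDist d f) := fun j => by
      have := h _ (Submodule.mul_mem_mul (Submodule.one_le.1 hW.one_le_op) (mem_letterSpan a j))
      rwa [one_mul] at this
    choose g hg using hj
    have hgj : ∀ j, MemLp (fun z => (w z : ℂ) * fourierL2 d (g j) z) 2 volume := fun j => by
      refine (hW.memLp_iff _).1 fun D hD => ?_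
      rw [hg]
      exact h _ (Submodule.mul_mem_mul hD (mem_letterSpan a j))
    have hsum : MemLp (fun z => ‖(w z : ℂ) * fourierL2 d f z‖ +
        ∑ j, ‖(w z : ℂ) * fourierL2 d (g j) z‖) 2 volume :=
      ((hW.memLp_iff f).1 hf).norm.add (memLp_finsetSum _ fun j _ => (hgj j).norm)
    refine MemLp.of_le_mul hsum (c := C) ?_ ?_
    · exact AEStronglyMeasurable.mul
        (Complex.continuous_ofReal.comp (hW.continuous.mul hσ)).aestronglyMeasurable (hmeas f)
    have hall : ∀ᵐ z, ∀ j, fourierL2 d (g j) z = s j z * fourierL2 d f z :=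
      ae_all_iff.2 fun j => ((hs j) f (g j)).1 (hg j).symm
    filter_upwards [hall] with z hz
    have e1 : ‖(w z : ℂ) * fourierL2 d f z‖ + ∑ j, ‖(w z : ℂ) * fourierL2 d (g j) z‖ =
        (1 + ∑ j, ‖s j z‖) * (w z * ‖fourierL2 d f z‖) := by
      simp only [hz, norm_mul, Complex.norm_real, Real.norm_of_nonneg (hw0 z), add_mul, one_mul,
        Finset.sum_mul]
      congr 1
      exact Finset.sum_congr rfl fun j _ => by ring
    rw [e1, Real.norm_of_nonneg (by have := hw0 z; positivity), norm_mul, Complex.norm_real,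
      Real.norm_of_nonneg (mul_nonneg (hw0 z) (hσ0 z))]
    calc w z * σ z * ‖fourierL2 d f z‖ = σ z * (w z * ‖fourierL2 d f z‖) := by ring
      _ ≤ (C * (1 + ∑ j, ‖s j z‖)) * (w z * ‖fourierL2 d f z‖) :=
        mul_le_mul_of_nonneg_right (hC z) (mul_nonneg (hw0 z) (norm_nonneg _))
      _ = _ := by ring
  · have hf : ∀ D ∈ W, D (toDist d f) ∈ l2Range d := by
      refine (hW.memLp_iff f).2 (memLp_mul_of_le (C := 1) h ?_ (.of_forall fun z => ?_))
      · exact AEStronglyMeasurable.mul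
          (Complex.continuous_ofReal.comp hW.continuous).aestronglyMeasurable (hmeas f)
      · rw [norm_mul, Complex.norm_real, one_mul, norm_mul]
        refine mul_le_mul_of_nonneg_right ?_ (norm_nonneg _)
        exact le_mul_of_one_le_right (norm_nonneg _) ((h1 z).trans (le_abs_self _))
    have hj : ∀ j, MemLp (fun z => s j z * fourierL2 d f z) 2 volume := fun j => by
      refine memLp_mul_of_le (C := C') h ((hsc j).aestronglyMeasurable.mul (hmeas f))
        (.of_forall fun z => ?_)
      rw [norm_mul, norm_mul, Real.norm_of_nonneg (hw0 z), Real.norm_of_nonneg (hσ0 z),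
        ← mul_assoc]
      refine mul_le_mul_of_nonneg_right ((hC' j z).trans ?_) (norm_nonneg _)
      have h2 : 0 ≤ C' * σ z := (norm_nonneg _).trans (hC' j z)
      calc C' * σ z ≤ w z * (C' * σ z) := le_mul_of_one_le_left h2 (hW.one_le z)
        _ = _ := by ring
    have hfj : ∀ j, ∀ D ∈ W, D (a j (toDist d f)) ∈ l2Range d := by
      intro j
      -- The function that represents a_j f is constructed on the Fourier side, where its transform
      -- s_j Ff is square integrable thanks to the weight.
      set g := fourierInvL2 d ((hj j).toLp _)
      have hg : ∀ᵐ z, fourierL2 d g z = s j z * fourierL2 d f z := by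
        simp only [g, fourierL2_fourierInvL2]
        exact (hj j).coeFn_toLp
      rw [((hs j) f g).2 hg]
      refine (hW.memLp_iff g).2 (memLp_mul_of_le (C := C') h ?_ ?_)
      · exact AEStronglyMeasurable.mul
          (Complex.continuous_ofReal.comp hW.continuous).aestronglyMeasurable (hmeas g)
      · filter_upwards [hg] with z hz
        rw [hz, norm_mul, norm_mul, norm_mul, Complex.norm_real, Real.norm_of_nonneg (hσ0 z)]
        calc ‖w z‖ * (‖s j z‖ * ‖fourierL2 d f z‖)
            ≤ ‖w z‖ * (C' * σ z * ‖fourierL2 d f z‖) := by gcongr; exact hC' j z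
          _ = _ := by ring
    have hle : W * letterSpan a ≤ (l2Range d).comap (evalAt (toDist d f)) := by
      refine Submodule.mul_le.2 fun P hP x hx => ?_
      have : letterSpan a ≤ (l2Range d).comap
          ((evalAt (toDist d f)).comp (LinearMap.mulLeft ℂ P)) := by
        refine Submodule.span_le.2 ?_
        rintro _ (rfl | ⟨j, rfl⟩)
        · exact (mul_one P).symm ▸ hf P hP
        · exact hfj j P hP
      exact this hx
    exact fun D hD => hle hD

theorem IsWeight.mul_letterSpan_pow {W : Submodule ℂ (DistOp d)} {w : Phase d → ℝ}
    (hW : IsWeight W w) {a : Fin d → DistOp d} {s : Fin d → Phase d → ℂ}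
    (hs : ∀ j, HasSymbol (a j) (s j))
    (hsc : ∀ j, Continuous (s j)) {σ : Phase d → ℝ} (hσ : Continuous σ) (h1 : ∀ z, 1 ≤ σ z)
    {C : ℝ} (hC : ∀ z, σ z ≤ C * (1 + ∑ j, ‖s j z‖)) {C' : ℝ} (hC' : ∀ j z, ‖s j z‖ ≤ C' * σ z)
    (n : ℕ) : IsWeight (W * letterSpan a ^ n) fun z => w z * σ z ^ n := by
  induction n with
  | zero => simpa using hW
  | succ n ih =>
    have h := ih.mul_letterSpan hs hsc hσ h1 hC hC'
    simp only [pow_succ (σ _), ← mul_assoc (w _)]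
    exact (congrArg (fun W' => IsWeight W' _) (submodule_mul_pow_succ W (letterSpan a) n)).mpr h

/-- `-i` times the symbol of `V_+`. -/
def wP (ε : ℝ) (z : Phase d) : Pos d := (2 * Real.pi * ε) • z.1 + (2 : ℝ) • z.2

/-- `-i` times the symbol of `V_-`. -/
def wM (ε : ℝ) (z : Phase d) : Pos d := (2 * Real.pi * ε) • z.1 - (2 : ℝ) • z.2

/-- The weight that corresponds to `n` derivatives in `x`, `i` factors `V_+` and `j` factors
`V_-`. -/
def weight (ε : ℝ) (n i j : ℕ) (z : Phase d) : ℝ :=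
  (1 + ‖z.1‖) ^ n * (1 + ‖wP ε z‖) ^ i * (1 + ‖wM ε z‖) ^ j

theorem norm_le_sum_coord (y : Pos d) : ‖y‖ ≤ ∑ j, |y j| := by
  have h : y = ∑ j, y j • EuclideanSpace.single j (1 : ℝ) := by
    ext i
    simp [Finset.sum_apply, Pi.single_apply]
  calc ‖y‖ = ‖∑ j, y j • EuclideanSpace.single j (1 : ℝ)‖ := by rw [← h]
    _ ≤ ∑ j, ‖y j • EuclideanSpace.single j (1 : ℝ)‖ := norm_sum_le _ _
    _ = _ := by simp [norm_smul]

theorem abs_coord_le (y : Pos d) (j : Fin d) : |y j| ≤ ‖y‖ := PiLp.norm_apply_le y j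

theorem norm_symbol_vPlus (ε : ℝ) (j : Fin d) (z : Phase d) :
    ‖symbol ε (EuclideanSpace.single j 1) (2 * Complex.I) (coordV j) z‖ = |wP ε z j| := by
  have : symbol ε (EuclideanSpace.single j 1) (2 * Complex.I) (coordV j) z =
      Complex.I * ((wP ε z j : ℝ) : ℂ) := by
    simp [symbol_apply, wP, EuclideanSpace.inner_single_left]
    ring
  rw [this]; simp

theorem norm_symbol_vMinus (ε : ℝ) (j : Fin d) (z : Phase d) :
    ‖symbol ε (EuclideanSpace.single j 1) (-(2 * Complex.I)) (coordV j) z‖ = |wM ε z j| := by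
  have : symbol ε (EuclideanSpace.single j 1) (-(2 * Complex.I)) (coordV j) z =
      Complex.I * ((wM ε z j : ℝ) : ℂ) := by
    simp [symbol_apply, wM, EuclideanSpace.inner_single_left]
    ring
  rw [this]; simp

theorem norm_symbol_dX (j : Fin d) (z : Phase d) :
    ‖symbol 1 (EuclideanSpace.single j 1) 0 0 z‖ = 2 * Real.pi * |z.1 j| := by
  simp [symbol_apply, EuclideanSpace.inner_single_left, abs_of_pos Real.pi_pos]

theorem continuous_wP (ε : ℝ) : Continuous (wP ε : Phase d → Pos d) := by unfold wP; fun_prop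

theorem continuous_wM (ε : ℝ) : Continuous (wM ε : Phase d → Pos d) := by unfold wM; fun_prop

/-- The symbols of ∂_x, V_+ and V_- have components of modulus 2π|ζ_j|, |(w_+)_j| and |(w_-)_j|.
Starting from the trivial weight, the three families are multiplied in one letter at a time. -/
theorem isWeight_weight (ε : ℝ) (n i j : ℕ) :
    IsWeight (letterSpan (dX : Fin d → DistOp d) ^ n * letterSpan (vPlus ε) ^ i *
      letterSpan (vMinus ε) ^ j) (weight ε n i j) := by
  have h1 : IsWeight (1 * letterSpan (dX : Fin d → DistOp d) ^ n)
      fun z => 1 * (1 + ‖z.1‖) ^ n := by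
    refine isWeight_one.mul_letterSpan_pow (C := 1) (C' := 2 * Real.pi) (fun j => ?_)
      (fun j => (symbol 1 (EuclideanSpace.single j 1) 0 0).continuous) (by fun_prop)
      (fun z => by simp) (fun z => ?_) (fun j z => ?_) n
    · rw [dX_eq]; exact hasSymbol_letter _ _ _ (fun x v => by simp)
    · simp only [norm_symbol_dX, one_mul, ← Finset.mul_sum]
      have h2 := norm_le_sum_coord z.1
      have h3 : 0 ≤ ∑ j, |z.1 j| := Finset.sum_nonneg fun _ _ => abs_nonneg _
      nlinarith [Real.pi_gt_three]
    · rw [norm_symbol_dX]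
      have := abs_coord_le z.1 j
      gcongr
      linarith
  have h2 := h1.mul_letterSpan_pow (C := 1) (C' := 1) (a := vPlus ε)
    (s := fun j => symbol ε (EuclideanSpace.single j 1) (2 * Complex.I) (coordV j))
    (σ := fun z => 1 + ‖wP ε z‖) (fun j => by
      rw [vPlus_eq]; exact hasSymbol_letter _ _ _ (fun x v => by simp))
    (fun j => (symbol _ _ _ _).continuous) (by have := continuous_wP (d := d) ε; fun_prop)
    (fun z => by simp)
    (fun z => by simpa only [norm_symbol_vPlus, one_mul, add_le_add_iff_left] using
      norm_le_sum_coord _)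
    (fun j z => by
      rw [norm_symbol_vPlus]
      have := abs_coord_le (wP ε z) j
      linarith) i
  have h3 := h2.mul_letterSpan_pow (C := 1) (C' := 1) (a := vMinus ε)
    (s := fun j => symbol ε (EuclideanSpace.single j 1) (-(2 * Complex.I)) (coordV j))
    (σ := fun z => 1 + ‖wM ε z‖) (fun j => by
      rw [vMinus_eq]; exact hasSymbol_letter _ _ _ (fun x v => by simp))
    (fun j => (symbol _ _ _ _).continuous) (by have := continuous_wM (d := d) ε; fun_prop)
    (fun z => by simp)
    (fun z => by simpa only [norm_symbol_vMinus, one_mul, add_le_add_iff_left] using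
      norm_le_sum_coord _)
    (fun j z => by
      rw [norm_symbol_vMinus]
      have := abs_coord_le (wM ε z) j
      linarith) j
  simp only [one_mul] at h3
  exact h3

/-! ### Modulations in position and translations in velocity -/

/-- The character `x ↦ e^{2πi ζ·x}`, as a function on phase space. -/
def character (ζ : Pos d) (z : Phase d) : ℂ :=
  Complex.exp (2 * Real.pi * Complex.I * (⟪z.1, ζ⟫_ℝ : ℝ))

theorem norm_character (ζ : Pos d) (z : Phase d) : ‖character ζ z‖ = 1 := by
  rw [character, show 2 * Real.pi * Complex.I * (⟪z.1, ζ⟫_ℝ : ℝ) =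
    ((2 * Real.pi * ⟪z.1, ζ⟫_ℝ : ℝ) : ℂ) * Complex.I by push_cast; ring,
    Complex.norm_exp_ofReal_mul_I]

theorem hasTemperateGrowth_cexp : Function.HasTemperateGrowth
    fun t : ℝ => Complex.exp (2 * Real.pi * Complex.I * t) := by
  have h : ∀ n : ℕ, iteratedDeriv n (fun t : ℝ => Complex.exp (2 * Real.pi * Complex.I * t)) =
      fun t : ℝ => (2 * Real.pi * Complex.I) ^ n * Complex.exp (2 * Real.pi * Complex.I * t) := by
    intro n
    induction n with
    | zero => ext t; simp
    | succ n ih =>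
      ext t
      rw [iteratedDeriv_succ, ih]
      have h1 : HasDerivAt (fun t : ℝ => 2 * Real.pi * Complex.I * (t : ℂ))
          (2 * Real.pi * Complex.I) t := by
        simpa using (Complex.ofRealCLM.hasDerivAt (x := t)).const_mul (2 * Real.pi * Complex.I)
      rw [(h1.cexp.const_mul _).deriv]
      ring
  refine ⟨Complex.contDiff_exp.comp (contDiff_const.mul Complex.ofRealCLM.contDiff), fun n => ⟨0, (2 * Real.pi) ^ n, fun t => ?_⟩⟩
  rw [norm_iteratedFDeriv_eq_norm_iteratedDeriv, h]
  have : ‖Complex.exp (2 * Real.pi * Complex.I * t)‖ = 1 := by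
    rw [show 2 * Real.pi * Complex.I * (t : ℂ) = ((2 * Real.pi * t : ℝ) : ℂ) * Complex.I by
      push_cast; ring, Complex.norm_exp_ofReal_mul_I]
  simp [this, abs_of_pos Real.pi_pos]

theorem hasTemperateGrowth_character (ζ : Pos d) : (character ζ).HasTemperateGrowth :=
  hasTemperateGrowth_cexp.comp
    (((innerSL ℝ).flip ζ ∘L ContinuousLinearMap.fst ℝ (Pos d) (Pos d)).hasTemperateGrowth)

theorem continuous_character (ζ : Pos d) : Continuous (character ζ) :=
  (hasTemperateGrowth_character ζ).1.continuous

/-- The shift `(x, v) ↦ (x, v - w)`. -/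
def shiftV (w : Pos d) (z : Phase d) : Phase d := (z.1, z.2 - w)

theorem shiftV_eq (w : Pos d) : shiftV w = fun z : Phase d => z - (0, w) := by
  ext z <;> simp [shiftV]

theorem measurePreserving_sub (y : Phase d) : MeasurePreserving fun z : Phase d => z - y :=
  measurePreserving_sub_right volume y

theorem measurePreserving_shiftV (w : Pos d) : MeasurePreserving (shiftV w : Phase d → Phase d) :=
  shiftV_eq w ▸ measurePreserving_sub _

/-- Modulation in `x` and translation in `v` of Schwartz functions. -/
def modS (ζ w : Pos d) : 𝓢(Phase d, ℂ) →L[ℂ] 𝓢(Phase d, ℂ) :=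
  SchwartzMap.smulLeftCLM ℂ (character ζ) ∘L
    SchwartzMap.compCLMOfAntilipschitz ℂ (K := 1) (g := shiftV w)
      (by rw [shiftV_eq]; fun_prop)
      (by rw [shiftV_eq]; exact (IsometryEquiv.subRight ((0, w) : Phase d)).isometry.antilipschitz)

theorem modS_apply (ζ w : Pos d) (φ : 𝓢(Phase d, ℂ)) (z : Phase d) :
    modS ζ w φ z = character ζ z * φ (shiftV w z) := by
  simp [modS, SchwartzMap.smulLeftCLM_apply_apply (hasTemperateGrowth_character ζ)]

/-- Modulation in `x` and translation in `v` of square integrable functions. -/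
def modL2 (ζ w : Pos d) : L2Phase d →L[ℂ] L2Phase d :=
  (ContinuousLinearMap.mul ℂ ℂ).holderL volume ∞ 2 2
    ((memLp_top_of_bound (continuous_character ζ).aestronglyMeasurable 1
      (.of_forall fun z => (norm_character ζ z).le)).toLp _) ∘L
    compL2 (shiftV w) (measurePreserving_shiftV w)

theorem coeFn_modL2 (ζ w : Pos d) (f : L2Phase d) :
    ∀ᵐ z, modL2 ζ w f z = character ζ z * f (shiftV w z) := by
  have hm : MemLp (character ζ) ∞ (volume : Measure (Phase d)) :=
    memLp_top_of_bound (continuous_character ζ).aestronglyMeasurable 1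
      (.of_forall fun z => (norm_character ζ z).le)
  filter_upwards [(ContinuousLinearMap.mul ℂ ℂ).coeFn_holder (r := 2) (hm.toLp _)
    (compL2 (shiftV w) (measurePreserving_shiftV w) f), hm.coeFn_toLp,
    coeFn_compL2 _ (measurePreserving_shiftV w) f] with z h1 h2 h3
  rw [h2, h3] at h1
  exact h1

theorem modL2_schwartzL2 (ζ w : Pos d) (φ : 𝓢(Phase d, ℂ)) :
    modL2 ζ w (schwartzL2 d φ) = schwartzL2 d (modS ζ w φ) := by
  refine Lp.ext ?_
  filter_upwards [coeFn_modL2 ζ w (schwartzL2 d φ), coeFn_schwartzL2 (modS ζ w φ),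
    (measurePreserving_shiftV w).quasiMeasurePreserving.ae (coeFn_schwartzL2 φ)] with z h1 h2 h3
  rw [h1, h2, h3, modS_apply]

/-- Translations of square integrable functions. -/
def translateL2 (y : Phase d) : L2Phase d →L[ℂ] L2Phase d :=
  compL2 _ (measurePreserving_sub y)

theorem coeFn_translateL2 (y : Phase d) (f : L2Phase d) :
    ∀ᵐ z, translateL2 y f z = f (z - y) :=
  coeFn_compL2 _ (measurePreserving_sub y) f

theorem continuous_translateL2 (f : L2Phase d) : Continuous fun y => translateL2 y f := by
  let g : Phase d → C(Phase d, Phase d) := fun y => ⟨fun z => z - y, by fun_prop⟩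
  have hg : Continuous g := by
    refine ContinuousMap.continuous_of_continuous_uncurry _ ?_
    exact continuous_snd.sub continuous_fst
  exact Continuous.compMeasurePreservingLp (g := g) continuous_const hg
    (fun y => measurePreserving_sub y) ENNReal.ofNat_ne_top

theorem fourierX_modS (ζ w : Pos d) (φ : 𝓢(Phase d, ℂ)) (z : Phase d) :
    fourierX (modS ζ w φ) z = fourierX φ (z - (ζ, w)) := by
  simp only [fourierX, Real.fourier_eq', modS_apply, character, shiftV, smul_eq_mul]
  refine integral_congr_ae (.of_forall fun x => ?_)
  simp only [← mul_assoc, ← Complex.exp_add, Prod.fst_sub, Prod.snd_sub, inner_sub_right]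
  congr 2
  push_cast
  ring

theorem fourierL2_modL2 (ζ w : Pos d) (f : L2Phase d) :
    fourierL2 d (modL2 ζ w f) = translateL2 (ζ, w) (fourierL2 d f) := by
  refine denseRange_schwartzL2.induction_on
    (p := fun f => fourierL2 d (modL2 ζ w f) = translateL2 (ζ, w) (fourierL2 d f)) f
    (isClosed_eq (by fun_prop) (by fun_prop)) fun φ => ?_
  refine Lp.ext ?_
  rw [modL2_schwartzL2]
  filter_upwards [coeFn_fourierL2_schwartz (modS ζ w φ),
    coeFn_translateL2 (ζ, w) (fourierL2 d (schwartzL2 d φ)),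
    (measurePreserving_sub (ζ, w)).quasiMeasurePreserving.ae (coeFn_fourierL2_schwartz φ)]
    with z h1 h2 h3
  rw [h1, h2, h3, fourierX_modS]

theorem modL2_eq (ζ w : Pos d) (f : L2Phase d) :
    modL2 ζ w f = fourierInvL2 d (translateL2 (ζ, w) (fourierL2 d f)) := by
  rw [← fourierL2_modL2, fourierInvL2_fourierL2]

theorem norm_translateL2 (y : Phase d) (f : L2Phase d) : ‖translateL2 y f‖ = ‖f‖ :=
  (Lp.compMeasurePreservingₗᵢ ℂ _ (measurePreserving_sub y)).norm_map f

theorem norm_modL2 (ζ w : Pos d) (f : L2Phase d) : ‖modL2 ζ w f‖ = ‖f‖ := by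
  rw [← norm_fourierL2, fourierL2_modL2, norm_translateL2, norm_fourierL2]

theorem continuous_modL2 {α : Type*} [TopologicalSpace α] {ζ w : α → Pos d} (hζ : Continuous ζ)
    (hw : Continuous w) (f : L2Phase d) : Continuous fun t => modL2 (ζ t) (w t) f := by
  simp only [modL2_eq]
  exact (fourierInvL2 d).continuous.comp ((continuous_translateL2 _).comp (hζ.prodMk hw))

/-- Modulation in `x` and translation in `v` of distributions. -/
def modD (ζ w : Pos d) : DistOp d := PointwiseConvergenceCLM.precomp _ (modS ζ (-w))

theorem modD_apply (ζ w : Pos d) (u : Dist d) (φ : 𝓢(Phase d, ℂ)) :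
    modD ζ w u φ = u (modS ζ (-w) φ) := rfl

theorem modD_toDist (ζ w : Pos d) (f : L2Phase d) :
    modD ζ w (toDist d f) = toDist d (modL2 ζ w f) := by
  ext φ
  rw [modD_apply, toDist_apply, toDist_apply]
  have h1 : ∀ᵐ z, modL2 ζ w f z * φ z = f (shiftV w z) * modS ζ (-w) φ (shiftV w z) := by
    filter_upwards [coeFn_modL2 ζ w f] with z hz
    rw [hz, modS_apply]
    have h2 : shiftV (-w) (shiftV w z) = z := by simp [shiftV]
    have h3 : character ζ (shiftV w z) = character ζ z := rfl
    rw [h2, h3]; ring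
  rw [integral_congr_ae h1]
  simp only [shiftV_eq]
  exact (integral_sub_right_eq_self (fun z => f z * modS ζ (-w) φ z) ((0, w) : Phase d)).symm

/-- A vertical letter differentiates only in v, where the character is constant, and multiplies by a
function of x, which the velocity shift does not affect. So the commutation is exact. -/
theorem modS_letterT (ζ w : Pos d) (a : ℂ) (e : Pos d) (b : ℂ) {L : Phase d →L[ℝ] ℂ}
    (hL : ∀ x v, L (x, v) = L (x, 0)) (φ : 𝓢(Phase d, ℂ)) :
    letterT a (0, e) b L (modS ζ w φ) = modS ζ w (letterT a (0, e) b L φ) := by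
  ext z
  have h1 : HasFDerivAt (modS ζ w φ) (character ζ z • fderiv ℝ φ (shiftV w z) +
      φ (shiftV w z) • fderiv ℝ (character ζ) z) z := by
    have h2 : HasFDerivAt (character ζ) (fderiv ℝ (character ζ) z) z :=
      ((hasTemperateGrowth_character ζ).1.differentiable (by simp) z).hasFDerivAt
    have h3 : HasFDerivAt (fun z => φ (shiftV w z)) (fderiv ℝ φ (shiftV w z)) z := by
      have h4 : HasFDerivAt (shiftV w : Phase d → Phase d) (ContinuousLinearMap.id ℝ _) z := by
        rw [shiftV_eq]; exact (hasFDerivAt_id z).sub_const _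
      exact (φ.hasFDerivAt (shiftV w z)).comp z h4
    refine (h2.mul h3).congr_of_eventuallyEq (.of_forall fun z => modS_apply ζ w φ z)
  have h5 : fderiv ℝ (character ζ) z (0, e) = 0 := by
    have h7 : DifferentiableAt ℝ (fun x : Pos d => character ζ (x, 0)) z.1 :=
      ((hasTemperateGrowth_character ζ).1.differentiable (by simp) _).comp z.1
        (by fun_prop : DifferentiableAt ℝ (fun x : Pos d => (x, (0 : Pos d))) z.1)
    have h9 := (HasFDerivAt.comp z h7.hasFDerivAt
      (ContinuousLinearMap.fst ℝ (Pos d) (Pos d)).hasFDerivAt).fderiv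
    exact (DFunLike.congr_fun h9 (0, e)).trans (by simp)
  have h8 : L (shiftV w z) = L z := by
    rw [shiftV, hL, ← hL z.1 z.2]
  rw [letterT_apply, h1.fderiv, modS_apply, modS_apply, letterT_apply, h8]
  simp only [add_apply, smul_apply, h5, smul_eq_mul]
  ring

theorem modD_commute_letter (ζ w : Pos d) (a : ℂ) (e : Pos d) (b : ℂ) {L : Phase d →L[ℝ] ℂ}
    (hL : ∀ x v, L (x, v) = L (x, 0)) : Commute (letter a (0, e) b L) (modD ζ w) := by
  ext u φ
  change letter a (0, e) b L (modD ζ w u) φ = modD ζ w (letter a (0, e) b L u) φ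
  rw [letter_apply, modD_apply, modD_apply, letter_apply, modS_letterT ζ _ a e b hL]

/-- The operators that commute with all modulations in `x` and translations in `v`. -/
def modCommutant (d : ℕ) : Subalgebra ℂ (DistOp d) :=
  Subalgebra.centralizer ℂ {M | ∃ ζ w, M = modD ζ w}

theorem mem_modCommutant {D : DistOp d} : D ∈ modCommutant d ↔ ∀ ζ w, Commute D (modD ζ w) := by
  rw [modCommutant, Subalgebra.mem_centralizer_iff]
  constructor
  · intro h ζ w; exact (h _ ⟨ζ, w, rfl⟩).symm
  · rintro h _ ⟨ζ, w, rfl⟩; exact (h ζ w).symm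

theorem subalgebra_pow_le {A : Type*} [Ring A] [Algebra ℂ A] (S : Subalgebra ℂ A) {ι : Type*}
    {a : ι → A} (h : ∀ i, a i ∈ S) (n : ℕ) : letterSpan a ^ n ≤ Subalgebra.toSubmodule S := by
  have h1 : letterSpan a ≤ Subalgebra.toSubmodule S := by
    refine Submodule.span_le.2 ?_
    rintro _ (rfl | ⟨i, rfl⟩)
    · exact S.one_mem
    · exact h i
  induction n with
  | zero => rw [pow_zero, Submodule.one_le]; exact S.one_mem
  | succ n ih =>
    rw [pow_succ]
    exact Submodule.mul_le.2 fun x hx y hy => S.mul_mem (ih hx) (h1 hy)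

theorem subalgebra_mul_le {A : Type*} [Ring A] [Algebra ℂ A] (S : Subalgebra ℂ A)
    {M N : Submodule ℂ A} (hM : M ≤ Subalgebra.toSubmodule S) (hN : N ≤ Subalgebra.toSubmodule S) :
    M * N ≤ Subalgebra.toSubmodule S :=
  Submodule.mul_le.2 fun _ hx _ hy => S.mul_mem (hM hx) (hN hy)

theorem le_modCommutant (ε : ℝ) (i j n : ℕ) :
    letterSpan (xMinus ε : Fin d → DistOp d) ^ i * letterSpan (xPlus ε) ^ j * letterSpan dV ^ n ≤
      Subalgebra.toSubmodule (modCommutant d) := by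
  refine subalgebra_mul_le _ (subalgebra_mul_le _ (subalgebra_pow_le _ (fun k => ?_) _)
    (subalgebra_pow_le _ (fun k => ?_) _)) (subalgebra_pow_le _ (fun k => ?_) _)
  · rw [mem_modCommutant, xMinus_eq]
    exact fun ζ w => modD_commute_letter ζ w _ _ _ fun x v => by simp
  · rw [mem_modCommutant, xPlus_eq]
    exact fun ζ w => modD_commute_letter ζ w _ _ _ fun x v => by simp
  · rw [mem_modCommutant, dV_eq]
    exact fun ζ w => modD_commute_letter ζ w _ _ _ fun x v => by simp

/-! ### Vector-valued integrals and twisted convolutions -/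

theorem lintegral_norm_restrict_le {K : Set (Phase d)} (f : L2Phase d) :
    ∫⁻ z in K, ‖f z‖ₑ ≤ ‖f‖ₑ * volume K ^ (1 / 2 : ℝ) := by
  have h := eLpNorm_le_eLpNorm_mul_rpow_measure_univ (μ := volume.restrict K) (p := 1) (q := 2)
    one_le_two (f := f) (Lp.aestronglyMeasurable f).restrict
  rw [eLpNorm_one_eq_lintegral_enorm, Measure.restrict_apply_univ] at h
  refine h.trans ?_
  rw [Lp.enorm_def]
  have h2 : (1 / (1 : ℝ≥0∞).toReal - 1 / (2 : ℝ≥0∞).toReal) = (1 / 2 : ℝ) := by norm_num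
  rw [h2]
  gcongr
  exact Measure.restrict_le_self

section Integral

variable {Z : Type*} [MeasurableSpace Z] {μ : Measure Z} [SFinite μ]

theorem integrable_prod_restrict_of_L2 {g : Z × Phase d → ℂ}
    (hg : AEStronglyMeasurable g (μ.prod volume)) {G : Z → L2Phase d} (hG : Integrable G μ)
    (h : ∀ᵐ y ∂μ, ∀ᵐ z, G y z = g (y, z)) {K : Set (Phase d)} (hK : IsCompact K) :
    Integrable g (μ.prod (volume.restrict K)) := by
  have hKm := hK.measure_lt_top (μ := volume)
  have hm : AEStronglyMeasurable g (μ.prod (volume.restrict K)) := by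
    have : μ.prod ((volume : Measure (Phase d)).restrict K) =
        (μ.prod volume).restrict (Set.univ ×ˢ K) := by
      rw [← Measure.prod_restrict, Measure.restrict_univ]
    rw [this]; exact hg.restrict
  have hle : ∀ᵐ y ∂μ, ∫⁻ z in K, ‖g (y, z)‖ₑ ≤ ‖G y‖ₑ * volume K ^ (1 / 2 : ℝ) := by
    filter_upwards [h] with y hy
    refine le_trans (le_of_eq (lintegral_congr_ae ?_)) (lintegral_norm_restrict_le (G y))
    filter_upwards [ae_restrict_of_ae hy] with z hz
    rw [hz]
  refine ⟨hm, ?_⟩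
  rw [HasFiniteIntegral, lintegral_prod _ hm.enorm]
  refine (lintegral_mono_ae hle).trans_lt ?_
  rw [lintegral_mul_const' _ _ (ENNReal.rpow_ne_top_of_nonneg (by norm_num) hKm.ne)]
  exact ENNReal.mul_lt_top hG.2 (ENNReal.rpow_lt_top_of_nonneg (by norm_num) hKm.ne)

/-- An `L²`-valued Bochner integral can be computed pointwise. -/
theorem coeFn_integral {g : Z × Phase d → ℂ}
    (hg : AEStronglyMeasurable g (μ.prod volume)) {G : Z → L2Phase d} (hG : Integrable G μ)
    (h : ∀ᵐ y ∂μ, ∀ᵐ z, G y z = g (y, z)) :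
    ∀ᵐ z, (∫ y, G y ∂μ) z = ∫ y, g (y, z) ∂μ := by
  have hint := fun {K : Set (Phase d)} (hK : IsCompact K) =>
    integrable_prod_restrict_of_L2 hg hG h hK
  refine ae_eq_of_integral_contDiff_smul_eq ((Lp.memLp _).locallyIntegrable one_le_two) ?_
    fun α hα hαc => ?_
  · rw [locallyIntegrable_iff]
    exact fun K hK => (hint hK).integral_prod_right
  have hαm : MemLp (fun z => (α z : ℂ)) 2 (volume : Measure (Phase d)) :=
    (Complex.continuous_ofReal.comp hα.continuous).memLp_of_hasCompactSupport
      (hαc.comp_left (g := Complex.ofReal) rfl)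
  have h1 : ∀ f : L2Phase d, (pairL2 d).flip (hαm.toLp _) f = ∫ z, α z • f z := fun f => by
    rw [ContinuousLinearMap.flip_apply, pairL2_apply]
    refine integral_congr_ae ?_
    filter_upwards [hαm.coeFn_toLp] with z hz
    rw [hz, Complex.real_smul, mul_comm]
  have h2 : Integrable (fun p : Z × Phase d => α p.2 • g p) (μ.prod volume) := by
    have h3 := hint (HasCompactSupport.isCompact hαc)
    have h4 : μ.prod ((volume : Measure (Phase d)).restrict (tsupport α)) =
        (μ.prod volume).restrict (Set.univ ×ˢ tsupport α) := by
      rw [← Measure.prod_restrict, Measure.restrict_univ]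
    rw [h4] at h3
    obtain ⟨C, hC⟩ := hα.continuous.bounded_above_of_compact_support hαc
    have h5 : IntegrableOn (fun p : Z × Phase d => α p.2 • g p) (Set.univ ×ˢ tsupport α)
        (μ.prod volume) := by
      exact Integrable.bdd_smul (C := C) h3
        (hα.continuous.measurable.comp measurable_snd).aestronglyMeasurable
        (.of_forall fun p => hC p.2)
    refine h5.integrable_of_forall_notMem_eq_zero fun p hp => ?_
    have : p.2 ∉ tsupport α := fun hm => hp ⟨trivial, hm⟩
    rw [image_eq_zero_of_notMem_tsupport this, zero_smul]
  rw [← h1, ← ContinuousLinearMap.integral_comp_comm _ hG]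
  simp only [h1, ← integral_smul]
  refine Eq.trans (integral_congr_ae ?_) (integral_integral_swap h2)
  filter_upwards [h] with y hy
  refine integral_congr_ae ?_
  filter_upwards [hy] with z hz
  rw [hz]

end Integral

/-- Superpositions `∫ U(y) T_y f dy` of a strongly continuous family of contractions. -/
def superpose (T : Phase d → L2Phase d →L[ℂ] L2Phase d) (hT : ∀ f, Continuous fun y => T y f)
    (hn : ∀ y f, ‖T y f‖ ≤ ‖f‖) :
    Lp ℂ 1 (volume : Measure (Phase d)) →L[ℂ] L2Phase d →L[ℂ] L2Phase d :=
  have hi : ∀ (U : Lp ℂ 1 (volume : Measure (Phase d))) (f : L2Phase d),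
      Integrable fun y => U y • T y f := fun U f => by
    refine Integrable.mono' ((L1.integrable_coeFn U).norm.mul_const ‖f‖)
      ((Lp.aestronglyMeasurable U).smul (hT f).aestronglyMeasurable) (.of_forall fun y => ?_)
    rw [norm_smul]
    exact mul_le_mul_of_nonneg_left (hn y f) (norm_nonneg _)
  LinearMap.mkContinuous₂ (LinearMap.mk₂ ℂ (fun U f => ∫ y, U y • T y f)
    (fun U U' f => by
      rw [← integral_add (hi U f) (hi U' f)]
      refine integral_congr_ae ?_
      filter_upwards [Lp.coeFn_add U U'] with y hy
      rw [hy, Pi.add_apply, add_smul])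
    (fun c U f => by
      rw [← integral_smul]
      refine integral_congr_ae ?_
      filter_upwards [Lp.coeFn_smul c U] with y hy
      rw [hy, Pi.smul_apply, smul_assoc])
    (fun U f f' => by
      rw [← integral_add (hi U f) (hi U f')]
      simp only [map_add, smul_add])
    (fun c U f => by
      rw [← integral_smul]
      simp only [map_smul, smul_comm c])) 1 fun U f => by
        refine (norm_integral_le_of_norm_le ((L1.integrable_coeFn U).norm.mul_const ‖f‖)
          (.of_forall fun y => ?_)).trans ?_
        · rw [norm_smul]
          exact mul_le_mul_of_nonneg_left (hn y f) (norm_nonneg _)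
        · rw [integral_mul_const, one_mul, L1.norm_eq_integral_norm]

theorem integrable_superpose {T : Phase d → L2Phase d →L[ℂ] L2Phase d}
    (hT : ∀ f, Continuous fun y => T y f) (hn : ∀ y f, ‖T y f‖ ≤ ‖f‖)
    (U : Lp ℂ 1 (volume : Measure (Phase d))) (f : L2Phase d) :
    Integrable fun y => U y • T y f := by
  refine Integrable.mono' ((L1.integrable_coeFn U).norm.mul_const ‖f‖)
    ((Lp.aestronglyMeasurable U).smul (hT f).aestronglyMeasurable) (.of_forall fun y => ?_)
  rw [norm_smul]
  exact mul_le_mul_of_nonneg_left (hn y f) (norm_nonneg _)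

/-- The operator `(U, f) ↦ ∫ U(ζ, w) e^{2πi ζ·x} f(x, v - c ζ) dζ dw`. -/
def twistConv (d : ℕ) (c : ℝ) :
    Lp ℂ 1 (volume : Measure (Phase d)) →L[ℂ] L2Phase d →L[ℂ] L2Phase d :=
  superpose (fun y => modL2 y.1 (c • y.1))
    (fun f => continuous_modL2 continuous_fst (continuous_fst.const_smul c) f)
    (fun _ f => (norm_modL2 _ _ f).le)

theorem twistConv_apply (c : ℝ) (U : Lp ℂ 1 (volume : Measure (Phase d))) (f : L2Phase d) :
    twistConv d c U f = ∫ y, U y • modL2 y.1 (c • y.1) f := rfl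

theorem integrable_twistConv (c : ℝ) (U : Lp ℂ 1 (volume : Measure (Phase d))) (f : L2Phase d) :
    Integrable fun y => U y • modL2 y.1 (c • y.1) f :=
  integrable_superpose (fun f => continuous_modL2 continuous_fst (continuous_fst.const_smul c) f)
    (fun _ f => (norm_modL2 _ _ f).le) U f

theorem coeFn_twistConv (c : ℝ) (U : Lp ℂ 1 (volume : Measure (Phase d))) (f : L2Phase d) :
    ∀ᵐ z, twistConv d c U f z = ∫ y, U y * (character y.1 z * f (shiftV (c • y.1) z)) := by
  rw [twistConv_apply]
  refine coeFn_integral (g := fun p : Phase d × Phase d =>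
    U p.1 * (character p.1.1 p.2 * f (shiftV (c • p.1.1) p.2))) ?_ (integrable_twistConv c U f)
    (.of_forall fun y => ?_)
  · have h1 : StronglyMeasurable fun p : Phase d × Phase d => U p.1 :=
      (Lp.stronglyMeasurable U).comp_measurable measurable_fst
    have h2 : Continuous fun p : Phase d × Phase d => character p.1.1 p.2 := by
      unfold character; fun_prop
    have h3 : Continuous fun p : Phase d × Phase d => shiftV (c • p.1.1) p.2 := by
      unfold shiftV; fun_prop
    exact (h1.mul (h2.stronglyMeasurable.mul
      ((Lp.stronglyMeasurable f).comp_measurable h3.measurable))).aestronglyMeasurable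
  · filter_upwards [Lp.coeFn_smul (U y) (modL2 y.1 (c • y.1) f), coeFn_modL2 y.1 (c • y.1) f]
      with z h1 h2
    rw [h1, Pi.smul_apply, h2, smul_eq_mul]

/-- The partial Fourier transform turns the modulated shifts into translations by (ζ, cζ). The
result involves U only through its integral over the second variable, which is why the later
estimates need just ∫ |U(ζ, w)| dw. -/
theorem coeFn_fourierL2_twistConv (c : ℝ) (U : Lp ℂ 1 (volume : Measure (Phase d)))
    (f : L2Phase d) : ∀ᵐ z, fourierL2 d (twistConv d c U f) z =
      ∫ y, U y * fourierL2 d f (z - (y.1, c • y.1)) := by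
  have hi : Integrable fun y => U y • translateL2 (y.1, c • y.1) (fourierL2 d f) := by
    simpa only [map_smul, fourierL2_modL2] using
      (fourierL2 d).integrable_comp (integrable_twistConv c U f)
  rw [twistConv_apply, ← ContinuousLinearMap.integral_comp_comm _ (integrable_twistConv c U f)]
  simp only [map_smul, fourierL2_modL2]
  refine coeFn_integral (g := fun p : Phase d × Phase d =>
    U p.1 * fourierL2 d f (p.2 - (p.1.1, c • p.1.1))) ?_ hi (.of_forall fun y => ?_)
  · have h1 : StronglyMeasurable fun p : Phase d × Phase d => U p.1 :=
      (Lp.stronglyMeasurable U).comp_measurable measurable_fst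
    have h3 : Continuous fun p : Phase d × Phase d => p.2 - (p.1.1, c • p.1.1) := by fun_prop
    exact (h1.mul
      ((Lp.stronglyMeasurable (fourierL2 d f)).comp_measurable h3.measurable)).aestronglyMeasurable
  · filter_upwards [Lp.coeFn_smul (U y) (translateL2 (y.1, c • y.1) (fourierL2 d f)),
      coeFn_translateL2 (y.1, c • y.1) (fourierL2 d f)] with z h1 h2
    rw [h1, Pi.smul_apply, h2, smul_eq_mul]

/-- Tested against a fixed φ, the operator Q becomes a continuous functional on L². It therefore
enters the Bochner integral and meets each modulated shift separately, where it commutes. -/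
theorem twistConv_of_mem_modCommutant {Q : DistOp d} (hQ : Q ∈ modCommutant d) (c : ℝ)
    (U : Lp ℂ 1 (volume : Measure (Phase d))) {f g : L2Phase d} (h : Q (toDist d f) = toDist d g) :
    Q (toDist d (twistConv d c U f)) = toDist d (twistConv d c U g) := by
  have h0 : ∀ ζ w, Q (toDist d (modL2 ζ w f)) = toDist d (modL2 ζ w g) := fun ζ w => by
    rw [← modD_toDist, ← modD_toDist, ← h]
    exact DFunLike.congr_fun (mem_modCommutant.1 hQ ζ w).eq (toDist d f)
  ext φ
  let ℓ : Dist d →L[ℂ] ℂ := PointwiseConvergenceCLM.evalCLM _ _ φ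
  let ℓ1 : L2Phase d →L[ℂ] ℂ := ℓ ∘L Q ∘L toDist d
  let ℓ2 : L2Phase d →L[ℂ] ℂ := ℓ ∘L toDist d
  change ℓ1 (twistConv d c U f) = ℓ2 (twistConv d c U g)
  rw [twistConv_apply, twistConv_apply,
    ← ContinuousLinearMap.integral_comp_comm _ (integrable_twistConv c U f),
    ← ContinuousLinearMap.integral_comp_comm _ (integrable_twistConv c U g)]
  refine integral_congr_ae (.of_forall fun y => ?_)
  change ℓ1 _ = ℓ2 _
  rw [map_smul, map_smul]
  exact congrArg (fun u : Dist d => U y • u φ) (h0 _ _)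

/-! ### Weighted convolution estimates -/

theorem lintegral_mul_sq_le {α : Type*} [MeasurableSpace α] (μ : Measure α) {f g : α → ℝ≥0∞}
    (hf : AEMeasurable f μ) (hg : AEMeasurable g μ) :
    (∫⁻ a, f a * g a ∂μ) ^ 2 ≤ (∫⁻ a, f a ^ 2 ∂μ) * ∫⁻ a, g a ^ 2 ∂μ := by
  have h := ENNReal.lintegral_mul_le_Lp_mul_Lq μ Real.HolderConjugate.two_two hf hg
  simp only [Pi.mul_apply, ENNReal.rpow_ofNat] at h
  refine (pow_le_pow_left' h 2).trans (le_of_eq ?_)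
  have e : ∀ x : ℝ≥0∞, (x ^ (1 / 2 : ℝ)) ^ 2 = x := fun x => by
    rw [← ENNReal.rpow_natCast, ← ENNReal.rpow_mul]; norm_num
  rw [mul_pow, e, e]

theorem add_sq_le_four_mul (a b : ℝ≥0∞) : (a + b) ^ 2 ≤ 4 * (a ^ 2 + b ^ 2) := by
  have key : ∀ a b : ℝ≥0∞, a ≤ b → (a + b) ^ 2 ≤ 4 * (a ^ 2 + b ^ 2) := fun a b h => by
    calc (a + b) ^ 2 ≤ (b + b) ^ 2 := by gcongr
      _ = 4 * b ^ 2 := by ring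
      _ ≤ _ := by gcongr; exact le_add_self
  rcases le_total a b with h | h
  · exact key a b h
  · rw [add_comm a b, add_comm (a ^ 2)]; exact key b a h

/-- A weighted estimate for twisted convolutions. -/
theorem lintegral_conv_sq_le {A a : Pos d → ℝ≥0∞} {F ϖ : Phase d → ℝ≥0∞}
    {κ : Phase d → Pos d → ℝ≥0∞} (ℓ : Pos d → Phase d) (hℓ : Continuous ℓ) (hA : Measurable A)
    (ha : Measurable a) (hF : Measurable F) (hϖ : Measurable ϖ)
    (hκ : ∀ z, Measurable (κ z)) (h : ∀ z ζ, ϖ z ≤ a ζ * ϖ (z - ℓ ζ) * κ z ζ) {K : ℝ≥0∞}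
    (hK : ∀ z, ∫⁻ ζ, κ z ζ ^ 2 ≤ K) :
    ∫⁻ z, (ϖ z * ∫⁻ ζ, A ζ * F (z - ℓ ζ)) ^ 2 ≤
      K * ((∫⁻ ζ, (a ζ * A ζ) ^ 2) * ∫⁻ z, (ϖ z * F z) ^ 2) := by
  have hm : ∀ z, Measurable fun ζ => z - ℓ ζ := fun z => by
    have : Continuous fun ζ => z - ℓ ζ := by fun_prop
    exact this.measurable
  have h1 : ∀ z, (ϖ z * ∫⁻ ζ, A ζ * F (z - ℓ ζ)) ^ 2 ≤
      K * ∫⁻ ζ, (a ζ * A ζ) ^ 2 * (ϖ (z - ℓ ζ) * F (z - ℓ ζ)) ^ 2 := fun z => by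
    -- The weight at z is distributed over the integrand so that κ(z, ·) can be split off by
    -- Cauchy–Schwarz in ζ and bounded uniformly in z.
    have e1 : ϖ z * ∫⁻ ζ, A ζ * F (z - ℓ ζ) ≤
        ∫⁻ ζ, κ z ζ * (a ζ * A ζ * (ϖ (z - ℓ ζ) * F (z - ℓ ζ))) := by
      have hm4 : Measurable fun ζ => A ζ * F (z - ℓ ζ) := hA.mul (hF.comp (hm z))
      rw [← lintegral_const_mul _ hm4]
      refine lintegral_mono fun ζ => ?_
      calc ϖ z * (A ζ * F (z - ℓ ζ)) ≤ (a ζ * ϖ (z - ℓ ζ) * κ z ζ) * (A ζ * F (z - ℓ ζ)) := by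
            gcongr; exact h z ζ
        _ = _ := by ring
    refine (pow_le_pow_left' e1 2).trans ((lintegral_mul_sq_le _ (hκ z).aemeasurable ?_).trans ?_)
    · exact ((ha.mul hA).mul ((hϖ.comp (hm z)).mul (hF.comp (hm z)))).aemeasurable
    · simp only [mul_pow]
      gcongr
      exact hK z
  refine (lintegral_mono h1).trans ?_
  have hm2 : Measurable fun p : Phase d × Pos d => p.1 - ℓ p.2 := by
    have : Continuous fun p : Phase d × Pos d => p.1 - ℓ p.2 := by fun_prop
    exact this.measurable
  have hm3 : Measurable fun p : Phase d × Pos d =>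
      (a p.2 * A p.2) ^ 2 * (ϖ (p.1 - ℓ p.2) * F (p.1 - ℓ p.2)) ^ 2 :=
    (((ha.mul hA).comp measurable_snd).pow_const 2).mul
      (((hϖ.mul hF).comp hm2).pow_const 2)
  rw [lintegral_const_mul _ hm3.lintegral_prod_right']
  gcongr
  -- Once z is integrated first, translation invariance removes the shift by ℓ(ζ).
  rw [lintegral_lintegral_swap hm3.aemeasurable]
  have e2 : ∀ ζ, ∫⁻ z, (a ζ * A ζ) ^ 2 * (ϖ (z - ℓ ζ) * F (z - ℓ ζ)) ^ 2 =
      (a ζ * A ζ) ^ 2 * ∫⁻ z, (ϖ z * F z) ^ 2 := fun ζ => by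
    rw [lintegral_const_mul, lintegral_sub_right_eq_self fun z => (ϖ z * F z) ^ 2]
    have : Measurable fun z => z - ℓ ζ := by fun_prop
    exact ((hϖ.mul hF).comp this).pow_const 2
  simp only [e2]
  have hm5 : Measurable fun ζ => (a ζ * A ζ) ^ 2 := (ha.mul hA).pow_const 2
  rw [lintegral_mul_const _ hm5]

/-- `(1 + |y|)^{-r}`. -/
def decay (r : ℕ) (y : Pos d) : ℝ := ((1 + ‖y‖) ^ r)⁻¹

theorem decay_nonneg (r : ℕ) (y : Pos d) : 0 ≤ decay r y := by unfold decay; positivity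

theorem continuous_decay (r : ℕ) : Continuous (decay r : Pos d → ℝ) := by
  unfold decay
  exact Continuous.inv₀ (by fun_prop) fun y => by positivity

theorem lintegral_decay_sq_lt_top {r : ℕ} (hr : (d : ℝ) / 2 < r) :
    ∫⁻ y : Pos d, ENNReal.ofReal (decay r y) ^ 2 < ⊤ := by
  have h := finite_integral_one_add_norm (E := Pos d) (μ := volume) (r := 2 * r)
    (by rw [finrank_euclideanSpace_fin]; linarith)
  refine lt_of_eq_of_lt (lintegral_congr fun y => ?_) h
  rw [← ENNReal.ofReal_pow (decay_nonneg r y), decay, Real.rpow_neg (by positivity), inv_pow,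
    ← pow_mul]
  congr 2
  rw [← Real.rpow_natCast]
  push_cast
  ring_nf

/-- The scaling by c is handled by comparing 1 + |c⁻¹q - y| with 1 + |q - cy|; translation
invariance then makes the bound independent of q. -/
theorem exists_lintegral_decay_sq_le {r : ℕ} (hr : (d : ℝ) / 2 < r) {c : ℝ} (hc : c ≠ 0) :
    ∃ K < (⊤ : ℝ≥0∞), ∀ q : Pos d, ∫⁻ y, ENNReal.ofReal (decay r (q - c • y)) ^ 2 ≤ K := by
  refine ⟨ENNReal.ofReal ((1 + |c|⁻¹) ^ r) ^ 2 * ∫⁻ y : Pos d, ENNReal.ofReal (decay r y) ^ 2,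
    ENNReal.mul_lt_top (ENNReal.pow_lt_top ENNReal.ofReal_lt_top) (lintegral_decay_sq_lt_top hr),
    fun q => ?_⟩
  rw [← lintegral_sub_left_eq_self (fun y : Pos d => ENNReal.ofReal (decay r y) ^ 2) (c⁻¹ • q),
    ← lintegral_const_mul']
  swap
  · exact (ENNReal.pow_lt_top ENNReal.ofReal_lt_top).ne
  refine lintegral_mono fun y => ?_
  rw [← mul_pow, ← ENNReal.ofReal_mul (by positivity)]
  gcongr
  have h1 : ‖c⁻¹ • q - y‖ = |c|⁻¹ * ‖q - c • y‖ := by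
    rw [← abs_inv, ← Real.norm_eq_abs, ← norm_smul, smul_sub, smul_smul, inv_mul_cancel₀ hc,
      one_smul]
  have h2 : 1 + ‖c⁻¹ • q - y‖ ≤ (1 + |c|⁻¹) * (1 + ‖q - c • y‖) := by
    rw [h1]
    have := inv_nonneg.2 (abs_nonneg c)
    nlinarith [norm_nonneg (q - c • y)]
  have h3 := pow_le_pow_left₀ (by positivity) h2 r
  rw [mul_pow] at h3
  rw [decay, decay, ← div_eq_mul_inv, inv_eq_one_div,
    div_le_div_iff₀ (by positivity) (by positivity), one_mul]
  exact h3

/-- The two inverse powers correspond to two cases. If Z ≤ W', then W is at most a multiple of W'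
and the term with Z^{-r} suffices. If W' ≤ Z, then W^i is at most a multiple of Z^i, and Z^i ≤ Z^r
W'^{i-r} because i ≤ r. -/
theorem pow_le_of_le_add {Z W W' c : ℝ} (hZ : 1 ≤ Z) (hW : 0 ≤ W) (hW' : 1 ≤ W') (hc : 0 ≤ c)
    (h : W ≤ W' + c * Z) {i r : ℕ} (hi : i ≤ r) :
    W ^ i ≤ (1 + c) ^ r * Z ^ r * W' ^ i * ((Z ^ r)⁻¹ + (W' ^ r)⁻¹) := by
  have h0 : (1 + c) ^ i ≤ (1 + c) ^ r := pow_le_pow_right₀ (by linarith) hi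
  have hZ0 : 0 < Z := by linarith
  have hW0 : 0 < W' := by linarith
  have e : (1 + c) ^ r * Z ^ r * W' ^ i * ((Z ^ r)⁻¹ + (W' ^ r)⁻¹) =
      (1 + c) ^ r * W' ^ i + (1 + c) ^ r * (Z ^ r * W' ^ i * (W' ^ r)⁻¹) := by
    field_simp
  rw [e]
  rcases le_total Z W' with h1 | h1
  · have h2 : W ≤ (1 + c) * W' := by nlinarith
    have h3 : W ^ i ≤ (1 + c) ^ i * W' ^ i := by
      rw [← mul_pow]; exact pow_le_pow_left₀ hW h2 i
    have h4 : (1 + c) ^ i * W' ^ i ≤ (1 + c) ^ r * W' ^ i := by gcongr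
    have h5 : 0 ≤ (1 + c) ^ r * (Z ^ r * W' ^ i * (W' ^ r)⁻¹) := by positivity
    linarith
  · have h2 : W ≤ (1 + c) * Z := by nlinarith
    have h3 : W ^ i ≤ (1 + c) ^ i * Z ^ i := by
      rw [← mul_pow]; exact pow_le_pow_left₀ hW h2 i
    have h4 : Z ^ i ≤ Z ^ r * W' ^ i * (W' ^ r)⁻¹ := by
      rw [← div_eq_mul_inv, le_div_iff₀ (by positivity)]
      obtain ⟨k, rfl⟩ := Nat.exists_eq_add_of_le hi
      calc Z ^ i * W' ^ (i + k) = Z ^ i * W' ^ i * W' ^ k := by ring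
        _ ≤ Z ^ i * W' ^ i * Z ^ k := by gcongr
        _ = _ := by ring
    have h5 : (1 + c) ^ i * Z ^ i ≤ (1 + c) ^ r * (Z ^ r * W' ^ i * (W' ^ r)⁻¹) := by gcongr
    have h6 : 0 ≤ (1 + c) ^ r * W' ^ i := by positivity
    linarith

theorem pow_le_add_pow {Z W U c : ℝ} (hZ : 0 ≤ Z) (hW : 0 < W) (hU : 0 < U) (hc : 0 ≤ c)
    (h : Z ≤ c * (W + U)) (r : ℕ) :
    Z ^ r ≤ (2 * c) ^ r * (W ^ r * U ^ r) * ((W ^ r)⁻¹ + (U ^ r)⁻¹) := by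
  have e : (2 * c) ^ r * (W ^ r * U ^ r) * ((W ^ r)⁻¹ + (U ^ r)⁻¹) =
      (2 * c) ^ r * W ^ r + (2 * c) ^ r * U ^ r := by
    field_simp
    ring
  have h1 : 0 ≤ (2 * c) ^ r * W ^ r := by positivity
  have h2 : 0 ≤ (2 * c) ^ r * U ^ r := by positivity
  rw [e]
  rcases le_total W U with h3 | h3
  · have : Z ^ r ≤ (2 * c * U) ^ r := pow_le_pow_left₀ hZ (by nlinarith) r
    rw [mul_pow] at this; linarith
  · have : Z ^ r ≤ (2 * c * W) ^ r := pow_le_pow_left₀ hZ (by nlinarith) r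
    rw [mul_pow] at this; linarith

theorem wP_sub (ε c : ℝ) (z : Phase d) (ζ : Pos d) :
    wP ε z = wP ε (z - (ζ, c • ζ)) + (2 * Real.pi * ε + 2 * c) • ζ := by
  simp only [wP, Prod.fst_sub, Prod.snd_sub]
  module

theorem wM_sub (ε c : ℝ) (z : Phase d) (ζ : Pos d) :
    wM ε z = wM ε (z - (ζ, c • ζ)) + (2 * Real.pi * ε - 2 * c) • ζ := by
  simp only [wM, Prod.fst_sub, Prod.snd_sub]
  module

theorem one_add_norm_pow_le (y ζ : Pos d) {n m : ℕ} (hn : n ≤ m) :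
    (1 + ‖y‖) ^ n ≤ (1 + ‖ζ‖) ^ m * (1 + ‖y - ζ‖) ^ n := by
  have h1 : 1 + ‖y‖ ≤ (1 + ‖ζ‖) * (1 + ‖y - ζ‖) := by
    have h2 : ‖y‖ ≤ ‖ζ‖ + ‖y - ζ‖ := by
      calc ‖y‖ = ‖ζ + (y - ζ)‖ := by rw [add_sub_cancel]
        _ ≤ _ := norm_add_le _ _
    nlinarith [norm_nonneg ζ, norm_nonneg (y - ζ), mul_nonneg (norm_nonneg ζ) (norm_nonneg (y - ζ))]
  calc (1 + ‖y‖) ^ n ≤ ((1 + ‖ζ‖) * (1 + ‖y - ζ‖)) ^ n := by gcongr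
    _ = (1 + ‖ζ‖) ^ n * (1 + ‖y - ζ‖) ^ n := mul_pow _ _ _
    _ ≤ _ := by
      gcongr
      · linarith [norm_nonneg ζ]

theorem one_add_norm_pow_le_decay (q ζ : Pos d) (c : ℝ) {i r : ℕ} (hi : i ≤ r) :
    (1 + ‖q‖) ^ i ≤ (1 + |c|) ^ r * (1 + ‖ζ‖) ^ r * (1 + ‖q - c • ζ‖) ^ i *
      (decay r ζ + decay r (q - c • ζ)) := by
  refine pow_le_of_le_add (by simp) (by positivity) (by simp) (abs_nonneg c) ?_ hi
  have h2 : ‖q‖ ≤ ‖q - c • ζ‖ + |c| * ‖ζ‖ := by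
    calc ‖q‖ = ‖(q - c • ζ) + c • ζ‖ := by rw [sub_add_cancel]
      _ ≤ ‖q - c • ζ‖ + ‖c • ζ‖ := norm_add_le _ _
      _ = _ := by rw [norm_smul, Real.norm_eq_abs]
  nlinarith [abs_nonneg c]

theorem continuous_weight (ε : ℝ) (n i j : ℕ) : Continuous (weight ε n i j : Phase d → ℝ) := by
  have h1 := continuous_wP (d := d) ε
  have h2 := continuous_wM (d := d) ε
  unfold weight
  fun_prop

theorem one_le_weight (ε : ℝ) (n i j : ℕ) (z : Phase d) : 1 ≤ weight ε n i j z := by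
  have h : ∀ (y : Pos d) (k : ℕ), 1 ≤ (1 + ‖y‖) ^ k := fun y k => one_le_pow₀ (by simp)
  exact one_le_mul_of_one_le_of_one_le (one_le_mul_of_one_le_of_one_le (h _ _) (h _ _)) (h _ _)

/-- The velocity that the weights `V_±` lose in a shift along `(ζ, ± π ε ζ)`. -/
theorem weight_le (ε : ℝ) {c : ℝ} (hc : c = Real.pi * ε ∨ c = -(Real.pi * ε)) :
    ∃ q : Phase d → Pos d, ∀ {m r n i j : ℕ}, n ≤ m → i ≤ r → j ≤ r → ∀ (z : Phase d) (ζ : Pos d),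
      weight ε n i j z ≤ ((1 + |4 * Real.pi * ε|) ^ r * (1 + ‖ζ‖) ^ (m + r)) *
        weight ε n i j (z - (ζ, c • ζ)) * (decay r ζ + decay r (q z - (4 * Real.pi * ε) • ζ)) := by
  -- For c = πε the shift moves w_+ by 4πεζ and fixes w_-; for c = -πε the roles are exchanged. Only
  -- the moving factor has to be split, and q(z) is its value at z.
  rcases hc with rfl | rfl
  · refine ⟨wP ε, fun {m r n i j} hn hi hj z ζ => ?_⟩
    have h1 := wP_sub ε (Real.pi * ε) z ζ
    have h2 := wM_sub ε (Real.pi * ε) z ζ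
    rw [show 2 * Real.pi * ε + 2 * (Real.pi * ε) = 4 * Real.pi * ε by ring] at h1
    rw [show 2 * Real.pi * ε - 2 * (Real.pi * ε) = 0 by ring, zero_smul, add_zero] at h2
    have h3 := one_add_norm_pow_le_decay (wP ε z) ζ (4 * Real.pi * ε) hi
    have h4 := one_add_norm_pow_le z.1 ζ hn
    have h5 : wP ε z - (4 * Real.pi * ε) • ζ = wP ε (z - (ζ, (Real.pi * ε) • ζ)) := by
      rw [h1, add_sub_cancel_right]
    rw [weight, weight, ← h2, ← h5, Prod.fst_sub]
    calc _ ≤ ((1 + ‖ζ‖) ^ m * (1 + ‖z.1 - ζ‖) ^ n) * ((1 + |4 * Real.pi * ε|) ^ r *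
          (1 + ‖ζ‖) ^ r * (1 + ‖wP ε z - (4 * Real.pi * ε) • ζ‖) ^ i *
          (decay r ζ + decay r (wP ε z - (4 * Real.pi * ε) • ζ))) * (1 + ‖wM ε z‖) ^ j := by
          gcongr
      _ = _ := by ring
  · refine ⟨wM ε, fun {m r n i j} hn hi hj z ζ => ?_⟩
    have h1 := wP_sub ε (-(Real.pi * ε)) z ζ
    have h2 := wM_sub ε (-(Real.pi * ε)) z ζ
    rw [show 2 * Real.pi * ε - 2 * -(Real.pi * ε) = 4 * Real.pi * ε by ring] at h2
    rw [show 2 * Real.pi * ε + 2 * -(Real.pi * ε) = 0 by ring, zero_smul, add_zero] at h1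
    have h3 := one_add_norm_pow_le_decay (wM ε z) ζ (4 * Real.pi * ε) hj
    have h4 := one_add_norm_pow_le z.1 ζ hn
    have h5 : wM ε z - (4 * Real.pi * ε) • ζ = wM ε (z - (ζ, (-(Real.pi * ε)) • ζ)) := by
      rw [h2, add_sub_cancel_right]
    rw [weight, weight, ← h1, ← h5, Prod.fst_sub]
    calc _ ≤ ((1 + ‖ζ‖) ^ m * (1 + ‖z.1 - ζ‖) ^ n) * (1 + ‖wP ε z‖) ^ i *
          ((1 + |4 * Real.pi * ε|) ^ r *
          (1 + ‖ζ‖) ^ r * (1 + ‖wM ε z - (4 * Real.pi * ε) • ζ‖) ^ j *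
          (decay r ζ + decay r (wM ε z - (4 * Real.pi * ε) • ζ))) := by
          gcongr
      _ = _ := by ring

/-- Integrable functions on phase space. -/
abbrev L1Phase (d : ℕ) : Type := Lp ℂ 1 (volume : Measure (Phase d))

theorem memLp_two_iff {α : Type*} [MeasurableSpace α] {μ : Measure α} {f : α → ℂ}
    (hf : AEStronglyMeasurable f μ) : MemLp f 2 μ ↔ ∫⁻ z, ‖f z‖ₑ ^ 2 ∂μ < ⊤ := by
  have h := eLpNorm_lt_top_iff_lintegral_rpow_enorm_lt_top (f := f) (μ := μ) two_ne_zero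
    ENNReal.ofNat_ne_top
  simp only [ENNReal.toReal_ofNat, ENNReal.rpow_ofNat] at h
  exact ⟨fun H => h.1 H.2, fun H => ⟨hf, h.2 H⟩⟩

theorem lintegral_phase_eq {f : Phase d → ℝ≥0∞} (hf : Measurable f) :
    ∫⁻ z, f z = ∫⁻ x, ∫⁻ v, f (x, v) :=
  lintegral_prod f hf.aemeasurable

theorem enorm_weight_mul (ε : ℝ) (n i j : ℕ) (z : Phase d) (c : ℂ) :
    ‖(weight ε n i j z : ℂ) * c‖ₑ = ENNReal.ofReal (weight ε n i j z) * ‖c‖ₑ := by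
  rw [enorm_mul, ← ofReal_norm, Complex.norm_real,
    Real.norm_of_nonneg (zero_le_one.trans (one_le_weight ε n i j z))]

/-- The convolution estimate `lintegral_conv_sq_le` applied to A(ζ) = ∫ |U(ζ, w)| dw, with shifts
along (ζ, cζ). The loss (1 + |ζ|)^{m+r} is charged to A; the square integrable factor κ is the one
furnished by `weight_le`. -/
theorem memLp_weight_twistConv {ε : ℝ} (hε : 0 < ε) {c : ℝ}
    (hc : c = Real.pi * ε ∨ c = -(Real.pi * ε)) {m r n i j : ℕ} (hr : (d : ℝ) / 2 < r) (hn : n ≤ m)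
    (hi : i ≤ r) (hj : j ≤ r) (U : L1Phase d)
    (hU : ∫⁻ ζ : Pos d, (ENNReal.ofReal ((1 + ‖ζ‖) ^ (m + r)) * ∫⁻ w, ‖U (ζ, w)‖ₑ) ^ 2 < ⊤)
    {f : L2Phase d} (hf : MemLp (fun z => (weight ε n i j z : ℂ) * fourierL2 d f z) 2 volume) :
    MemLp (fun z => (weight ε n i j z : ℂ) * fourierL2 d (twistConv d c U f) z) 2 volume := by
  have hm : ∀ g : L2Phase d,
      AEStronglyMeasurable (fun z => (weight ε n i j z : ℂ) * fourierL2 d g z) := fun g =>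
    (Complex.continuous_ofReal.comp (continuous_weight ε n i j)).aestronglyMeasurable.mul
      (Lp.aestronglyMeasurable _)
  rw [memLp_two_iff (hm _)] at hf ⊢
  simp only [enorm_weight_mul] at hf ⊢
  obtain ⟨q, hq⟩ := weight_le (d := d) ε hc
  obtain ⟨K, hK, hK'⟩ := exists_lintegral_decay_sq_le (d := d) hr
    (c := 4 * Real.pi * ε) (by positivity)
  set C := (1 + |4 * Real.pi * ε|) ^ r
  set A : Pos d → ℝ≥0∞ := fun ζ => ∫⁻ w, ‖U (ζ, w)‖ₑ
  have hUm : Measurable fun y : Phase d => ‖U y‖ₑ := (Lp.stronglyMeasurable U).measurable.enorm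
  have hFm : Measurable fun y : Phase d => ‖fourierL2 d f y‖ₑ :=
    (Lp.stronglyMeasurable (fourierL2 d f)).measurable.enorm
  have hdm : Continuous (decay r : Pos d → ℝ) := continuous_decay r
  have key := lintegral_conv_sq_le (A := A) (a := fun ζ => ENNReal.ofReal (C * (1 + ‖ζ‖) ^ (m + r)))
    (F := fun y => ‖fourierL2 d f y‖ₑ) (ϖ := fun z => ENNReal.ofReal (weight ε n i j z))
    (κ := fun z ζ => ENNReal.ofReal (decay r ζ + decay r (q z - (4 * Real.pi * ε) • ζ)))
    (fun ζ => (ζ, c • ζ)) (by fun_prop) hUm.lintegral_prod_right' (by fun_prop) hFm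
    (continuous_weight ε n i j).measurable.ennreal_ofReal
    (fun z => (Continuous.measurable (by fun_prop)).ennreal_ofReal) (fun z ζ => by
      rw [← ENNReal.ofReal_mul (by positivity), ← ENNReal.ofReal_mul]
      · exact ENNReal.ofReal_le_ofReal (hq hn hi hj z ζ)
      · have := one_le_weight ε n i j (z - (ζ, c • ζ))
        positivity)
    -- The two decaying terms of κ are separated by (a + b)² ≤ 4(a² + b²); one does not depend on z,
    -- the other is bounded uniformly in z.
    (K := 4 * ((∫⁻ y : Pos d, ENNReal.ofReal (decay r y) ^ 2) + K)) (fun z => by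
      have h1 : ∀ ζ : Pos d,
          ENNReal.ofReal (decay r ζ + decay r (q z - (4 * Real.pi * ε) • ζ)) ^ 2 ≤
          4 * (ENNReal.ofReal (decay r ζ) ^ 2 +
            ENNReal.ofReal (decay r (q z - (4 * Real.pi * ε) • ζ)) ^ 2) := fun ζ => by
        rw [ENNReal.ofReal_add (decay_nonneg _ _) (decay_nonneg _ _)]
        exact add_sq_le_four_mul _ _
      refine (lintegral_mono h1).trans ?_
      rw [lintegral_const_mul' _ _ (by norm_num), lintegral_add_left]
      · gcongr
        exact hK' (q z)
      · exact (hdm.measurable.ennreal_ofReal).pow_const 2)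
  refine lt_of_le_of_lt ?_ (key.trans_lt ?_)
  · refine lintegral_mono_ae ?_
    filter_upwards [coeFn_fourierL2_twistConv c U f] with z hz
    gcongr
    rw [hz]
    refine (enorm_integral_le_lintegral_enorm _).trans (le_of_eq ?_)
    simp only [enorm_mul]
    have hm2 : Measurable fun y : Phase d => z - (y.1, c • y.1) :=
      Continuous.measurable (by fun_prop)
    refine (lintegral_phase_eq (hUm.mul (hFm.comp hm2))).trans (lintegral_congr fun ζ => ?_)
    have hUm1 : Measurable fun v => ‖U (ζ, v)‖ₑ := hUm.comp measurable_prodMk_left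
    change ∫⁻ v, ‖U (ζ, v)‖ₑ * ‖fourierL2 d f (z - (ζ, c • ζ))‖ₑ = _
    exact lintegral_mul_const _ hUm1
  · refine ENNReal.mul_lt_top (ENNReal.mul_lt_top (by norm_num)
      (ENNReal.add_lt_top.2 ⟨lintegral_decay_sq_lt_top hr, hK⟩)) (ENNReal.mul_lt_top ?_ hf)
    have h2 : ∀ ζ : Pos d, (ENNReal.ofReal (C * (1 + ‖ζ‖) ^ (m + r)) * A ζ) ^ 2 =
        ENNReal.ofReal C ^ 2 * (ENNReal.ofReal ((1 + ‖ζ‖) ^ (m + r)) * A ζ) ^ 2 := fun ζ => by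
      rw [ENNReal.ofReal_mul (by positivity)]; ring
    simp only [h2]
    rw [lintegral_const_mul' _ _ (ENNReal.pow_lt_top ENNReal.ofReal_lt_top).ne]
    exact ENNReal.mul_lt_top (ENNReal.pow_lt_top ENNReal.ofReal_lt_top) hU

/-- Since w_+ + w_- = 4πεζ, at least one of w_± is as large as ζ up to a constant. It absorbs the r
extra powers of 1 + |ζ|, and the inverse power of the other is square integrable in v because r >
d/2. -/
theorem exists_lintegral_inv_weight_le {ε : ℝ} (hε : 0 < ε) {m r : ℕ} (hr : (d : ℝ) / 2 < r) :
    ∃ K < (⊤ : ℝ≥0∞), ∀ ζ : Pos d, ∫⁻ v, ENNReal.ofReal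
      ((1 + ‖ζ‖) ^ (m + r) * (weight ε m r r (ζ, v))⁻¹) ^ 2 ≤ K := by
  -- The constants -2 and 2 occur because, at fixed ζ, w_± depends on v through ±2v.
  obtain ⟨K, hK, h1⟩ := exists_lintegral_decay_sq_le (d := d) hr (c := -2) (by norm_num)
  obtain ⟨K', hK', h2⟩ := exists_lintegral_decay_sq_le (d := d) hr (c := 2) (by norm_num)
  set c := 1 + (4 * Real.pi * ε)⁻¹ with hc
  have hpos : 0 < 4 * Real.pi * ε := by positivity
  have hc0 : 0 ≤ c := by positivity
  refine ⟨ENNReal.ofReal ((2 * c) ^ r) ^ 2 * (4 * (K + K')), ENNReal.mul_lt_top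
    (ENNReal.pow_lt_top ENNReal.ofReal_lt_top)
    (ENNReal.mul_lt_top (by norm_num) (ENNReal.add_lt_top.2 ⟨hK, hK'⟩)), fun ζ => ?_⟩
  have key : ∀ v : Pos d, ENNReal.ofReal ((1 + ‖ζ‖) ^ (m + r) * (weight ε m r r (ζ, v))⁻¹) ^ 2 ≤
      ENNReal.ofReal ((2 * c) ^ r) ^ 2 * (4 *
        (ENNReal.ofReal (decay r ((2 * Real.pi * ε) • ζ - (-2 : ℝ) • v)) ^ 2 +
        ENNReal.ofReal (decay r ((2 * Real.pi * ε) • ζ - (2 : ℝ) • v)) ^ 2)) := fun v => by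
    have e1 : (2 * Real.pi * ε) • ζ - (-2 : ℝ) • v = wP ε (ζ, v) := by
      simp only [wP]; module
    have e2 : (2 * Real.pi * ε) • ζ - (2 : ℝ) • v = wM ε (ζ, v) := rfl
    rw [e1, e2]
    refine le_trans ?_ (mul_le_mul_right (add_sq_le_four_mul _ _) _)
    rw [← ENNReal.ofReal_add (decay_nonneg _ _) (decay_nonneg _ _), ← mul_pow,
      ← ENNReal.ofReal_mul (by positivity)]
    refine pow_le_pow_left' (ENNReal.ofReal_le_ofReal ?_) 2
    have h3 : 1 + ‖ζ‖ ≤ c * ((1 + ‖wP ε (ζ, v)‖) + (1 + ‖wM ε (ζ, v)‖)) := by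
      have e3 : (4 * Real.pi * ε) • ζ = wP ε (ζ, v) + wM ε (ζ, v) := by
        simp only [wP, wM]; module
      have e4 : 4 * Real.pi * ε * ‖ζ‖ ≤ ‖wP ε (ζ, v)‖ + ‖wM ε (ζ, v)‖ := by
        rw [← Real.norm_of_nonneg hpos.le, ← norm_smul, e3]
        exact norm_add_le _ _
      have e5 : ‖ζ‖ ≤ (4 * Real.pi * ε)⁻¹ * (‖wP ε (ζ, v)‖ + ‖wM ε (ζ, v)‖) := by
        rw [← div_eq_inv_mul, le_div_iff₀ hpos]; linarith
      have e6 := inv_pos.2 hpos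
      have e7 := norm_nonneg (wP ε (ζ, v))
      have e8 := norm_nonneg (wM ε (ζ, v))
      rw [hc]
      nlinarith
    have h4 := pow_le_add_pow (by positivity) (by positivity) (by positivity) hc0 h3 r
    have e9 : (1 + ‖ζ‖) ^ (m + r) * (weight ε m r r (ζ, v))⁻¹ = (1 + ‖ζ‖) ^ r *
        ((1 + ‖wP ε (ζ, v)‖) ^ r * (1 + ‖wM ε (ζ, v)‖) ^ r)⁻¹ := by
      rw [weight]
      have : (0 : ℝ) < 1 + ‖ζ‖ := by positivity
      field_simp
      ring
    rw [e9, ← div_eq_mul_inv, div_le_iff₀ (by positivity), decay, decay]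
    linarith
  refine (lintegral_mono key).trans ?_
  rw [lintegral_const_mul' _ _ (ENNReal.pow_lt_top ENNReal.ofReal_lt_top).ne,
    lintegral_const_mul' _ _ (by norm_num), lintegral_add_left]
  · gcongr
    · exact h1 _
    · exact h2 _
  · have hdm : Continuous (decay r : Pos d → ℝ) := continuous_decay r
    exact (Continuous.measurable (by fun_prop)).ennreal_ofReal.pow_const 2

theorem memLp_inv_weight {ε : ℝ} (hε : 0 < ε) {m r : ℕ} (hr : (d : ℝ) / 2 < r) :
    MemLp (fun z : Phase d => (((weight ε m r r z)⁻¹ : ℝ) : ℂ)) 2 volume := by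
  obtain ⟨K, hK, h⟩ := exists_lintegral_inv_weight_le (d := d) hε (m := m) hr
  have hw0 : ∀ z : Phase d, 0 < weight ε m r r z := fun z =>
    zero_lt_one.trans_le (one_le_weight ε m r r z)
  have hcont : Continuous fun z : Phase d => (weight ε m r r z)⁻¹ :=
    (continuous_weight ε m r r).inv₀ fun z => (hw0 z).ne'
  refine (memLp_two_iff (Complex.continuous_ofReal.comp hcont).aestronglyMeasurable).2 ?_
  have e : ∀ z : Phase d, ‖(((weight ε m r r z)⁻¹ : ℝ) : ℂ)‖ₑ ^ 2 =
      ENNReal.ofReal (weight ε m r r z)⁻¹ ^ 2 := fun z => by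
    rw [← ofReal_norm, Complex.norm_real, Real.norm_of_nonneg (inv_nonneg.2 (hw0 z).le)]
  refine lt_of_eq_of_lt (lintegral_congr e) ?_
  rw [lintegral_phase_eq (hcont.measurable.ennreal_ofReal.pow_const 2)]
  have h1 : ∀ ζ : Pos d, ∫⁻ v, ENNReal.ofReal (weight ε m r r (ζ, v))⁻¹ ^ 2 ≤
      ENNReal.ofReal (decay (m + r) ζ) ^ 2 * K := fun ζ => by
    refine le_trans (le_of_eq ?_) (mul_le_mul_right (h ζ) _)
    rw [← lintegral_const_mul' _ _ (ENNReal.pow_lt_top ENNReal.ofReal_lt_top).ne]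
    refine lintegral_congr fun v => ?_
    rw [← mul_pow, ← ENNReal.ofReal_mul (decay_nonneg _ _), decay,
      inv_mul_cancel_left₀ (by positivity)]
  refine (lintegral_mono h1).trans_lt ?_
  rw [lintegral_mul_const' _ _ hK.ne]
  refine ENNReal.mul_lt_top (lintegral_decay_sq_lt_top ?_) hK
  push_cast
  have : (0 : ℝ) ≤ m := Nat.cast_nonneg m
  linarith

/-! ### Continuity of the interaction on 𝓗^m_r -/

theorem le_comap_of_mul {A B : Submodule ℂ (DistOp d)} {u : Dist d}
    (h : ∀ P ∈ A, ∀ Q ∈ B, P (Q u) ∈ l2Range d) : A * B ≤ (l2Range d).comap (evalAt u) :=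
  Submodule.mul_le.2 fun P hP Q hQ => h P hP Q hQ

/-- Horizontal letters are gathered on the left, where they act as weights, and vertical letters on
the right, where they commute with twisted convolutions. `le_opSpan` is the converse inclusion, with
the same exponents. -/
theorem opSpan_le_of_forall {C : Submodule ℂ (DistOp d)}
    (hC : ∀ i ≤ r, ∀ j ≤ r, ∀ n ≤ m,
      (letterSpan (dX : Fin d → DistOp d) ^ n * letterSpan (vPlus ε) ^ i *
        letterSpan (vMinus ε) ^ j) *
      (letterSpan (xMinus ε : Fin d → DistOp d) ^ (r - i) * letterSpan (xPlus ε) ^ (r - j) *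
        letterSpan dV ^ (m - n)) ≤ C) : opSpan d ε m r ≤ C :=
  prod_add_pow_le ((isLetterFamily_vPlus ε).commute (isLetterFamily_xMinus ε))
    ((isLetterFamily_vMinus ε).commute (isLetterFamily_xPlus ε))
    (isLetterFamily_dX.commute isLetterFamily_dV)
    ((isLetterFamily_xMinus ε).commute (isLetterFamily_vMinus ε))
    ((isLetterFamily_xMinus ε).commute isLetterFamily_dX)
    ((isLetterFamily_xPlus ε).commute isLetterFamily_dX)
    ((isLetterFamily_vPlus ε).commute isLetterFamily_dX)
    ((isLetterFamily_vMinus ε).commute isLetterFamily_dX) r m hC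

theorem le_opSpan {i j n : ℕ} (hi : i ≤ r) (hj : j ≤ r) (hn : n ≤ m) :
    (letterSpan (dX : Fin d → DistOp d) ^ n * letterSpan (vPlus ε) ^ i *
        letterSpan (vMinus ε) ^ j) *
      (letterSpan (xMinus ε : Fin d → DistOp d) ^ (r - i) * letterSpan (xPlus ε) ^ (r - j) *
        letterSpan dV ^ (m - n)) ≤ opSpan d ε m r :=
  mul_mem_prod_add_pow
    ((isLetterFamily_xMinus ε).commute (isLetterFamily_vMinus ε))
    ((isLetterFamily_xMinus ε).commute isLetterFamily_dX)
    ((isLetterFamily_xPlus ε).commute isLetterFamily_dX)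
    ((isLetterFamily_vPlus ε).commute isLetterFamily_dX)
    ((isLetterFamily_vMinus ε).commute isLetterFamily_dX) hi hj hn

theorem one_mem_letterSpan_mul {ι κ τ : Type*} {A : Type*} [Ring A] [Algebra ℂ A] (a : ι → A)
    (b : κ → A) (c : τ → A) (i j k : ℕ) :
    (1 : A) ∈ letterSpan a ^ i * letterSpan b ^ j * letterSpan c ^ k := by
  have h1 : (1 : Submodule ℂ A) * 1 * 1 ≤ letterSpan a ^ i * letterSpan b ^ j * letterSpan c ^ k :=
    mul_le_mul' (mul_le_mul' (one_le_pow_of_one_le' (one_le_letterSpan a) i)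
      (one_le_pow_of_one_le' (one_le_letterSpan b) j))
      (one_le_pow_of_one_le' (one_le_letterSpan c) k)
  rw [one_mul, one_mul] at h1
  exact Submodule.one_le.1 h1

/-- Twisted convolutions preserve `𝓗^m_r`. -/
theorem memH_twistConv (hε : 0 < ε) {c : ℝ}
    (hc : c = Real.pi * ε ∨ c = -(Real.pi * ε)) (hr : (d : ℝ) / 2 < r) (U : L1Phase d)
    (hU : ∫⁻ ζ : Pos d, (ENNReal.ofReal ((1 + ‖ζ‖) ^ (m + r)) * ∫⁻ w, ‖U (ζ, w)‖ₑ) ^ 2 < ⊤)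
    {f : L2Phase d} (hf : MemH ε m r f) : MemH ε m r (twistConv d c U f) := by
  rw [memH_iff] at hf ⊢
  suffices h : opSpan d ε m r ≤ (l2Range d).comap (evalAt (toDist d (twistConv d c U f))) from
    fun D hD => h hD
  refine opSpan_le_of_forall fun i hi j hj n hn => le_comap_of_mul fun P hP Q hQ => ?_
  have hPQ : ∀ P' ∈ letterSpan (dX : Fin d → DistOp d) ^ n * letterSpan (vPlus ε) ^ i *
      letterSpan (vMinus ε) ^ j, P' (Q (toDist d f)) ∈ l2Range d := fun P' hP' =>
    hf _ (le_opSpan hi hj hn (Submodule.mul_mem_mul hP' hQ))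
  -- Taking the identity among the horizontal operators shows that the vertical part Q sends f to a
  -- square integrable g. As Q passes through the twisted convolution, what remains is the weighted
  -- estimate for g.
  obtain ⟨g, hg⟩ := hPQ 1 (one_mem_letterSpan_mul _ _ _ _ _ _)
  have hg' : Q (toDist d f) = toDist d g := hg.symm
  rw [twistConv_of_mem_modCommutant (le_modCommutant ε _ _ _ hQ) c U hg']
  rw [hg'] at hPQ
  have hw := isWeight_weight (d := d) ε n i j
  exact (hw.memLp_iff _).2
    (memLp_weight_twistConv hε hc hr hn hi hj U hU ((hw.memLp_iff g).1 hPQ)) P hP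

theorem memLp_weight_of_memH {f : L2Phase d} (hf : MemH ε m r f) :
    MemLp (fun z => (weight ε m r r z : ℂ) * fourierL2 d f z) 2 volume := by
  refine ((isWeight_weight (d := d) ε m r r).memLp_iff f).1 fun D hD => memH_iff.1 hf D ?_
  have h := le_opSpan (d := d) (ε := ε) (m := m) (r := r) le_rfl le_rfl le_rfl
  rw [← mul_one D]
  exact h (Submodule.mul_mem_mul hD (one_mem_letterSpan_mul _ _ _ _ _ _))

/-- Multiplication by a bounded continuous function. -/
def mulL2 (g : Phase d → ℂ) (hg : MemLp g ∞ volume) : L2Phase d →L[ℂ] L2Phase d :=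
  (ContinuousLinearMap.mul ℂ ℂ).holderL volume ∞ 2 2 (hg.toLp g)

theorem coeFn_mulL2 {g : Phase d → ℂ} (hg : MemLp g ∞ volume) (f : L2Phase d) :
    ∀ᵐ z, mulL2 g hg f z = g z * f z := by
  filter_upwards [(ContinuousLinearMap.mul ℂ ℂ).coeFn_holder (r := 2) (hg.toLp g) f,
    hg.coeFn_toLp] with z h1 h2
  rw [h2] at h1
  exact h1

/-- Ff is the product of the inverse weight, square integrable since r > d/2, and of the weighted
transform, square integrable by membership in 𝓗^m_r; so U is integrable by Hölder's inequality. -/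
theorem exists_interactionSymbol (hε : 0 < ε) (hr : (d : ℝ) / 2 < r) {k : Pos d → ℂ}
    (hk : Continuous k) {C : ℝ} (hC : ∀ ζ, ‖k ζ‖ ≤ C) :
    ∃ U : HSpace d ε m r →L[ℂ] L1Phase d, ∀ p, ∀ᵐ y, U p y =
      k y.1 * fourierL2 d (toL2 d ε m r p) y := by
  have hw0 : ∀ z : Phase d, 0 < weight ε m r r z := fun z =>
    zero_lt_one.trans_le (one_le_weight ε m r r z)
  have hi2 := memLp_inv_weight (d := d) hε (m := m) hr
  have hi : MemLp (fun z : Phase d => (((weight ε m r r z)⁻¹ : ℝ) : ℂ)) ∞ volume :=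
    memLp_top_of_bound hi2.1 1 (.of_forall fun z => by
      rw [Complex.norm_real, Real.norm_of_nonneg (inv_nonneg.2 (hw0 z).le)]
      exact inv_le_one_of_one_le₀ (one_le_weight ε m r r z))
  have hJ : Function.Injective (mulL2 _ hi) := by
    intro f g hfg
    refine Lp.ext ?_
    filter_upwards [coeFn_mulL2 hi f, coeFn_mulL2 hi g] with z h1 h2
    rw [hfg, h2] at h1
    have : (((weight ε m r r z)⁻¹ : ℝ) : ℂ) ≠ 0 := by
      exact_mod_cast (inv_pos.2 (hw0 z)).ne'
    exact (mul_left_cancel₀ this h1).symm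
  -- Ψ is p ↦ weight · Fp; its continuity into L² comes from the closed graph theorem, the injection
  -- being multiplication by the inverse weight.
  obtain ⟨Ψ, hΨ⟩ := exists_lift hJ (fourierL2 d ∘L toL2 d ε m r) fun p => by
    refine ⟨(memLp_weight_of_memH (memH_toL2 p)).toLp _, Lp.ext ?_⟩
    filter_upwards [coeFn_mulL2 hi ((memLp_weight_of_memH (memH_toL2 p)).toLp _),
      (memLp_weight_of_memH (memH_toL2 p)).coeFn_toLp] with z h1 h2
    rw [h1, h2, ContinuousLinearMap.comp_apply, ← mul_assoc, ← Complex.ofReal_mul,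
      inv_mul_cancel₀ (hw0 z).ne', Complex.ofReal_one, one_mul]
  have hk2 : MemLp (fun z : Phase d => k z.1 * (((weight ε m r r z)⁻¹ : ℝ) : ℂ)) 2 volume :=
    hi2.of_le_mul ((hk.comp continuous_fst).aestronglyMeasurable.mul hi2.1)
      (.of_forall fun z => by rw [norm_mul]; exact mul_le_mul_of_nonneg_right (hC _) (norm_nonneg _))
  refine ⟨(ContinuousLinearMap.mul ℂ ℂ).holderL volume 2 2 1 (hk2.toLp _) ∘L Ψ, fun p => ?_⟩
  filter_upwards [(ContinuousLinearMap.mul ℂ ℂ).coeFn_holder (r := 1) (hk2.toLp _) (Ψ p),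
    hk2.coeFn_toLp, coeFn_mulL2 hi (Ψ p)] with z h1 h2 h3
  rw [hΨ p] at h3
  rw [ContinuousLinearMap.comp_apply] at h3
  rw [h3, ← mul_assoc]
  rw [h2] at h1
  exact h1

theorem ae_ae_phase {p : Phase d → Prop} (h : ∀ᵐ z, p z) : ∀ᵐ x : Pos d, ∀ᵐ v, p (x, v) :=
  Measure.ae_ae_of_ae_prod h

/-- Cauchy–Schwarz in w against the inverse weight, uniformly in ζ. This is exactly the bound on U
that `memLp_weight_twistConv` demands, so the two factors of the bilinear term are estimated in the
same space. -/
theorem lintegral_interactionSymbol_lt_top (hε : 0 < ε) (hr : (d : ℝ) / 2 < r) {k : Pos d → ℂ}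
    {C : ℝ} (hC : ∀ ζ, ‖k ζ‖ ≤ C) {f : L2Phase d} (hf : MemH ε m r f) {U : L1Phase d}
    (hU : ∀ᵐ y, U y = k y.1 * fourierL2 d f y) :
    ∫⁻ ζ : Pos d, (ENNReal.ofReal ((1 + ‖ζ‖) ^ (m + r)) * ∫⁻ w, ‖U (ζ, w)‖ₑ) ^ 2 < ⊤ := by
  obtain ⟨K, hK, h⟩ := exists_lintegral_inv_weight_le (d := d) hε (m := m) hr
  have hw0 : ∀ z : Phase d, 0 < weight ε m r r z := fun z =>
    zero_lt_one.trans_le (one_le_weight ε m r r z)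
  have h1 := memLp_weight_of_memH hf
  rw [memLp_two_iff h1.1] at h1
  simp only [enorm_weight_mul] at h1
  have hFm : Measurable fun y : Phase d => ‖fourierL2 d f y‖ₑ :=
    (Lp.stronglyMeasurable (fourierL2 d f)).measurable.enorm
  have hwm : Measurable fun y : Phase d => ENNReal.ofReal (weight ε m r r y) :=
    (continuous_weight ε m r r).measurable.ennreal_ofReal
  have hiw : Continuous fun z : Phase d => (weight ε m r r z)⁻¹ :=
    (continuous_weight ε m r r).inv₀ fun z => (hw0 z).ne'
  have h2 : ∀ᵐ ζ : Pos d, (ENNReal.ofReal ((1 + ‖ζ‖) ^ (m + r)) * ∫⁻ w, ‖U (ζ, w)‖ₑ) ^ 2 ≤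
      ENNReal.ofReal C ^ 2 * (K *
        ∫⁻ w, (ENNReal.ofReal (weight ε m r r (ζ, w)) * ‖fourierL2 d f (ζ, w)‖ₑ) ^ 2) := by
    filter_upwards [ae_ae_phase hU] with ζ hζ
    have e1 : ENNReal.ofReal ((1 + ‖ζ‖) ^ (m + r)) * ∫⁻ w, ‖U (ζ, w)‖ₑ ≤ ENNReal.ofReal C *
        ∫⁻ w, ENNReal.ofReal ((1 + ‖ζ‖) ^ (m + r) * (weight ε m r r (ζ, w))⁻¹) *
          (ENNReal.ofReal (weight ε m r r (ζ, w)) * ‖fourierL2 d f (ζ, w)‖ₑ) := by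
      rw [← lintegral_const_mul' _ _ ENNReal.ofReal_ne_top,
        ← lintegral_const_mul' _ _ ENNReal.ofReal_ne_top]
      refine lintegral_mono_ae ?_
      filter_upwards [hζ] with w hw
      rw [hw, enorm_mul, ← mul_assoc (ENNReal.ofReal (_ * _)), ← ENNReal.ofReal_mul, mul_assoc,
        inv_mul_cancel₀ (hw0 _).ne', mul_one]
      · have : ‖k ζ‖ₑ ≤ ENNReal.ofReal C := by
          rw [← ofReal_norm]; exact ENNReal.ofReal_le_ofReal (hC ζ)
        calc _ ≤ ENNReal.ofReal ((1 + ‖ζ‖) ^ (m + r)) *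
              (ENNReal.ofReal C * ‖fourierL2 d f (ζ, w)‖ₑ) := by gcongr
          _ = _ := by ring
      · have := (inv_pos.2 (hw0 (ζ, w))).le
        positivity
    refine (pow_le_pow_left' e1 2).trans ?_
    rw [mul_pow]
    gcongr
    refine (lintegral_mul_sq_le _ ?_ ?_).trans ?_
    · have : Continuous fun w => (1 + ‖ζ‖) ^ (m + r) * (weight ε m r r (ζ, w))⁻¹ :=
        continuous_const.mul (hiw.comp (by fun_prop : Continuous fun w : Pos d => (ζ, w)))
      exact this.measurable.ennreal_ofReal.aemeasurable
    · exact ((hwm.mul hFm).comp measurable_prodMk_left).aemeasurable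
    · gcongr
      exact h ζ
  refine (lintegral_mono_ae h2).trans_lt ?_
  rw [lintegral_const_mul' _ _ (ENNReal.pow_lt_top ENNReal.ofReal_lt_top).ne,
    lintegral_const_mul' _ _ hK.ne]
  refine ENNReal.mul_lt_top (ENNReal.pow_lt_top ENNReal.ofReal_lt_top)
    (ENNReal.mul_lt_top hK ?_)
  have h3 := lintegral_phase_eq ((hwm.mul hFm).pow_const 2)
  exact lt_of_eq_of_lt h3.symm h1

/-- The bilinear interaction operator on `𝓗^m_r`. -/
theorem exists_interaction (hε : 0 < ε) (hr : (d : ℝ) / 2 < r) {k : Pos d → ℂ}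
    (hk : Continuous k) {C : ℝ} (hC : ∀ ζ, ‖k ζ‖ ≤ C) :
    ∃ b : HSpace d ε m r →L[ℂ] HSpace d ε m r →L[ℂ] HSpace d ε m r, ∀ p q, ∃ U : L1Phase d,
      (∀ᵐ y, U y = k y.1 * fourierL2 d (toL2 d ε m r p) y) ∧
      toL2 d ε m r (b p q) = (Complex.I / ε) • (twistConv d (Real.pi * ε) U (toL2 d ε m r q) -
        twistConv d (-(Real.pi * ε)) U (toL2 d ε m r q)) := by
  obtain ⟨U, hU⟩ := exists_interactionSymbol (m := m) hε hr hk hC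
  have hmem : ∀ c, (c = Real.pi * ε ∨ c = -(Real.pi * ε)) → ∀ p q : HSpace d ε m r,
      ∃ z, toL2 d ε m r z = twistConv d c (U p) (toL2 d ε m r q) := fun c hc p q =>
    exists_toL2_eq (memH_twistConv hε hc hr _
      (lintegral_interactionSymbol_lt_top hε hr hC (memH_toL2 p) (hU p)) (memH_toL2 q))
  let Φ : L1Phase d →L[ℂ] L2Phase d →L[ℂ] L2Phase d :=
    (Complex.I / ε) • (twistConv d (Real.pi * ε) - twistConv d (-(Real.pi * ε)))
  obtain ⟨b, hb⟩ := exists_lift₂ (toL2_injective (d := d) (ε := ε) (m := m) (r := r))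
    (Φ.bilinearComp U (toL2 d ε m r)) (fun p q => by
      obtain ⟨z1, h1⟩ := hmem _ (Or.inl rfl) p q
      obtain ⟨z2, h2⟩ := hmem _ (Or.inr rfl) p q
      refine ⟨(Complex.I / ε) • (z1 - z2), ?_⟩
      rw [map_smul, map_sub, h1, h2]
      rfl)
  exact ⟨b, fun p q => ⟨U p, hU p, hb p q⟩⟩

/-! ### Velocity moments and the density -/

theorem memLp_top_snd {g : Pos d → ℂ} (hg : Continuous g) {C : ℝ} (hC : ∀ v, ‖g v‖ ≤ C) :
    MemLp (fun z : Phase d => g z.2) ∞ volume :=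
  memLp_top_of_bound (hg.comp continuous_snd).aestronglyMeasurable C (.of_forall fun z => hC z.2)

/-- Functions of the velocity commute with the partial Fourier transform. -/
theorem fourierL2_mulL2_snd {g : Pos d → ℂ} (hg : Continuous g) {C : ℝ} (hC : ∀ v, ‖g v‖ ≤ C)
    (f : L2Phase d) : fourierL2 d (mulL2 _ (memLp_top_snd hg hC) f) =
      mulL2 _ (memLp_top_snd hg hC) (fourierL2 d f) := by
  refine denseRange_schwartzL2.induction_on (p := fun f =>
    fourierL2 d (mulL2 _ (memLp_top_snd hg hC) f) =
      mulL2 _ (memLp_top_snd hg hC) (fourierL2 d f)) f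
    (isClosed_eq (by fun_prop) (by fun_prop)) fun φ => Lp.ext ?_
  have h1 : ∀ᵐ z, mulL2 _ (memLp_top_snd hg hC) (schwartzL2 d φ) z = g z.2 * φ z := by
    filter_upwards [coeFn_mulL2 (memLp_top_snd hg hC) (schwartzL2 d φ), coeFn_schwartzL2 φ]
      with z h1 h2
    rw [h1, h2]
  have hi : Integrable fun z : Phase d => g z.2 * φ z :=
    φ.integrable.bdd_mul (hg.comp continuous_snd).aestronglyMeasurable
      (.of_forall fun z => hC z.2)
  have h2 : mulL2 _ (memLp_top_snd hg hC) (schwartzL2 d φ) =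
      (MemLp.ae_eq h1 (Lp.memLp _)).toLp _ := Lp.ext (by
    filter_upwards [h1, (MemLp.ae_eq h1 (Lp.memLp _)).coeFn_toLp] with z h3 h4
    rw [h3, h4])
  have h3 : ∀ᵐ z, fourierL2 d (mulL2 _ (memLp_top_snd hg hC) (schwartzL2 d φ)) z =
      fourierX (fun z => g z.2 * φ z) z := by
    have h4 := coeFn_fourierL2 (mulL2 _ (memLp_top_snd hg hC) (schwartzL2 d φ)) fun R =>
      (hi.congr (h1.mono fun z hz => hz.symm)).integrableOn
    have h5 : ∀ᵐ v : Pos d, ∀ᵐ x : Pos d,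
        mulL2 _ (memLp_top_snd hg hC) (schwartzL2 d φ) (x, v) = g v * φ (x, v) :=
      Measure.ae_ae_of_ae_prod
        (Measure.measurePreserving_swap.quasiMeasurePreserving.ae h1)
    have h6 : ∀ᵐ z : Phase d, ∀ᵐ x : Pos d,
        mulL2 _ (memLp_top_snd hg hC) (schwartzL2 d φ) (x, z.2) = g z.2 * φ (x, z.2) :=
      Measure.quasiMeasurePreserving_snd.ae h5
    filter_upwards [h4, h6] with z h7 h8
    rw [h7, fourierX, fourierX, Real.fourier_eq', Real.fourier_eq']
    refine integral_congr_ae ?_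
    filter_upwards [h8] with x hx
    rw [hx]
  filter_upwards [h3, coeFn_mulL2 (memLp_top_snd hg hC) (fourierL2 d (schwartzL2 d φ)),
    coeFn_fourierL2_schwartz φ] with z h4 h5 h6
  rw [h4, h5, h6, fourierX, fourierX, Real.fourier_eq', Real.fourier_eq', ← integral_const_mul]
  refine integral_congr_ae (.of_forall fun x => ?_)
  simp only [smul_eq_mul]
  ring

/-- `(1 + |v|)^{-r}` as a complex-valued function. -/
def decayC (r : ℕ) (v : Pos d) : ℂ := (decay r v : ℂ)

theorem continuous_decayC (r : ℕ) : Continuous (decayC r : Pos d → ℂ) :=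
  Complex.continuous_ofReal.comp (continuous_decay r)

theorem norm_decayC (r : ℕ) (v : Pos d) : ‖decayC r v‖ = decay r v := by
  rw [decayC, Complex.norm_real, Real.norm_of_nonneg (decay_nonneg r v)]

theorem enorm_decayC (r : ℕ) (v : Pos d) : ‖decayC r v‖ₑ = ENNReal.ofReal (decay r v) := by
  rw [← ofReal_norm, norm_decayC]

theorem decay_le_one (r : ℕ) (v : Pos d) : decay r v ≤ 1 :=
  inv_le_one_of_one_le₀ (one_le_pow₀ (by simp))

theorem norm_decayC_le (r : ℕ) (v : Pos d) : ‖decayC r v‖ ≤ 1 :=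
  norm_decayC r v ▸ decay_le_one r v

theorem memLp_decayC (hr : (d : ℝ) / 2 < r) : MemLp (decayC r : Pos d → ℂ) 2 volume := by
  rw [memLp_two_iff (continuous_decayC r).aestronglyMeasurable]
  simpa only [enorm_decayC] using lintegral_decay_sq_lt_top hr

/-- Elements of `𝓗^m_r` have `r` moments in `v`. -/
theorem exists_eq_decay_mul {f : L2Phase d} (hf : MemH ε m r f) :
    ∃ h : L2Phase d, (∀ᵐ z, f z = decayC r z.2 * h z) ∧
      ∀ᵐ z, fourierL2 d f z = decayC r z.2 * fourierL2 d h z := by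
  have h1 := memLp_weight_of_memH hf
  have hc : Continuous fun z : Phase d => (((1 + ‖z.2‖) ^ r : ℝ) : ℂ) := by fun_prop
  have h2 : MemLp (fun z : Phase d => (((1 + ‖z.2‖) ^ r : ℝ) : ℂ) * fourierL2 d f z) 2 volume := by
    refine memLp_mul_of_le (C := 1) h1 (hc.aestronglyMeasurable.mul (Lp.aestronglyMeasurable _))
      (.of_forall fun z => ?_)
    rw [norm_mul, one_mul, Complex.norm_real]
    refine mul_le_mul_of_nonneg_right ?_ (norm_nonneg _)
    rw [Real.norm_of_nonneg (by positivity),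
      Real.norm_of_nonneg (zero_le_one.trans (one_le_weight ε m r r z)), weight, mul_assoc,
      ← mul_pow]
    -- Here w_+ - w_- = 4v, so a large velocity forces one of w_± to be large.
    have h3 : 1 + ‖z.2‖ ≤ (1 + ‖wP ε z‖) * (1 + ‖wM ε z‖) := by
      have e : (4 : ℝ) • z.2 = wP ε z - wM ε z := by simp only [wP, wM]; module
      have e2 : 4 * ‖z.2‖ ≤ ‖wP ε z‖ + ‖wM ε z‖ := by
        have := norm_sub_le (wP ε z) (wM ε z)
        rw [← e, norm_smul] at this
        simpa using this
      nlinarith [norm_nonneg (wP ε z), norm_nonneg (wM ε z), norm_nonneg z.2,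
        mul_nonneg (norm_nonneg (wP ε z)) (norm_nonneg (wM ε z))]
    have h4 := pow_le_pow_left₀ (by positivity) h3 r
    refine h4.trans (le_mul_of_one_le_left (by positivity) (one_le_pow₀ (by simp)))
  have key : ∀ᵐ z, fourierL2 d f z = decayC r z.2 * (h2.toLp _ : L2Phase d) z := by
    filter_upwards [h2.coeFn_toLp] with z hz
    rw [hz, ← mul_assoc, decayC, decay, ← Complex.ofReal_mul, inv_mul_cancel₀ (by positivity),
      Complex.ofReal_one, one_mul]
  refine ⟨fourierInvL2 d (h2.toLp _), ?_, by rwa [fourierL2_fourierInvL2]⟩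
  have hM := memLp_top_snd (continuous_decayC (d := d) r) (norm_decayC_le r)
  have h5 : f = mulL2 _ hM (fourierInvL2 d (h2.toLp _)) := by
    refine fourierL2_injective ?_
    rw [fourierL2_mulL2_snd (continuous_decayC r) (norm_decayC_le r), fourierL2_fourierInvL2]
    refine Lp.ext ?_
    filter_upwards [key, coeFn_mulL2 hM (h2.toLp _)] with z h6 h7
    rw [h6, h7]
  have h8 := coeFn_mulL2 hM (fourierInvL2 d (h2.toLp _))
  rwa [← h5] at h8

theorem ae_memLp_slice_snd (h : L2Phase d) : ∀ᵐ x : Pos d, MemLp (fun v => h (x, v)) 2 volume := by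
  have h1 := (memLp_two_iff (Lp.aestronglyMeasurable h)).1 (Lp.memLp h)
  have hm : Measurable fun z : Phase d => ‖h z‖ₑ ^ 2 :=
    (Lp.stronglyMeasurable h).measurable.enorm.pow_const 2
  rw [lintegral_phase_eq hm] at h1
  filter_upwards [ae_lt_top hm.lintegral_prod_right' h1.ne] with x hx
  rw [memLp_two_iff]
  · exact hx
  · exact ((Lp.stronglyMeasurable h).comp_measurable measurable_prodMk_left).aestronglyMeasurable

theorem ae_integrable_slice_snd {f h : L2Phase d} (hr : (d : ℝ) / 2 < r)
    (hf : ∀ᵐ z, f z = decayC r z.2 * h z) : ∀ᵐ x : Pos d, Integrable fun v => f (x, v) := by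
  filter_upwards [ae_memLp_slice_snd h, ae_ae_phase hf] with x h1 h2
  exact (integrable_mul_of_memLp (memLp_decayC hr) h1).congr (h2.mono fun v hv => hv.symm)

theorem aestronglyMeasurable_density (f : L2Phase d) : AEStronglyMeasurable (density f) := by
  unfold density
  exact (Lp.stronglyMeasurable f).integral_prod_right'.aestronglyMeasurable

theorem lintegral_norm_sq_le {f h : L2Phase d}
    (hf : ∀ᵐ z, f z = decayC r z.2 * h z) : ∀ᵐ x : Pos d, (∫⁻ v, ‖f (x, v)‖ₑ) ^ 2 ≤
    (∫⁻ v : Pos d, ENNReal.ofReal (decay r v) ^ 2) * ∫⁻ v, ‖h (x, v)‖ₑ ^ 2 := by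
  filter_upwards [ae_ae_phase hf] with x hx
  have h1 : ∫⁻ v, ‖f (x, v)‖ₑ = ∫⁻ v, ENNReal.ofReal (decay r v) * ‖h (x, v)‖ₑ := by
    refine lintegral_congr_ae ?_
    filter_upwards [hx] with v hv
    rw [hv, enorm_mul, enorm_decayC]
  rw [h1]
  refine lintegral_mul_sq_le _ (continuous_decay r).measurable.ennreal_ofReal.aemeasurable ?_
  exact ((Lp.stronglyMeasurable h).measurable.comp measurable_prodMk_left).enorm.aemeasurable

theorem memLp_density {f h : L2Phase d} (hr : (d : ℝ) / 2 < r)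
    (hf : ∀ᵐ z, f z = decayC r z.2 * h z) : MemLp (density f) 2 volume := by
  refine (memLp_two_iff (aestronglyMeasurable_density f)).2 ?_
  have h1 : ∀ᵐ x, ‖density f x‖ₑ ^ 2 ≤
      (∫⁻ v : Pos d, ENNReal.ofReal (decay r v) ^ 2) * ∫⁻ v, ‖h (x, v)‖ₑ ^ 2 := by
    filter_upwards [lintegral_norm_sq_le hf] with x hx
    exact (pow_le_pow_left' (enorm_integral_le_lintegral_enorm _) 2).trans hx
  refine (lintegral_mono_ae h1).trans_lt ?_
  rw [lintegral_const_mul' _ _ (lintegral_decay_sq_lt_top hr).ne]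
  refine ENNReal.mul_lt_top (lintegral_decay_sq_lt_top hr) ?_
  have hm : Measurable fun z : Phase d => ‖h z‖ₑ ^ 2 :=
    (Lp.stronglyMeasurable h).measurable.enorm.pow_const 2
  exact lt_of_eq_of_lt (lintegral_phase_eq hm).symm
    ((memLp_two_iff (Lp.aestronglyMeasurable h)).1 (Lp.memLp h))

theorem memLp_mul_decay (hr : (d : ℝ) / 2 < r) {a : Pos d → ℂ} (ha : MemLp a 2 volume) :
    MemLp (fun z : Phase d => a z.1 * decayC r z.2) 2 volume := by
  have hm : AEStronglyMeasurable fun z : Phase d => a z.1 * decayC r z.2 :=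
    (ha.1.comp_quasiMeasurePreserving Measure.quasiMeasurePreserving_fst).mul
      ((continuous_decayC r).comp continuous_snd).aestronglyMeasurable
  refine (memLp_two_iff hm).2 ?_
  simp only [enorm_mul, mul_pow]
  rw [Measure.volume_eq_prod, lintegral_prod_mul (ha.1.enorm.pow_const 2)
    ((continuous_decayC r).enorm.measurable.pow_const 2).aemeasurable]
  exact ENNReal.mul_lt_top ((memLp_two_iff ha.1).1 ha)
    ((memLp_two_iff (continuous_decayC r).aestronglyMeasurable).1 (memLp_decayC hr))

theorem integrable_mul_fst {f h : L2Phase d} (hr : (d : ℝ) / 2 < r)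
    (hf : ∀ᵐ z, f z = decayC r z.2 * h z) {a : Pos d → ℂ} (ha : MemLp a 2 volume) :
    Integrable fun z : Phase d => f z * a z.1 := by
  refine (integrable_mul_of_memLp (Lp.memLp h) (memLp_mul_decay hr ha)).congr ?_
  filter_upwards [hf] with z hz
  rw [hz]; ring

theorem integral_density_mul {f h : L2Phase d} (hr : (d : ℝ) / 2 < r)
    (hf : ∀ᵐ z, f z = decayC r z.2 * h z) {a : Pos d → ℂ} (ha : MemLp a 2 volume) :
    ∫ x, density f x * a x = ∫ z : Phase d, h z * (a z.1 * decayC r z.2) := by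
  have h1 : ∫ z : Phase d, h z * (a z.1 * decayC r z.2) = ∫ z : Phase d, f z * a z.1 := by
    refine integral_congr_ae ?_
    filter_upwards [hf] with z hz
    rw [hz]; ring
  have h2 := integrable_mul_fst hr hf ha
  have h3 : ∫ z : Phase d, f z * a z.1 = ∫ x, ∫ v, f (x, v) * a x := integral_prod _ h2
  rw [h1, h3]
  simp only [integral_mul_const, density]

/-- Integration over v commutes with the Fourier transform in x. Writing f as a decaying function of
v times an L² function h reduces both sides, tested against G, to pairings of h with G ⊗ decay, for
which `fourierL2` is its own transpose. -/
theorem fourier_density {f h : L2Phase d} (hr : (d : ℝ) / 2 < r)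
    (hf : ∀ᵐ z, f z = decayC r z.2 * h z)
    (hf' : ∀ᵐ z, fourierL2 d f z = decayC r z.2 * fourierL2 d h z) :
    ∀ᵐ ζ, (𝓕 (densityL2 f)) ζ = density (fourierL2 d f) ζ := by
  have hd := memLp_density hr hf
  have hd' := memLp_density hr hf'
  refine ae_eq_of_integral_contDiff_smul_eq ((Lp.memLp _).locallyIntegrable one_le_two)
    (hd'.locallyIntegrable one_le_two) fun g hg hgc => ?_
  have hg1 : HasCompactSupport (Complex.ofRealCLM ∘ g) := hgc.comp_left rfl
  have hg2 : ContDiff ℝ ∞ (Complex.ofRealCLM ∘ g) := by fun_prop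
  set G : 𝓢(Pos d, ℂ) := hg1.toSchwartzMap hg2
  have hG : ∀ x, G x = (g x : ℂ) := fun x => rfl
  have e1 : ∫ x, g x • (𝓕 (densityL2 f)) x = ∫ x, density f x * (𝓕 G) x := by
    have e2 := DFunLike.congr_fun (Lp.fourier_toTemperedDistribution_eq (densityL2 f)) G
    rw [TemperedDistribution.fourier_apply, Lp.toTemperedDistribution_apply,
      Lp.toTemperedDistribution_apply] at e2
    calc _ = ∫ x, G x • (𝓕 (densityL2 f)) x := integral_congr_ae (.of_forall fun x => by
          simp only [hG, Complex.real_smul, smul_eq_mul])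
      _ = _ := by
        rw [← e2]
        refine integral_congr_ae ?_
        have : densityL2 f = hd.toLp _ := by rw [densityL2, dif_pos hd]
        rw [this]
        filter_upwards [hd.coeFn_toLp] with x hx
        rw [hx, smul_eq_mul, mul_comm]
  have e3 : ∫ x, g x • density (fourierL2 d f) x = ∫ x, density (fourierL2 d f) x * G x :=
    integral_congr_ae (.of_forall fun x => by
      simp only [hG, Complex.real_smul, mul_comm])
  have hm1 := memLp_mul_decay hr (G.memLp 2 volume)
  have hm2 := memLp_mul_decay hr ((𝓕 G).memLp 2 volume)
  rw [e1, e3, integral_density_mul hr hf ((𝓕 G).memLp 2 volume),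
    integral_density_mul hr hf' (G.memLp 2 volume)]
  have e4 : ∀ (u : L2Phase d) {w : Phase d → ℂ} (hw : MemLp w 2 volume),
      ∫ z, u z * w z = pairL2 d u (hw.toLp _) := fun u w hw => by
    rw [pairL2_apply]
    refine integral_congr_ae ?_
    filter_upwards [hw.coeFn_toLp] with z hz
    rw [hz]
  rw [e4 _ hm1, e4 _ hm2, pairL2_fourierL2]
  congr 1
  refine Lp.ext ?_
  -- For r > d/2 the factor (1 + |v|)^{-r} is square integrable but need not be integrable, so the
  -- integral formula is used in its version on slabs.
  have hi : ∀ R : ℝ, IntegrableOn (hm1.toLp _ : L2Phase d) {z : Phase d | ‖z.2‖ ≤ R} := fun R => by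
    have h1 : IntegrableOn (fun z : Phase d => G z.1 * decayC r z.2) {z : Phase d | ‖z.2‖ ≤ R} := by
      have h2 : {z : Phase d | ‖z.2‖ ≤ R} = Set.univ ×ˢ Metric.closedBall 0 R := by
        ext z; simp
      rw [h2, IntegrableOn, Measure.volume_eq_prod, ← Measure.prod_restrict, Measure.restrict_univ]
      exact G.integrable.mul_prod
        ((continuous_decayC r).continuousOn.integrableOn_compact (isCompact_closedBall _ _))
    exact h1.congr_fun_ae (ae_restrict_of_ae (hm1.coeFn_toLp.mono fun z hz => hz.symm))
  have h5 : ∀ᵐ z : Phase d, ∀ᵐ x : Pos d,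
      (hm1.toLp _ : L2Phase d) (x, z.2) = G x * decayC r z.2 :=
    Measure.quasiMeasurePreserving_snd.ae (Measure.ae_ae_of_ae_prod
      (Measure.measurePreserving_swap.quasiMeasurePreserving.ae hm1.coeFn_toLp))
  filter_upwards [hm2.coeFn_toLp, coeFn_fourierL2 _ hi, h5] with z h1 h2 h3
  rw [h1, h2, fourierX, SchwartzMap.fourier_coe, Real.fourier_eq', Real.fourier_eq',
    ← integral_mul_const]
  refine integral_congr_ae ?_
  filter_upwards [h3] with x hx
  rw [hx]
  simp only [smul_eq_mul]
  ring

/-! ### Changes of variables and the pointwise form of the interaction -/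

section Intertwine

variable {A : Type*} [Ring A] [Algebra ℂ A]

/-- The operators `P` with `P X = X P'` for some `P'` in `M`. -/
def intertwine (X : A) (M : Submodule ℂ A) : Submodule ℂ A where
  carrier := {P | ∃ P' ∈ M, P * X = X * P'}
  add_mem' := by
    rintro P Q ⟨P', h1, h2⟩ ⟨Q', h3, h4⟩
    exact ⟨P' + Q', M.add_mem h1 h3, by rw [add_mul, mul_add, h2, h4]⟩
  zero_mem' := ⟨0, M.zero_mem, by simp⟩
  smul_mem' := by
    rintro c P ⟨P', h1, h2⟩
    exact ⟨c • P', M.smul_mem c h1, by rw [smul_mul_assoc, mul_smul_comm, h2]⟩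

theorem mul_le_intertwine {X : A} {M N M' N' : Submodule ℂ A} (h : M ≤ intertwine X M')
    (h' : N ≤ intertwine X N') : M * N ≤ intertwine X (M' * N') := by
  refine Submodule.mul_le.2 fun P hP Q hQ => ?_
  obtain ⟨P', h1, h2⟩ := h hP
  obtain ⟨Q', h3, h4⟩ := h' hQ
  exact ⟨P' * Q', Submodule.mul_mem_mul h1 h3, by rw [mul_assoc, h4, ← mul_assoc, h2, mul_assoc]⟩

theorem pow_le_intertwine {X : A} {M M' : Submodule ℂ A} (h : M ≤ intertwine X M') (n : ℕ) :
    M ^ n ≤ intertwine X (M' ^ n) := by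
  induction n with
  | zero =>
    rw [pow_zero, pow_zero, Submodule.one_le]
    exact ⟨1, Submodule.one_le.1 le_rfl, by rw [one_mul, mul_one]⟩
  | succ n ih =>
    rw [pow_succ, pow_succ]
    exact mul_le_intertwine ih h

theorem letterSpan_le_intertwine {X : A} {ι : Type*} {a : ι → A} {M : Submodule ℂ A}
    (h1 : 1 ∈ M) (h : ∀ i, ∃ P ∈ M, a i * X = X * P) : letterSpan a ≤ intertwine X M := by
  refine Submodule.span_le.2 ?_
  rintro _ (rfl | ⟨i, rfl⟩)
  · exact ⟨1, h1, by rw [one_mul, mul_one]⟩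
  · exact h i

theorem pow_le_mul_pow_zero {K L M K' L' M' : Submodule ℂ A} (n : ℕ) (h1 : 1 ≤ L') (h2 : 1 ≤ M')
    (l : ℕ) : K' ^ n ≤ (K ^ 0 * L ^ 0 * M ^ 0) * (L' ^ l * M' ^ l * K' ^ n) := by
  have h3 : (1 : Submodule ℂ A) * 1 * K' ^ n ≤ L' ^ l * M' ^ l * K' ^ n :=
    mul_le_mul' (mul_le_mul' (one_le_pow_of_one_le' h1 l) (one_le_pow_of_one_le' h2 l)) le_rfl
  simpa using h3

theorem mem_mul_pow_zero {K L M : Submodule ℂ A} {n : ℕ} {D : A}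
    (h : D ∈ K ^ n * L ^ 0 * M ^ 0) : D ∈ K ^ n := by
  simpa using h

end Intertwine

/-- Composition of a distribution with the inverse of a linear map (of determinant one). -/
def linD (g : Phase d ≃L[ℝ] Phase d) : DistOp d :=
  PointwiseConvergenceCLM.precomp _ (SchwartzMap.compCLMOfContinuousLinearEquiv ℂ g)

theorem linD_apply (g : Phase d ≃L[ℝ] Phase d) (u : Dist d) (φ : 𝓢(Phase d, ℂ)) :
    linD g u φ = u (SchwartzMap.compCLMOfContinuousLinearEquiv ℂ g φ) := rfl

theorem letterT_comp (g : Phase d ≃L[ℝ] Phase d) (a : ℂ) (e : Phase d) (b : ℂ)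
    (L : Phase d →L[ℝ] ℂ) (φ : 𝓢(Phase d, ℂ)) :
    SchwartzMap.compCLMOfContinuousLinearEquiv ℂ g (letterT a (g e) b L φ) =
      letterT a e b (L ∘L (g : Phase d →L[ℝ] Phase d))
        (SchwartzMap.compCLMOfContinuousLinearEquiv ℂ g φ) := by
  ext z
  have h1 : fderiv ℝ (SchwartzMap.compCLMOfContinuousLinearEquiv ℂ g φ) z e =
      fderiv ℝ φ (g z) (g e) := by
    have h2 := (φ.hasFDerivAt (g z)).comp z g.hasFDerivAt
    have h3 : (SchwartzMap.compCLMOfContinuousLinearEquiv ℂ g φ : Phase d → ℂ) = φ ∘ g := rfl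
    rw [h3, h2.fderiv]
    rfl
  have h4 : ∀ ψ : 𝓢(Phase d, ℂ),
      SchwartzMap.compCLMOfContinuousLinearEquiv ℂ g ψ z = ψ (g z) := fun _ => rfl
  rw [letterT_apply, h1, h4, h4, letterT_apply]
  rfl

theorem letter_mul_linD (g : Phase d ≃L[ℝ] Phase d) (a : ℂ) (e : Phase d) (b : ℂ)
    (L : Phase d →L[ℝ] ℂ) :
    letter a (g e) b L * linD g = linD g * letter a e b (L ∘L (g : Phase d →L[ℝ] Phase d)) := by
  ext u φ
  change letter a (g e) b L (linD g u) φ =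
    linD g (letter a e b (L ∘L (g : Phase d →L[ℝ] Phase d)) u) φ
  rw [letter_apply, linD_apply, linD_apply, letter_apply, letterT_comp]

theorem linD_toDist (g : Phase d ≃L[ℝ] Phase d) (hg : MeasurePreserving g)
    (hg' : MeasurePreserving g.symm) (f : L2Phase d) :
    linD g (toDist d f) = toDist d (compL2 g.symm hg' f) := by
  ext φ
  rw [linD_apply, toDist_apply, toDist_apply]
  have h1 := hg.integral_comp g.toHomeomorph.measurableEmbedding
    (fun z => f (g.symm z) * φ z)
  simp only [ContinuousLinearEquiv.symm_apply_apply] at h1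
  refine Eq.trans h1 (integral_congr_ae ?_)
  filter_upwards [coeFn_compL2 g.symm hg' f] with z hz
  rw [hz, Function.comp_apply]

/-- The exchange of position and velocity. -/
def swapE (d : ℕ) : Phase d ≃L[ℝ] Phase d := ContinuousLinearEquiv.prodComm ℝ (Pos d) (Pos d)

theorem measurePreserving_swapE : MeasurePreserving (swapE d) :=
  Measure.measurePreserving_swap

theorem measurePreserving_swapE_symm : MeasurePreserving (swapE d).symm :=
  Measure.measurePreserving_swap

/-- The exchange of position and velocity. -/
def swapL2 (d : ℕ) : L2Phase d →L[ℂ] L2Phase d := compL2 _ measurePreserving_swapE_symm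

theorem coeFn_swapL2 (f : L2Phase d) : ∀ᵐ z, swapL2 d f z = f z.swap :=
  coeFn_compL2 _ measurePreserving_swapE_symm f

theorem dX_mul_swap (j : Fin d) : dX j * linD (swapE d) = linD (swapE d) * dV j := by
  have h := letter_mul_linD (swapE d) 1 (0, EuclideanSpace.single j (1 : ℝ)) 0 0
  rw [dX_eq, dV_eq]
  exact h

/-- Exchanging x and v turns velocity derivatives into position derivatives, so the weight criterion
for ∂_x^m converts m derivatives in v into the decay (1 + |η|)^{-m} of the transform in v. -/
theorem memLp_fourierL2_swap {f : L2Phase d} (hf : MemH ε m r f) :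
    MemLp (fun z : Phase d => (((1 + ‖z.1‖) ^ m : ℝ) : ℂ) * fourierL2 d (swapL2 d f) z) 2
      volume := by
  have h := ((isWeight_weight (d := d) ε m 0 0).memLp_iff (swapL2 d f)).1 fun D hD => by
    have hD' : D ∈ letterSpan dX ^ m := mem_mul_pow_zero hD
    obtain ⟨P, hP, hDP⟩ := pow_le_intertwine (letterSpan_le_intertwine (M := letterSpan dV)
      (one_mem_letterSpan _) fun j => ⟨dV j, mem_letterSpan _ j, dX_mul_swap (d := d) j⟩) m hD'
    have hP' : P ∈ opSpan d ε m r := by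
      have h1 := le_opSpan (d := d) (ε := ε) (r := r) (m := m) (i := 0) (j := 0) (n := 0)
        (Nat.zero_le _) (Nat.zero_le _) (Nat.zero_le _)
      exact h1 (pow_le_mul_pow_zero (K := letterSpan (dX : Fin d → DistOp d))
        (L := letterSpan (vPlus ε)) (M := letterSpan (vMinus ε)) m
        (one_le_letterSpan (xMinus ε)) (one_le_letterSpan (xPlus ε)) r hP)
    obtain ⟨g, hg⟩ := memH_iff.1 hf P hP'
    refine ⟨swapL2 d g, ?_⟩
    have h2 : toDist d (swapL2 d f) = linD (swapE d) (toDist d f) :=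
      (linD_toDist _ measurePreserving_swapE measurePreserving_swapE_symm f).symm
    have h3 : toDist d (swapL2 d g) = linD (swapE d) (toDist d g) :=
      (linD_toDist _ measurePreserving_swapE measurePreserving_swapE_symm g).symm
    change toDist d (swapL2 d g) = _
    change toDist d g = _ at hg
    rw [h2, h3, hg]
    exact (DFunLike.congr_fun hDP (toDist d f)).symm
  simpa [weight] using h

/-- For almost every x the Fourier transform in v is (1 + |η|)^{-m} times a square integrable
function, and m > d/2 makes this product integrable. -/
theorem ae_integrable_fourier_slice {f : L2Phase d} (hm : (d : ℝ) / 2 < m)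
    (hr : (d : ℝ) / 2 < r) (hf : MemH ε m r f) :
    ∀ᵐ x : Pos d, Integrable (𝓕 fun v => f (x, v)) := by
  obtain ⟨h, hh, -⟩ := exists_eq_decay_mul hf
  have hi : ∀ R : ℝ, IntegrableOn (swapL2 d f) {z : Phase d | ‖z.2‖ ≤ R} := fun R => by
    have ha : MemLp ((Metric.closedBall (0 : Pos d) R).indicator fun _ => (1 : ℂ)) 2 volume :=
      memLp_indicator_const 2 measurableSet_closedBall 1 (Or.inr measure_closedBall_lt_top.ne)
    have h1 := (integrable_mul_fst hr hh ha).swap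
    have h2 : {z : Phase d | ‖z.2‖ ≤ R} = Prod.snd ⁻¹' Metric.closedBall 0 R := by
      ext z; simp
    have h3 : MeasurableSet {z : Phase d | ‖z.2‖ ≤ R} := by
      rw [h2]; exact measurable_snd measurableSet_closedBall
    rw [← integrable_indicator_iff h3]
    refine h1.congr ?_
    filter_upwards [coeFn_swapL2 f] with z hz
    by_cases hz2 : ‖z.2‖ ≤ R
    · rw [Set.indicator_of_mem (by exact hz2), hz]
      simp [Set.indicator, hz2]
    · rw [Set.indicator_of_notMem (by exact hz2)]
      simp [Set.indicator, hz2]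
  have h1 : ∀ᵐ x : Pos d, ∀ᵐ η : Pos d,
      fourierL2 d (swapL2 d f) (η, x) = 𝓕 (fun v => swapL2 d f (v, x)) η :=
    Measure.ae_ae_of_ae_prod (Measure.measurePreserving_swap.quasiMeasurePreserving.ae
      (coeFn_fourierL2 _ hi))
  have h2 : ∀ᵐ x : Pos d, ∀ᵐ v : Pos d, swapL2 d f (v, x) = f (x, v) :=
    Measure.ae_ae_of_ae_prod (Measure.measurePreserving_swap.quasiMeasurePreserving.ae
      (coeFn_swapL2 f))
  set k : L2Phase d := (memLp_fourierL2_swap hf).toLp _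
  have h3 : ∀ᵐ x : Pos d, ∀ᵐ η : Pos d,
      fourierL2 d (swapL2 d f) (η, x) = decayC m η * k (η, x) := by
    refine Measure.ae_ae_of_ae_prod (Measure.measurePreserving_swap.quasiMeasurePreserving.ae
      (p := fun z : Phase d => fourierL2 d (swapL2 d f) z = decayC m z.1 * k z) ?_)
    filter_upwards [(memLp_fourierL2_swap hf).coeFn_toLp] with z hz
    rw [hz, ← mul_assoc, decayC, decay, ← Complex.ofReal_mul, inv_mul_cancel₀ (by positivity),
      Complex.ofReal_one, one_mul]
  have h4 : ∀ᵐ x : Pos d, MemLp (fun η => k (η, x)) 2 volume := by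
    filter_upwards [ae_memLp_slice_snd (swapL2 d k), ae_ae_phase (coeFn_swapL2 k)] with x h5 h6
    exact h5.ae_eq h6
  filter_upwards [h1, h2, h3, h4] with x h1 h2 h3 h4
  refine (integrable_mul_of_memLp (memLp_decayC hm) h4).congr ?_
  filter_upwards [h1, h3] with η h5 h6
  rw [← h6, h5, Real.fourier_eq', Real.fourier_eq']
  refine integral_congr_ae ?_
  filter_upwards [h2] with v hv
  rw [hv]

/-- No continuity of f is available, so the inversion formula is obtained by duality: both
transforms are moved onto a test function, where inversion is known. -/
theorem fourierInv_fourier_ae {f : Pos d → ℂ} (hf : Integrable f) (hf' : Integrable (𝓕 f)) :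
    ∀ᵐ v, 𝓕⁻ (𝓕 f) v = f v := by
  have hi : ∀ v, 𝓕⁻ (𝓕 f) v = 𝓕 (𝓕 f) (-v) := fun v => Real.fourierInv_eq_fourier_neg _ v
  have hc : Continuous (𝓕⁻ (𝓕 f)) := by
    have h1 : Continuous (𝓕 (𝓕 f)) := VectorFourier.fourierIntegral_continuous
      Real.continuous_fourierChar continuous_inner hf'
    have h2 : 𝓕⁻ (𝓕 f) = fun v => 𝓕 (𝓕 f) (-v) := funext hi
    rw [h2]
    exact h1.comp continuous_neg
  refine ae_eq_of_integral_contDiff_smul_eq hc.locallyIntegrable hf.locallyIntegrable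
    fun g hg hgc => ?_
  have hg1 : HasCompactSupport (Complex.ofRealCLM ∘ g) := hgc.comp_left rfl
  have hg2 : ContDiff ℝ ∞ (Complex.ofRealCLM ∘ g) := by fun_prop
  set G : 𝓢(Pos d, ℂ) := hg1.toSchwartzMap hg2
  have hG : ∀ x, G x = (g x : ℂ) := fun x => rfl
  have hG' : Integrable fun v => G (-v) := G.integrable.comp_neg
  calc ∫ v, g v • 𝓕⁻ (𝓕 f) v = ∫ v, 𝓕 (𝓕 f) (-v) * G v :=
        integral_congr_ae (.of_forall fun v => by
          simp only [hi, hG, Complex.real_smul, mul_comm])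
    _ = ∫ v, 𝓕 (𝓕 f) v * G (-v) := by
        rw [← integral_neg_eq_self]
        simp only [neg_neg]
    _ = ∫ v, 𝓕 f v * 𝓕 (fun v => G (-v)) v := integral_fourier_mul hf' hG'
    _ = ∫ v, 𝓕 f v * (𝓕⁻ G : 𝓢(Pos d, ℂ)) v := by
        rw [SchwartzMap.fourierInv_coe, Real.fourierInv_eq_fourier_comp_neg]
    _ = ∫ v, f v * 𝓕 (𝓕⁻ G : 𝓢(Pos d, ℂ)) v :=
        integral_fourier_mul hf (𝓕⁻ G : 𝓢(Pos d, ℂ)).integrable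
    _ = ∫ v, f v * G v := by
        rw [FourierTransform.fourier_fourierInv_eq]
    _ = _ := integral_congr_ae (.of_forall fun v => by
          simp only [hG, Complex.real_smul, mul_comm])

/-- The transform of the density at ζ is ∫ Ff(ζ, w) dw, so the integral over ζ unfolds into an
integral over phase space against U. -/
theorem potential_eq {Vhat : Pos d → ℂ} {f h : L2Phase d} (hr : (d : ℝ) / 2 < r)
    (hf : ∀ᵐ z, f z = decayC r z.2 * h z)
    (hf' : ∀ᵐ z, fourierL2 d f z = decayC r z.2 * fourierL2 d h z) {U : L1Phase d}
    (hU : ∀ᵐ y, U y = Vhat ((2 * Real.pi * ε) • y.1) * fourierL2 d f y) (y : Pos d) :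
    potential ε Vhat (densityL2 f) y =
      ∫ y' : Phase d, U y' * Complex.exp (2 * Real.pi * Complex.I * (⟪y, y'.1⟫_ℝ : ℝ)) := by
  have hi : Integrable fun y' : Phase d =>
      U y' * Complex.exp (2 * Real.pi * Complex.I * (⟪y, y'.1⟫_ℝ : ℝ)) := by
    refine (L1.integrable_coeFn U).mul_bdd (c := 1)
      (Continuous.aestronglyMeasurable (by fun_prop)) (.of_forall fun y' => ?_)
    have h1 := norm_character y'.1 ((y, 0) : Phase d)
    exact h1.le
  have h1 : ∫ y' : Phase d, U y' * Complex.exp (2 * Real.pi * Complex.I * (⟪y, y'.1⟫_ℝ : ℝ)) =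
      ∫ ζ, ∫ w, U (ζ, w) * Complex.exp (2 * Real.pi * Complex.I * (⟪y, ζ⟫_ℝ : ℝ)) :=
    integral_prod _ hi
  rw [h1, potential]
  refine integral_congr_ae ?_
  filter_upwards [fourier_density hr hf hf', ae_ae_phase hU] with ζ h2 h3
  rw [h2, density, ← integral_const_mul]
  refine integral_congr_ae ?_
  filter_upwards [h3] with w hw
  rw [hw]
  ring

/-- The Fourier representation of a product of a shifted potential with a function of `η`. -/
theorem integral_potential_mul (U : L1Phase d) {g : Pos d → ℂ} (hg : Integrable g) (c : ℝ)
    (z : Phase d) :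
    Integrable (fun η : Pos d => Complex.exp (2 * Real.pi * Complex.I * (⟪z.2, η⟫_ℝ : ℝ)) *
      (∫ y : Phase d, U y *
        Complex.exp (2 * Real.pi * Complex.I * (⟪z.1 - c • η, y.1⟫_ℝ : ℝ))) * g η) ∧
    ∫ η : Pos d, Complex.exp (2 * Real.pi * Complex.I * (⟪z.2, η⟫_ℝ : ℝ)) *
      (∫ y : Phase d, U y *
        Complex.exp (2 * Real.pi * Complex.I * (⟪z.1 - c • η, y.1⟫_ℝ : ℝ))) * g η =
      ∫ y : Phase d, U y * (character y.1 z * 𝓕⁻ g (z.2 - c • y.1)) := by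
  set F : Pos d × Phase d → ℂ := fun p =>
    (Complex.exp (2 * Real.pi * Complex.I * (⟪z.2, p.1⟫_ℝ : ℝ)) *
      Complex.exp (2 * Real.pi * Complex.I * (⟪z.1 - c • p.1, p.2.1⟫_ℝ : ℝ))) * (g p.1 * U p.2)
    with hF
  have hn : ∀ t : ℝ, ‖Complex.exp (2 * Real.pi * Complex.I * t)‖ = 1 := fun t => by
    have : 2 * Real.pi * Complex.I * t = ((2 * Real.pi * t : ℝ) : ℂ) * Complex.I := by
      push_cast; ring
    rw [this, Complex.norm_exp_ofReal_mul_I]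
  have hFi : Integrable F (volume.prod volume) := by
    refine (hg.mul_prod (L1.integrable_coeFn U)).bdd_mul (c := 1)
      (Continuous.aestronglyMeasurable (by fun_prop)) (.of_forall fun p => ?_)
    rw [norm_mul, hn, hn, one_mul]
  have h1 : ∀ η : Pos d, Complex.exp (2 * Real.pi * Complex.I * (⟪z.2, η⟫_ℝ : ℝ)) *
      (∫ y : Phase d, U y *
        Complex.exp (2 * Real.pi * Complex.I * (⟪z.1 - c • η, y.1⟫_ℝ : ℝ))) * g η =
      ∫ y : Phase d, F (η, y) := fun η => by
    rw [← integral_const_mul, ← integral_mul_const]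
    refine integral_congr_ae (.of_forall fun y => ?_)
    simp only [hF]
    ring
  simp only [h1]
  refine ⟨hFi.integral_prod_left, ?_⟩
  rw [integral_integral_swap hFi]
  refine integral_congr_ae (.of_forall fun y => ?_)
  simp only
  rw [Real.fourierInv_eq', ← mul_assoc, ← integral_const_mul]
  refine integral_congr_ae (.of_forall fun η => ?_)
  -- The identity of phases behind the twist: displacing the potential by cη in position amounts to
  -- displacing the velocity by c y.1.
  have h2 : (⟪z.2, η⟫_ℝ : ℝ) + ⟪z.1 - c • η, y.1⟫_ℝ = ⟪z.1, y.1⟫_ℝ + ⟪η, z.2 - c • y.1⟫_ℝ := by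
    rw [inner_sub_left, inner_sub_right, inner_smul_left, inner_smul_right, real_inner_comm η z.2]
    simp only [conj_trivial]
    ring
  simp only [hF, character, smul_eq_mul]
  have h3 : Complex.exp (2 * Real.pi * Complex.I * (⟪z.2, η⟫_ℝ : ℝ)) *
      Complex.exp (2 * Real.pi * Complex.I * (⟪z.1 - c • η, y.1⟫_ℝ : ℝ)) =
      Complex.exp (2 * Real.pi * Complex.I * (⟪z.1, y.1⟫_ℝ : ℝ)) *
        Complex.exp (((2 * Real.pi * ⟪η, z.2 - c • y.1⟫_ℝ : ℝ) : ℂ) * Complex.I) := by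
    rw [← Complex.exp_add, ← Complex.exp_add]
    congr 1
    have h4 := congrArg (fun t : ℝ => (t : ℂ)) h2
    simp only [Complex.ofReal_add] at h4
    push_cast
    linear_combination (2 * Real.pi * Complex.I) * h4
  rw [h3]
  ring

theorem fourierV_smul (f : Phase d → ℂ) (x η : Pos d) :
    fourierV f x ((2 * Real.pi) • η) = 𝓕 (fun v => f (x, v)) η := by
  rw [fourierV, Real.fourier_eq']
  refine integral_congr_ae (.of_forall fun v => ?_)
  simp only [smul_eq_mul]
  congr 2
  rw [inner_smul_left, real_inner_comm]
  simp only [conj_trivial]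
  push_cast
  ring

/-- The substitution ξ = 2πη absorbs the factor (2π)^{-d} and turns the displacements ±εξ/2 into
±πεη. Integrability of the transform in v is what permits Fubini's theorem in
`integral_potential_mul`. -/
theorem wignerB_eq {Vhat : Pos d → ℂ} {f h : L2Phase d} (hr : (d : ℝ) / 2 < r)
    (hf : ∀ᵐ z, f z = decayC r z.2 * h z)
    (hf' : ∀ᵐ z, fourierL2 d f z = decayC r z.2 * fourierL2 d h z) {U : L1Phase d}
    (hU : ∀ᵐ y, U y = Vhat ((2 * Real.pi * ε) • y.1) * fourierL2 d f y) {z : Phase d}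
    (hz : Integrable (𝓕 fun v => f (z.1, v))) :
    wignerB ε Vhat (densityL2 f) f z = (Complex.I / ε) *
      ((∫ y : Phase d, U y * (character y.1 z *
          𝓕⁻ (𝓕 fun v => f (z.1, v)) (z.2 - (Real.pi * ε) • y.1))) -
        ∫ y : Phase d, U y * (character y.1 z *
          𝓕⁻ (𝓕 fun v => f (z.1, v)) (z.2 - (-(Real.pi * ε)) • y.1))) := by
  obtain ⟨i1, e1⟩ := integral_potential_mul U hz (Real.pi * ε) z
  obtain ⟨i2, e2⟩ := integral_potential_mul U hz (-(Real.pi * ε)) z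
  rw [← e1, ← e2, ← integral_sub i1 i2, wignerB]
  set G : Pos d → ℂ := fun ξ => Complex.exp (Complex.I * (⟪z.2, ξ⟫_ℝ : ℝ)) *
      ((1 / ε : ℂ) * (potential ε Vhat (densityL2 f) (z.1 - (ε / 2) • ξ) -
        potential ε Vhat (densityL2 f) (z.1 + (ε / 2) • ξ))) *
      fourierV f z.1 ξ with hG
  have h1 := Measure.integral_comp_smul volume G (2 * Real.pi)
  rw [abs_of_nonneg (by positivity), finrank_euclideanSpace_fin] at h1
  have h2 : ∫ ξ, G ξ = ((2 * Real.pi : ℂ)) ^ d * ∫ η, G ((2 * Real.pi) • η) := by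
    rw [h1, Complex.real_smul, ← mul_assoc]
    push_cast
    rw [mul_inv_cancel₀, one_mul]
    have := Real.pi_ne_zero
    exact pow_ne_zero _ (by simp [Complex.ofReal_ne_zero.2 this])
  have hpi : (2 * Real.pi : ℂ) ^ d ≠ 0 :=
    pow_ne_zero _ (by simp [Complex.ofReal_ne_zero.2 Real.pi_ne_zero])
  rw [h2, ← mul_assoc, div_mul_cancel₀ _ hpi, div_eq_mul_one_div Complex.I, mul_assoc]
  congr 1
  rw [← integral_const_mul]
  refine integral_congr_ae (.of_forall fun η => ?_)
  simp only [hG, fourierV_smul, potential_eq hr hf hf' hU]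
  have a1 : z.1 - (ε / 2) • (2 * Real.pi) • η = z.1 - (Real.pi * ε) • η := by
    rw [smul_smul]; congr 2; ring
  have a2 : z.1 + (ε / 2) • (2 * Real.pi) • η = z.1 - (-(Real.pi * ε)) • η := by
    rw [smul_smul, neg_smul, sub_neg_eq_add]; congr 2; ring
  have a3 : Complex.I * ((⟪z.2, (2 * Real.pi) • η⟫_ℝ : ℝ) : ℂ) =
      2 * Real.pi * Complex.I * (⟪z.2, η⟫_ℝ : ℝ) := by
    rw [inner_smul_right]; push_cast; ring
  rw [a1, a2, a3]
  ring

theorem ae_phase_of_ae_ae {p : Phase d → Prop} (hp : MeasurableSet {z | p z})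
    (h : ∀ᵐ x : Pos d, ∀ᵐ v, p (x, v)) : ∀ᵐ z, p z :=
  (Measure.ae_prod_iff_ae_ae hp).2 h

theorem stronglyMeasurable_fourier_slice {F : Pos d → Pos d → ℂ}
    (hF : StronglyMeasurable fun z : Phase d => F z.1 z.2) :
    StronglyMeasurable fun z : Phase d => 𝓕 (F z.1) z.2 := by
  simp only [Real.fourier_eq']
  have hp : Measurable fun p : Phase d × Pos d => ((p.1.1, p.2) : Phase d) := by fun_prop
  have hc : Continuous fun p : Phase d × Pos d =>
    Complex.exp (((-2 * Real.pi * ⟪p.2, p.1.2⟫_ℝ : ℝ) : ℂ) * Complex.I) := by fun_prop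
  exact StronglyMeasurable.integral_prod_right (f := fun (z : Phase d) (v : Pos d) =>
    Complex.exp (↑(-2 * Real.pi * ⟪v, z.2⟫_ℝ) * Complex.I) • F z.1 v)
    (hc.stronglyMeasurable.smul (hF.comp_measurable hp))

theorem stronglyMeasurable_fourierInv_slice {F : Pos d → Pos d → ℂ}
    (hF : StronglyMeasurable fun z : Phase d => F z.1 z.2) :
    StronglyMeasurable fun z : Phase d => 𝓕⁻ (F z.1) z.2 := by
  have h := (stronglyMeasurable_fourier_slice hF).comp_measurable
    (by fun_prop : Measurable fun z : Phase d => ((z.1, -z.2) : Phase d))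
  simp only [Real.fourierInv_eq_fourier_neg]
  exact h

theorem ae_fourierInv_fourier_slice {f : L2Phase d} (hm : (d : ℝ) / 2 < m)
    (hr : (d : ℝ) / 2 < r) (hf : MemH ε m r f) :
    MeasurableSet {z : Phase d | 𝓕⁻ (𝓕 fun v => f (z.1, v)) z.2 = f z} ∧
    ∀ᵐ z : Phase d, 𝓕⁻ (𝓕 fun v => f (z.1, v)) z.2 = f z := by
  have m2 : StronglyMeasurable fun z : Phase d => 𝓕⁻ (𝓕 fun v => f (z.1, v)) z.2 :=
    stronglyMeasurable_fourierInv_slice (F := fun x => 𝓕 fun v => f (x, v))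
      (stronglyMeasurable_fourier_slice (F := fun x v => f (x, v)) (Lp.stronglyMeasurable f))
  have m3 : MeasurableSet {z : Phase d | 𝓕⁻ (𝓕 fun v => f (z.1, v)) z.2 = f z} :=
    measurableSet_eq_fun m2.measurable (Lp.stronglyMeasurable f).measurable
  refine ⟨m3, ae_phase_of_ae_ae m3 ?_⟩
  obtain ⟨h, hh, -⟩ := exists_eq_decay_mul hf
  filter_upwards [ae_integrable_fourier_slice hm hr hf, ae_integrable_slice_snd hr hh]
    with x h1 h2
  exact fourierInv_fourier_ae h2 h1

theorem ae_wignerB_eq {Vhat : Pos d → ℂ} {f : L2Phase d} (hm : (d : ℝ) / 2 < m)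
    (hr : (d : ℝ) / 2 < r) (hf : MemH ε m r f) {U : L1Phase d}
    (hU : ∀ᵐ y, U y = Vhat ((2 * Real.pi * ε) • y.1) * fourierL2 d f y) :
    ∀ᵐ z, wignerB ε Vhat (densityL2 f) f z = ((Complex.I / ε) • (twistConv d (Real.pi * ε) U f -
        twistConv d (-(Real.pi * ε)) U f) : L2Phase d) z := by
  obtain ⟨h, hh, hh'⟩ := exists_eq_decay_mul hf
  obtain ⟨hQm, hQ⟩ := ae_fourierInv_fourier_slice hm hr hf
  -- Inversion holds off a null set but is needed at shifted points. For each fixed y the shift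
  -- preserves null sets; measurability of the good set then allows the two almost-everywhere
  -- quantifiers to be exchanged.
  have key : ∀ c : ℝ, ∀ᵐ z : Phase d, ∀ᵐ y : Phase d,
      𝓕⁻ (𝓕 fun v => f (z.1, v)) (z.2 - c • y.1) = f (shiftV (c • y.1) z) := fun c => by
    have hc : Measurable fun p : Phase d × Phase d => shiftV (c • p.2.1) p.1 := by
      unfold shiftV; fun_prop
    refine (Measure.ae_ae_comm (p := fun z y : Phase d =>
      𝓕⁻ (𝓕 fun v => f (z.1, v)) (z.2 - c • y.1) = f (shiftV (c • y.1) z)) (hc hQm)).2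
      (.of_forall fun y => ?_)
    exact (measurePreserving_shiftV (c • y.1)).quasiMeasurePreserving.ae hQ
  have hI : ∀ᵐ z : Phase d, Integrable (𝓕 fun v => f (z.1, v)) :=
    Measure.quasiMeasurePreserving_fst.ae (ae_integrable_fourier_slice hm hr hf)
  filter_upwards [hI, key (Real.pi * ε), key (-(Real.pi * ε)), coeFn_twistConv (Real.pi * ε) U f,
    coeFn_twistConv (-(Real.pi * ε)) U f,
    Lp.coeFn_smul (Complex.I / ε : ℂ) (twistConv d (Real.pi * ε) U f -
        twistConv d (-(Real.pi * ε)) U f),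
    Lp.coeFn_sub (twistConv d (Real.pi * ε) U f) (twistConv d (-(Real.pi * ε)) U f)]
    with z h0 h1 h2 h3 h4 h5 h6
  rw [h5, Pi.smul_apply, h6, Pi.sub_apply, h3, h4, wignerB_eq hr hh hh' hU h0, smul_eq_mul]
  have e1 := integral_congr_ae (μ := volume) (h1.mono fun y hy =>
    congrArg (fun t => U y * (character y.1 z * t)) hy)
  have e2 := integral_congr_ae (μ := volume) (h2.mono fun y hy =>
    congrArg (fun t => U y * (character y.1 z * t)) hy)
  rw [e1, e2]

/-! ### Free transport on 𝓗^m_r -/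

section Path

variable {A : Type*} [Ring A] [Algebra ℂ A]

/-- The maps `t ↦ ∑ c_k(t) D_k` with `c_k` continuous and `D_k` in `N`. -/
def paths (N : Submodule ℂ A) : Submodule ℂ (ℝ → A) :=
  Submodule.span ℂ {F | ∃ c : ℝ → ℂ, Continuous c ∧ ∃ D ∈ N, F = fun t => c t • D}

theorem smul_mem_paths {N : Submodule ℂ A} {c : ℝ → ℂ} (hc : Continuous c) {D : A} (hD : D ∈ N) :
    (fun t => c t • D) ∈ paths N := Submodule.subset_span ⟨c, hc, D, hD, rfl⟩

theorem const_mem_paths {N : Submodule ℂ A} {D : A} (hD : D ∈ N) : (fun _ => D) ∈ paths N := by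
  simpa using smul_mem_paths (c := fun _ => 1) continuous_const hD

theorem mul_mem_paths {N N' : Submodule ℂ A} {F G : ℝ → A} (hF : F ∈ paths N)
    (hG : G ∈ paths N') : F * G ∈ paths (N * N') := by
  have h : paths N * paths N' ≤ paths (N * N') := by
    rw [paths, paths, Submodule.span_mul_span, Submodule.span_le]
    rintro _ ⟨_, ⟨c, hc, D, hD, rfl⟩, _, ⟨c', hc', D', hD', rfl⟩, rfl⟩
    have := smul_mem_paths (hc.mul hc') (Submodule.mul_mem_mul hD hD')
    refine (congrArg (· ∈ paths (N * N')) (funext fun t => ?_)).mpr this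
    exact smul_mul_smul_comm _ _ _ _
  exact h (Submodule.mul_mem_mul hF hG)

/-- The operators `P` with `P X_t = X_t P_t` for a path `t ↦ P_t` in `N`. -/
def pathIntertwine (X : ℝ → A) (N : Submodule ℂ A) : Submodule ℂ A where
  carrier := {P | ∃ F ∈ paths N, ∀ t, P * X t = X t * F t}
  add_mem' := by
    rintro P Q ⟨F, h1, h2⟩ ⟨G, h3, h4⟩
    exact ⟨F + G, add_mem h1 h3, fun t => by rw [add_mul, Pi.add_apply, mul_add, h2, h4]⟩
  zero_mem' := ⟨0, zero_mem _, by simp⟩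
  smul_mem' := by
    rintro c P ⟨F, h1, h2⟩
    exact ⟨c • F, Submodule.smul_mem _ c h1, fun t => by
      rw [smul_mul_assoc, Pi.smul_apply, mul_smul_comm, h2]⟩

theorem mul_le_pathIntertwine {X : ℝ → A} {M N M' N' : Submodule ℂ A}
    (h : M ≤ pathIntertwine X M') (h' : N ≤ pathIntertwine X N') :
    M * N ≤ pathIntertwine X (M' * N') := by
  refine Submodule.mul_le.2 fun P hP Q hQ => ?_
  obtain ⟨F, h1, h2⟩ := h hP
  obtain ⟨G, h3, h4⟩ := h' hQ
  exact ⟨F * G, mul_mem_paths h1 h3, fun t => by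
    rw [mul_assoc, h4, ← mul_assoc, h2, mul_assoc, Pi.mul_apply]⟩

theorem pow_le_pathIntertwine {X : ℝ → A} {M M' : Submodule ℂ A} (h : M ≤ pathIntertwine X M')
    (n : ℕ) : M ^ n ≤ pathIntertwine X (M' ^ n) := by
  induction n with
  | zero =>
    rw [pow_zero, pow_zero, Submodule.one_le]
    exact ⟨_, const_mem_paths (Submodule.one_le.1 le_rfl), fun t => by rw [one_mul, mul_one]⟩
  | succ n ih =>
    rw [pow_succ, pow_succ]
    exact mul_le_pathIntertwine ih h

/-- Conjugation of two families of letters by a unipotent flow. -/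
theorem add_le_pathIntertwine {X : ℝ → A} {ι : Type*} {a b : ι → A}
    (ha : ∀ i t, a i * X t = X t * a i)
    (hb : ∀ i t, b i * X t = X t * (b i - (t : ℂ) • a i)) :
    letterSpan a + letterSpan b ≤ pathIntertwine X (letterSpan a + letterSpan b) := by
  have h1 : letterSpan a ≤ letterSpan a + letterSpan b := le_sup_left
  have h2 : letterSpan b ≤ letterSpan a + letterSpan b := le_sup_right
  have h3 : (1 : A) ∈ pathIntertwine X (letterSpan a + letterSpan b) :=
    ⟨_, const_mem_paths (h1 (one_mem_letterSpan a)), fun t => by rw [one_mul, mul_one]⟩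
  refine sup_le (Submodule.span_le.2 ?_) (Submodule.span_le.2 ?_)
  · rintro _ (rfl | ⟨i, rfl⟩)
    · exact h3
    · exact ⟨_, const_mem_paths (h1 (mem_letterSpan a i)), ha i⟩
  · rintro _ (rfl | ⟨i, rfl⟩)
    · exact h3
    · exact ⟨_, sub_mem (const_mem_paths (h2 (mem_letterSpan b i)))
        (smul_mem_paths Complex.continuous_ofReal (h1 (mem_letterSpan a i))), hb i⟩

end Path

/-- The linear part `(x, v) ↦ (x + t v, v)` of free transport. -/
def shear (d : ℕ) (t : ℝ) : Phase d ≃L[ℝ] Phase d :=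
  LinearEquiv.toContinuousLinearEquiv
    { toFun := fun z => (z.1 + t • z.2, z.2)
      invFun := fun z => (z.1 - t • z.2, z.2)
      left_inv := fun z => by simp
      right_inv := fun z => by simp
      map_add' := fun z w => by ext <;> simp; ring
      map_smul' := fun c z => by ext <;> simp; ring }

theorem shear_apply (t : ℝ) (z : Phase d) : shear d t z = (z.1 + t • z.2, z.2) := rfl

theorem shear_symm_apply (t : ℝ) (z : Phase d) : (shear d t).symm z = (z.1 - t • z.2, z.2) := rfl

theorem shear_symm (t : ℝ) : (shear d t).symm = shear d (-t) := by
  refine ContinuousLinearEquiv.ext (funext fun z => ?_)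
  rw [shear_symm_apply, shear_apply, neg_smul, sub_eq_add_neg]

theorem measurePreserving_shear (t : ℝ) : MeasurePreserving (shear d t) := by
  have h : MeasurePreserving (fun z : Phase d => (z.1, z.2 + t • z.1)) :=
    (MeasurePreserving.id (volume : Measure (Pos d))).skew_product
      (g := fun x v => v + t • x) (by fun_prop) (.of_forall fun x =>
        (measurePreserving_add_right volume (t • x)).map_eq)
  exact (Measure.measurePreserving_swap.comp h).comp Measure.measurePreserving_swap

/-- Free transport `f(x, v) ↦ f(x - t v, v)`. -/
def flowL2 (d : ℕ) (t : ℝ) : L2Phase d →L[ℂ] L2Phase d := compL2 _ (measurePreserving_shear (-t))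

theorem coeFn_flowL2 (t : ℝ) (f : L2Phase d) : ∀ᵐ z, flowL2 d t f z = f (shear d (-t) z) :=
  coeFn_compL2 _ (measurePreserving_shear (-t)) f

theorem flowL2_add (s t : ℝ) (f : L2Phase d) : flowL2 d s (flowL2 d t f) = flowL2 d (s + t) f := by
  refine Lp.ext ?_
  filter_upwards [coeFn_flowL2 s (flowL2 d t f), coeFn_flowL2 (s + t) f,
    (measurePreserving_shear (d := d) (-s)).quasiMeasurePreserving.ae (coeFn_flowL2 t f)]
    with z h1 h2 h3
  rw [h1, h2, h3]
  congr 1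
  simp only [shear_apply, Prod.mk.injEq, and_true]
  module

theorem flowL2_zero (f : L2Phase d) : flowL2 d 0 f = f := by
  refine Lp.ext ?_
  filter_upwards [coeFn_flowL2 0 f] with z h1
  rw [h1]
  simp [shear_apply]

theorem flowL2_flowL2_neg (t : ℝ) (f : L2Phase d) : flowL2 d t (flowL2 d (-t) f) = f := by
  rw [flowL2_add, add_neg_cancel, flowL2_zero]

theorem continuous_flowL2 {Z : Type*} [TopologicalSpace Z] {τ : Z → ℝ} {f : Z → L2Phase d}
    (hτ : Continuous τ) (hf : Continuous f) : Continuous fun s => flowL2 d (τ s) (f s) := by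
  let g : Z → C(Phase d, Phase d) := fun s => ⟨shear d (-τ s), (shear d (-τ s)).continuous⟩
  have hg : Continuous g := by
    refine ContinuousMap.continuous_of_continuous_uncurry _ ?_
    change Continuous fun p : Z × Phase d => (p.2.1 + (-τ p.1) • p.2.2, p.2.2)
    fun_prop
  exact Continuous.compMeasurePreservingLp (g := g) hf hg
    (fun s => measurePreserving_shear (-τ s)) ENNReal.ofNat_ne_top

theorem pairL2_flowL2 (t : ℝ) (f g : L2Phase d) :
    pairL2 d (flowL2 d t f) g = pairL2 d f (flowL2 d (-t) g) := by
  rw [pairL2_apply, pairL2_apply, ← (measurePreserving_shear (d := d) t).integral_comp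
    (shear d t).toHomeomorph.measurableEmbedding]
  refine integral_congr_ae ?_
  filter_upwards [(measurePreserving_shear (d := d) t).quasiMeasurePreserving.ae
    (coeFn_flowL2 t f), coeFn_flowL2 (-t) g] with z h1 h2
  rw [h1, h2, neg_neg]
  congr 2
  simp [shear_apply]

theorem toDist_flowL2 (t : ℝ) (f : L2Phase d) :
    toDist d (flowL2 d t f) = linD (shear d t) (toDist d f) := by
  have h : MeasurePreserving (shear d t).symm := by
    rw [shear_symm]; exact measurePreserving_shear (-t)
  rw [linD_toDist _ (measurePreserving_shear t) h]
  congr 1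
  refine Lp.ext ?_
  filter_upwards [coeFn_flowL2 t f, coeFn_compL2 _ h f] with z h1 h2
  rw [h1, h2, Function.comp_apply, shear_symm]

theorem letter_horizontal_mul_shear (t : ℝ) (a : ℂ) (e : Pos d) (b : ℂ) (j : Fin d) :
    letter a (e, 0) b (coordV j) * linD (shear d t) =
      linD (shear d t) * letter a (e, 0) b (coordV j) := by
  have h := letter_mul_linD (shear d t) a (e, 0) b (coordV j)
  have h1 : shear d t (e, 0) = (e, 0) := by simp [shear_apply]
  have h2 : coordV j ∘L (shear d t : Phase d →L[ℝ] Phase d) = coordV j := by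
    ext z <;> simp [shear_apply]
  rwa [h1, h2] at h

/-- Along the shear, ∂_v acquires -t∂_x and x becomes x + tv. Thus X_- is conjugated to X_- - tV_+
and X_+ to X_+ - tV_-, which explains why the norm groups V_+ with X_- and V_- with X_+. -/
theorem letter_vertical_mul_shear (t : ℝ) (a : ℂ) (e : Pos d) (b : ℂ) (j : Fin d) :
    letter a (0, e) b (coordX j) * linD (shear d t) =
      linD (shear d t) * (letter a (0, e) b (coordX j) -
        (t : ℂ) • letter a (e, 0) (-b) (coordV j)) := by
  have h := letter_mul_linD (shear d t) a (-(t • e), e) b (coordX j)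
  have h1 : shear d t (-(t • e), e) = (0, e) := by simp [shear_apply]
  have h2 : letter a (-(t • e), e) b (coordX j ∘L (shear d t : Phase d →L[ℝ] Phase d)) =
      letter a (0, e) b (coordX j) - (t : ℂ) • letter a (e, 0) (-b) (coordV j) := by
    ext u φ
    change _ = letter a (0, e) b (coordX j) u φ - (t : ℂ) • letter a (e, 0) (-b) (coordV j) u φ
    rw [letter_apply, letter_apply, letter_apply, ← map_smul, ← map_sub]
    congr 1
    ext z
    have e1 : ((-(t • e), e) : Phase d) = (0, e) - t • (e, 0) := by simp
    have e2 : (coordX j ∘L (shear d t : Phase d →L[ℝ] Phase d)) z = coordX j z + t * coordV j z := by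
      simp [shear_apply]
    change _ = letterT a (0, e) b (coordX j) φ z - (t : ℂ) * letterT a (e, 0) (-b) (coordV j) φ z
    rw [letterT_apply, letterT_apply, letterT_apply, e1, e2, map_sub, map_smul, Complex.real_smul]
    ring
  rwa [h1, h2] at h

/-- Each of the three factors of `opSpan` joins a family fixed by the flow to one that moves by
multiples of it, so every factor is preserved separately, with coefficients continuous in t. -/
theorem opSpan_le_pathIntertwine :
    opSpan d ε m r ≤ pathIntertwine (fun t => linD (shear d t)) (opSpan d ε m r) := by
  have h0 : ∀ (e : Phase d) (j : Fin d), letter 1 e 0 0 = letter 1 e 0 (coordV j) := by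
    intro e j; simp [letter]
  have h0' : ∀ (e : Phase d) (j : Fin d), letter 1 e 0 0 = letter 1 e 0 (coordX j) := by
    intro e j; simp [letter]
  refine mul_le_pathIntertwine (mul_le_pathIntertwine (pow_le_pathIntertwine
    (add_le_pathIntertwine ?_ ?_) r) (pow_le_pathIntertwine (add_le_pathIntertwine ?_ ?_) r))
    (pow_le_pathIntertwine (add_le_pathIntertwine ?_ ?_) m) <;> intro j t
  · rw [vPlus_eq]; exact letter_horizontal_mul_shear t _ _ _ j
  · rw [vPlus_eq, xMinus_eq]
    simpa only [neg_neg] using letter_vertical_mul_shear t _ _ (-(2 * Complex.I)) j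
  · rw [vMinus_eq]; exact letter_horizontal_mul_shear t _ _ _ j
  · rw [vMinus_eq, xPlus_eq]; exact letter_vertical_mul_shear t _ _ _ j
  · rw [dX_eq, h0 _ j]; exact letter_horizontal_mul_shear t _ _ _ j
  · rw [dX_eq, dV_eq, h0 (EuclideanSpace.single j 1, 0) j, h0' (0, EuclideanSpace.single j 1) j]
    simpa only [neg_zero] using letter_vertical_mul_shear t 1 (EuclideanSpace.single j 1) 0 j

theorem exists_path_toDist {f : L2Phase d} (hf : MemH ε m r f) {F : ℝ → DistOp d}
    (hF : F ∈ paths (opSpan d ε m r)) :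
    ∃ q : ℝ → L2Phase d, Continuous q ∧ ∀ t, toDist d (q t) = F t (toDist d f) := by
  induction hF using Submodule.span_induction with
  | mem F h =>
    obtain ⟨c, hc, D, hD, rfl⟩ := h
    obtain ⟨g, hg⟩ := memH_iff.1 hf D hD
    refine ⟨fun t => c t • g, by fun_prop, fun t => ?_⟩
    rw [map_smul]
    exact congrArg (c t • ·) hg
  | zero => exact ⟨0, continuous_const, fun t => by simp⟩
  | add F G _ _ h1 h2 =>
    obtain ⟨q, hq, h1⟩ := h1
    obtain ⟨q', hq', h2⟩ := h2
    exact ⟨fun t => q t + q' t, hq.add hq', fun t => by rw [map_add, h1, h2]; rfl⟩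
  | smul c F _ h =>
    obtain ⟨q, hq, h⟩ := h
    exact ⟨fun t => c • q t, by fun_prop, fun t => by rw [map_smul, h]; rfl⟩

/-- A word applied to the transported function is free transport of F_t f, where F_t is a continuous
path of operators in `opSpan`. Both F_t f and the flow on L² depend continuously on t. -/
theorem exists_flow_lift (p : HSpace d ε m r) :
    ∃ y : ℝ → HSpace d ε m r, Continuous y ∧
      ∀ t, toL2 d ε m r (y t) = flowL2 d t (toL2 d ε m r p) := by
  have h : ∀ i : Idx d m r, ∃ q : ℝ → L2Phase d, Continuous q ∧
      ∀ t, toDist d (q t) = word ε i (toDist d (flowL2 d t (toL2 d ε m r p))) := fun i => by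
    obtain ⟨F, hF, hX⟩ := opSpan_le_pathIntertwine (word_mem ε i)
    obtain ⟨q, hq, hq'⟩ := exists_path_toDist (memH_toL2 p) hF
    refine ⟨fun t => flowL2 d t (q t), continuous_flowL2 continuous_id hq, fun t => ?_⟩
    rw [toDist_flowL2, toDist_flowL2, hq']
    exact (DFunLike.congr_fun (hX t) (toDist d (toL2 d ε m r p))).symm
  choose q hq hq' using h
  exact ⟨fun t => ⟨(flowL2 d t (toL2 d ε m r p), fun i => q i t), fun i => hq' i t⟩,
    Continuous.subtype_mk ((continuous_flowL2 continuous_id continuous_const).prodMk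
      (continuous_pi hq)) _, fun t => rfl⟩

theorem exists_flow (d : ℕ) (ε : ℝ) (m r : ℕ) :
    ∃ S : ℝ → HSpace d ε m r →L[ℂ] HSpace d ε m r,
      (∀ t p, toL2 d ε m r (S t p) = flowL2 d t (toL2 d ε m r p)) ∧
      ∀ p, Continuous fun t => S t p := by
  have h : ∀ t, ∃ S : HSpace d ε m r →L[ℂ] HSpace d ε m r,
      ∀ p, toL2 d ε m r (S p) = flowL2 d t (toL2 d ε m r p) := fun t =>
    exists_lift toL2_injective (flowL2 d t ∘L toL2 d ε m r) fun p => by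
      obtain ⟨y, -, hy⟩ := exists_flow_lift p
      exact ⟨y t, hy t⟩
  choose S hS using h
  refine ⟨S, hS, fun p => ?_⟩
  obtain ⟨y, hc, hy⟩ := exists_flow_lift p
  have : (fun t => S t p) = y := funext fun t => toL2_injective (by rw [hS, hy])
  rwa [this]

/-- Free transport on `𝓗^m_r`. -/
def flowH (d : ℕ) (ε : ℝ) (m r : ℕ) (t : ℝ) : HSpace d ε m r →L[ℂ] HSpace d ε m r :=
  (exists_flow d ε m r).choose t

theorem toL2_flowH (t : ℝ) (p : HSpace d ε m r) :
    toL2 d ε m r (flowH d ε m r t p) = flowL2 d t (toL2 d ε m r p) :=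
  (exists_flow d ε m r).choose_spec.1 t p

theorem flowH_flowH_neg (t : ℝ) (p : HSpace d ε m r) :
    flowH d ε m r t (flowH d ε m r (-t) p) = p :=
  toL2_injective (by rw [toL2_flowH, toL2_flowH, flowL2_flowL2_neg])

theorem flowH_zero (p : HSpace d ε m r) : flowH d ε m r 0 p = p :=
  toL2_injective (by rw [toL2_flowH, flowL2_zero])

/-- Strong continuity bounds each orbit on a compact time interval; the uniform boundedness
principle replaces an explicit bound in t. -/
theorem exists_norm_flowH_le (d : ℕ) (ε : ℝ) (m r : ℕ) (R : ℝ) :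
    ∃ C : ℝ, 0 ≤ C ∧ ∀ t, |t| ≤ R → ‖flowH d ε m r t‖ ≤ C := by
  obtain ⟨C, hC⟩ := banach_steinhaus (g := fun t : Set.Icc (-R) R => flowH d ε m r t) fun p => by
    have hc : Continuous fun t => flowH d ε m r t p := (exists_flow d ε m r).choose_spec.2 p
    obtain ⟨C, hC⟩ := isCompact_Icc.exists_bound_of_continuousOn (s := Set.Icc (-R) R)
      hc.continuousOn
    exact ⟨C, fun t => hC t t.2⟩
  exact ⟨max C 0, le_max_right _ _, fun t ht => (hC ⟨t, abs_le.1 ht⟩).trans (le_max_left _ _)⟩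

theorem continuous_flowH {Z : Type*} [TopologicalSpace Z] {τ : Z → ℝ} {p : Z → HSpace d ε m r}
    (hτ : Continuous τ) (hp : Continuous p) : Continuous fun s => flowH d ε m r (τ s) (p s) := by
  refine continuous_iff_continuousAt.2 fun s => ?_
  obtain ⟨C, hC0, hC⟩ := exists_norm_flowH_le d ε m r (|τ s| + 1)
  have h1 : Filter.Tendsto (fun x => flowH d ε m r (τ x) (p s)) (𝓝 s)
      (𝓝 (flowH d ε m r (τ s) (p s))) :=
    (((exists_flow d ε m r).choose_spec.2 (p s)).comp hτ).tendsto s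
  have h2 : Filter.Tendsto (fun x => flowH d ε m r (τ x) (p x - p s)) (𝓝 s) (𝓝 0) := by
    have h3 : Filter.Tendsto (fun x => C * ‖p x - p s‖) (𝓝 s) (𝓝 0) := by
      have : Continuous fun x => C * ‖p x - p s‖ := by fun_prop
      simpa using this.tendsto s
    refine squeeze_zero_norm' ?_ h3
    have h4 : ∀ᶠ x in 𝓝 s, |τ x| < |τ s| + 1 :=
      (hτ.abs.tendsto s).eventually_lt_const (lt_add_one _)
    filter_upwards [h4] with x hx
    exact (flowH d ε m r (τ x)).le_of_opNorm_le (hC _ hx.le) _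
  have h5 := h1.add h2
  rw [add_zero] at h5
  refine h5.congr fun x => ?_
  rw [← map_add, add_sub_cancel]

/-! ### Differential equations in Banach spaces -/

section ODE

variable {E : Type*} [NormedAddCommGroup E] [NormedSpace ℝ E]

/-- A function whose image under a separating family of functionals has a continuous derivative is
differentiable. -/
theorem hasDerivWithinAt_of_forall_clm [CompleteSpace E] {ι F : Type*} [NormedAddCommGroup F] [NormedSpace ℝ F]
    [CompleteSpace F] {ℓ : ι → E →L[ℝ] F} (hℓ : ∀ x y, (∀ i, ℓ i x = ℓ i y) → x = y) {y g : ℝ → E}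
    {a b : ℝ} (hg : Continuous g)
    (h : ∀ i, ∀ t ∈ Set.Icc a b,
      HasDerivWithinAt (fun s => ℓ i (y s)) (ℓ i (g t)) (Set.Icc a b) t)
    {t : ℝ} (ht : t ∈ Set.Icc a b) : HasDerivWithinAt y (g t) (Set.Icc a b) t := by
  -- The functionals identify y with a primitive of the continuous function g, and a primitive is
  -- differentiable in norm.
  have key : ∀ s ∈ Set.Icc a b, y s = (∫ τ in a..s, g τ) + y a := fun s hs => hℓ _ _ fun i => by
    have hsub : Set.Icc a s ⊆ Set.Icc a b := Set.Icc_subset_Icc_right hs.2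
    have h1 := intervalIntegral.integral_eq_sub_of_hasDerivAt_of_le hs.1
      (f := fun s => ℓ i (y s)) (f' := fun s => ℓ i (g s))
      (fun τ hτ => ((h i τ (hsub hτ)).continuousWithinAt).mono hsub)
      (fun τ hτ => (h i τ (hsub (Set.Ioo_subset_Icc_self hτ))).hasDerivAt
        (Icc_mem_nhds hτ.1 (hτ.2.trans_le hs.2)))
      (((ℓ i).continuous.comp hg).intervalIntegrable _ _)
    rw [map_add, ← (ℓ i).intervalIntegral_comp_comm (hg.intervalIntegrable _ _), h1,
      sub_add_cancel]
  have h2 := ((hg.integral_hasStrictDerivAt a t).hasDerivAt.add_const (y a)).hasDerivWithinAt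
    (s := Set.Icc a b)
  exact h2.congr key (key t ht)

theorem exists_hasDerivWithinAt_of_locally_lipschitz [CompleteSpace E] {Φ : ℝ → E → E}
    (hc : ∀ x, Continuous fun t => Φ t x)
    (hΦ : ∀ R, ∃ K : ℝ, 0 ≤ K ∧ ∀ t ∈ Set.Icc (0 : ℝ) 1, ∀ x y, ‖x‖ ≤ R → ‖y‖ ≤ R →
      ‖Φ t x - Φ t y‖ ≤ K * ‖x - y‖) (x₀ : E) :
    ∃ T : ℝ, 0 < T ∧ T ≤ 1 ∧ ∃ y : ℝ → E, y 0 = x₀ ∧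
      ∀ t ∈ Set.Icc 0 T, HasDerivWithinAt y (Φ t (y t)) (Set.Icc 0 T) t := by
  obtain ⟨K, hK0, hK⟩ := hΦ (‖x₀‖ + 1)
  obtain ⟨M, hM⟩ := isCompact_Icc.exists_bound_of_continuousOn (s := Set.Icc (0 : ℝ) 1)
    (hc x₀).continuousOn
  have hM0 : 0 ≤ M := (norm_nonneg _).trans (hM 0 (by simp))
  -- On the unit ball around the initial value the field has norm at most K + M, so T(K + M) ≤ 1
  -- keeps the solution in that ball. The added 1 makes T well defined and at most 1, the range in
  -- which the Lipschitz bound holds.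
  set T : ℝ := (K + M + 1)⁻¹ with hT
  have hT0 : 0 < T := by positivity
  have hT1 : T ≤ 1 := inv_le_one_of_one_le₀ (by linarith)
  have hsub : Set.Icc 0 T ⊆ Set.Icc (0 : ℝ) 1 := Set.Icc_subset_Icc_right hT1
  have hball : ∀ x ∈ Metric.closedBall x₀ ((1 : NNReal) : ℝ), ‖x‖ ≤ ‖x₀‖ + 1 := fun x hx => by
    have h1 := norm_sub_norm_le x x₀
    rw [mem_closedBall_iff_norm, NNReal.coe_one] at hx
    linarith
  have hP : IsPicardLindelof Φ (⟨0, le_rfl, hT0.le⟩ : Set.Icc 0 T) x₀ 1 0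
      ⟨K + M, by positivity⟩ ⟨K, hK0⟩ := by
    refine ⟨fun t ht => LipschitzOnWith.of_dist_le_mul fun x hx y hy => ?_,
      fun x _ => (hc x).continuousOn, fun t ht x hx => ?_, ?_⟩
    · rw [dist_eq_norm, dist_eq_norm]
      exact hK t (hsub ht) x y (hball x hx) (hball y hy)
    · have h1 := hK t (hsub ht) x x₀ (hball x hx) (by linarith)
      have h2 := norm_le_norm_add_norm_sub' (Φ t x) (Φ t x₀)
      rw [mem_closedBall_iff_norm, NNReal.coe_one] at hx
      have h3 := hM t (hsub ht)
      have h4 := mul_le_mul_of_nonneg_left hx hK0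
      change ‖Φ t x‖ ≤ K + M
      linarith
    · change (K + M) * max (T - 0) (0 - 0) ≤ 1 - 0
      rw [sub_zero, sub_zero, sub_zero, max_eq_left hT0.le, hT, ← div_eq_mul_inv,
        div_le_one (by positivity)]
      linarith
  obtain ⟨y, hy0, hy⟩ := hP.exists_eq_forall_mem_Icc_hasDerivWithinAt₀
  exact ⟨T, hT0, hT1, y, hy0, hy⟩

theorem eqOn_of_hasDerivWithinAt_of_locally_lipschitz {Φ : ℝ → E → E}
    (hΦ : ∀ R, ∃ K : ℝ, 0 ≤ K ∧ ∀ t ∈ Set.Icc (0 : ℝ) 1, ∀ x y, ‖x‖ ≤ R → ‖y‖ ≤ R →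
      ‖Φ t x - Φ t y‖ ≤ K * ‖x - y‖) {T : ℝ} (hT : T ≤ 1) {y z : ℝ → E}
    (hy : ∀ t ∈ Set.Icc 0 T, HasDerivWithinAt y (Φ t (y t)) (Set.Icc 0 T) t)
    (hz : ∀ t ∈ Set.Icc 0 T, HasDerivWithinAt z (Φ t (z t)) (Set.Icc 0 T) t) (h0 : y 0 = z 0) :
    Set.EqOn y z (Set.Icc 0 T) := by
  have hyc : ContinuousOn y (Set.Icc 0 T) := fun t ht => (hy t ht).continuousWithinAt
  have hzc : ContinuousOn z (Set.Icc 0 T) := fun t ht => (hz t ht).continuousWithinAt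
  obtain ⟨R, hR⟩ := isCompact_Icc.exists_bound_of_continuousOn hyc
  obtain ⟨R', hR'⟩ := isCompact_Icc.exists_bound_of_continuousOn hzc
  -- Both solutions are bounded on the compact interval, so one Lipschitz constant serves for both.
  obtain ⟨K, hK0, hK⟩ := hΦ (max R R')
  have hIci : ∀ {u : ℝ → E} {u' : E} {t : ℝ}, t ∈ Set.Ico 0 T →
      HasDerivWithinAt u u' (Set.Icc 0 T) t → HasDerivWithinAt u u' (Set.Ici t) t :=
    fun ht hu => hu.mono_of_mem_nhdsWithin (Icc_mem_nhdsGE_of_mem ht)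
  refine ODE_solution_unique_of_mem_Icc_right (K := ⟨K, hK0⟩)
    (s := fun _ => {x | ‖x‖ ≤ max R R'}) (fun t ht => LipschitzOnWith.of_dist_le_mul
      fun x hx w hw => ?_) hyc (fun t ht => hIci ht (hy t (Set.Ico_subset_Icc_self ht)))
    (fun t ht => (hR t (Set.Ico_subset_Icc_self ht)).trans (le_max_left _ _)) hzc
    (fun t ht => hIci ht (hz t (Set.Ico_subset_Icc_self ht)))
    (fun t ht => (hR' t (Set.Ico_subset_Icc_self ht)).trans (le_max_right _ _)) h0
  rw [dist_eq_norm, dist_eq_norm]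
  exact hK t ⟨ht.1, ht.2.le.trans hT⟩ x w hx hw

end ODE

/-! ### Weak formulation and interaction picture -/

/-- The derivative `v · ∇_x` of a test function. -/
def freeDeriv (d : ℕ) : 𝓢(Phase d, ℂ) →L[ℂ] 𝓢(Phase d, ℂ) :=
  ∑ j : Fin d, SchwartzMap.smulLeftCLM ℂ (coordV j) ∘L
    lineDerivOpCLM ℂ 𝓢(Phase d, ℂ) ((EuclideanSpace.single j (1 : ℝ), 0) : Phase d)

theorem freeDeriv_apply (φ : 𝓢(Phase d, ℂ)) (z : Phase d) :
    freeDeriv d φ z = fderiv ℝ φ z (z.2, 0) := by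
  have h : ((z.2, 0) : Phase d) =
      ∑ j : Fin d, (z.2 j) • ((EuclideanSpace.single j (1 : ℝ), 0) : Phase d) := by
    refine Prod.ext ?_ ?_
    · rw [Prod.fst_sum]
      ext i
      simp [Finset.sum_apply, Pi.single_apply]
    · simp [Prod.snd_sum]
  rw [h, map_sum, freeDeriv]
  simp only [map_smul, Complex.real_smul]
  simp [SchwartzMap.smulLeftCLM_apply_apply (coordV _).hasTemperateGrowth,
    SchwartzMap.lineDerivOp_apply_eq_fderiv]

/-- Free transport of test functions. -/
def shearS (d : ℕ) (t : ℝ) : 𝓢(Phase d, ℂ) →L[ℂ] 𝓢(Phase d, ℂ) :=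
  SchwartzMap.compCLMOfContinuousLinearEquiv ℂ (shear d t)

theorem shearS_apply (t : ℝ) (φ : 𝓢(Phase d, ℂ)) (z : Phase d) :
    shearS d t φ z = φ (shear d t z) := rfl

theorem flowL2_schwartzL2 (t : ℝ) (φ : 𝓢(Phase d, ℂ)) :
    flowL2 d (-t) (schwartzL2 d φ) = schwartzL2 d (shearS d t φ) := by
  refine Lp.ext ?_
  filter_upwards [coeFn_flowL2 (-t) (schwartzL2 d φ), coeFn_schwartzL2 (shearS d t φ),
    (measurePreserving_shear (d := d) t).quasiMeasurePreserving.ae (coeFn_schwartzL2 φ)]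
    with z h1 h2 h3
  rw [h1, h2, neg_neg, h3, shearS_apply]

theorem hasDerivAt_shear (φ : 𝓢(Phase d, ℂ)) (z : Phase d) (t : ℝ) :
    HasDerivAt (fun s => φ (shear d s z)) (freeDeriv d φ (shear d t z)) t := by
  have h1 : HasDerivAt (fun s : ℝ => shear d s z) ((z.2, 0) : Phase d) t := by
    have h2 : HasDerivAt (fun s : ℝ => z.1 + s • z.2) z.2 t := by
      simpa using ((hasDerivAt_id t).smul_const z.2).const_add z.1
    exact h2.prodMk (hasDerivAt_const t z.2)
  have h3 := (φ.hasFDerivAt (shear d t z)).comp_hasDerivAt t h1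
  rw [freeDeriv_apply]
  exact h3

theorem freeDeriv_shearS (t : ℝ) (φ : 𝓢(Phase d, ℂ)) :
    freeDeriv d (shearS d t φ) = shearS d t (freeDeriv d φ) := by
  ext z
  have h1 := (φ.hasFDerivAt (shear d t z)).comp z (shear d t).hasFDerivAt
  have h2 : (shearS d t φ : Phase d → ℂ) = φ ∘ shear d t := rfl
  rw [freeDeriv_apply, shearS_apply, freeDeriv_apply, h2, h1.fderiv]
  simp [shear_apply]

theorem hasDerivAt_integral_shear (φ ψ : 𝓢(Phase d, ℂ)) (t : ℝ) :
    HasDerivAt (fun s => ∫ z, φ (shear d s z) * ψ z)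
      (∫ z, freeDeriv d φ (shear d t z) * ψ z) t := by
  obtain ⟨C, hC⟩ : ∃ C : ℝ, ∀ z, ‖freeDeriv d φ z‖ ≤ C :=
    ⟨_, fun z => SchwartzMap.norm_le_seminorm ℂ (freeDeriv d φ) z⟩
  have hm : ∀ (χ : 𝓢(Phase d, ℂ)) (s : ℝ),
      AEStronglyMeasurable (fun z => χ (shear d s z) * ψ z) := fun χ s =>
    ((χ.continuous.comp (shear d s).continuous).mul ψ.continuous).aestronglyMeasurable
  refine (hasDerivAt_integral_of_dominated_loc_of_deriv_le
    (F' := fun s z => freeDeriv d φ (shear d s z) * ψ z) (bound := fun z => C * ‖ψ z‖)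
    Filter.univ_mem (.of_forall fun s => hm φ s) ?_ (hm _ t) (.of_forall fun z s _ => ?_)
    (ψ.integrable.norm.const_mul C) (.of_forall fun z s _ => ?_)).2
  · exact ψ.integrable.bdd_mul (c := SchwartzMap.seminorm ℂ 0 0 φ)
      (φ.continuous.comp (shear d t).continuous).aestronglyMeasurable
      (.of_forall fun z => SchwartzMap.norm_le_seminorm ℂ φ _)
  · rw [norm_mul]
    exact mul_le_mul_of_nonneg_right (hC _) (norm_nonneg _)
  · exact (hasDerivAt_shear φ z s).mul_const (ψ z)

/-- The derivative exists in the L² norm: weak derivatives against Schwartz functions come from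
differentiation under the integral, and continuity of the candidate derivative upgrades them. -/
theorem hasDerivAt_flowL2_schwartzL2 (φ : 𝓢(Phase d, ℂ)) (t : ℝ) :
    HasDerivAt (fun s => flowL2 d (-s) (schwartzL2 d φ))
      (flowL2 d (-t) (schwartzL2 d (freeDeriv d φ))) t := by
  have hc : Continuous fun s => flowL2 d (-s) (schwartzL2 d (freeDeriv d φ)) :=
    continuous_flowL2 continuous_neg continuous_const
  have e : ∀ (χ ψ : 𝓢(Phase d, ℂ)) (s : ℝ), pairL2 d (schwartzL2 d ψ)
      (flowL2 d (-s) (schwartzL2 d χ)) = ∫ z, χ (shear d s z) * ψ z := fun χ ψ s => by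
    rw [pairL2_comm, pairL2_schwartz, flowL2_schwartzL2, toDist_apply]
    refine integral_congr_ae ?_
    filter_upwards [coeFn_schwartzL2 (shearS d s χ)] with z hz
    rw [hz, shearS_apply]
  refine (hasDerivWithinAt_of_forall_clm (a := t - 1) (b := t + 1)
    (ℓ := fun ψ : 𝓢(Phase d, ℂ) => (pairL2 d (schwartzL2 d ψ)).restrictScalars ℝ)
    (fun f g h => ext_pairL2 fun ψ => ?_) hc (fun ψ s _ => ?_)
    (by simp)).hasDerivAt (Icc_mem_nhds (by linarith) (by linarith))
  · rw [pairL2_comm, pairL2_comm g]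
    exact h ψ
  · simp only [ContinuousLinearMap.coe_restrictScalars']
    simp only [e]
    exact (hasDerivAt_integral_shear φ ψ s).hasDerivWithinAt

section Duhamel

variable {E : Type*} [NormedAddCommGroup E] [NormedSpace ℂ E]

/-- The vector field of a quadratic evolution equation in the interaction picture. -/
def interactionField (S : ℝ → E →L[ℂ] E) (b : E →L[ℂ] E →L[ℂ] E) (t : ℝ) (x : E) : E :=
  -S (-t) (b (S t x) (S t x))

theorem interactionField_lipschitz {S : ℝ → E →L[ℂ] E} {b : E →L[ℂ] E →L[ℂ] E} {C : ℝ}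
    (hC0 : 0 ≤ C) (hC : ∀ t, |t| ≤ 1 → ‖S t‖ ≤ C) (R : ℝ) :
    ∃ K : ℝ, 0 ≤ K ∧ ∀ t ∈ Set.Icc (0 : ℝ) 1, ∀ x y, ‖x‖ ≤ R → ‖y‖ ≤ R →
      ‖interactionField S b t x - interactionField S b t y‖ ≤ K * ‖x - y‖ := by
  refine ⟨C * (‖b‖ * (C * |R| + C * |R|) * C), by positivity, fun t ht x y hx hy => ?_⟩
  have h1 : ‖S t‖ ≤ C := hC t (abs_le.2 ⟨by linarith [ht.1], ht.2⟩)
  have h2 : ‖S (-t)‖ ≤ C := hC (-t) (by rw [abs_neg]; exact abs_le.2 ⟨by linarith [ht.1], ht.2⟩)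
  have h3 : ∀ w, ‖w‖ ≤ R → ‖S t w‖ ≤ C * |R| := fun w hw =>
    (S t).le_of_opNorm_le_of_le h1 (hw.trans (le_abs_self R))
  have h4 : ‖S t x - S t y‖ ≤ C * ‖x - y‖ := by
    rw [← map_sub]
    exact (S t).le_of_opNorm_le h1 _
  have e : interactionField S b t x - interactionField S b t y =
      -S (-t) (b (S t x - S t y) (S t x) + b (S t y) (S t x - S t y)) := by
    rw [interactionField, interactionField, neg_sub_neg, ← map_sub, ← map_neg]
    congr 1
    simp only [map_sub, sub_apply]
    abel
  rw [e, norm_neg]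
  have h5 : ‖b (S t x - S t y) (S t x) + b (S t y) (S t x - S t y)‖ ≤
      ‖b‖ * (C * |R| + C * |R|) * C * ‖x - y‖ := by
    have h6 := b.le_opNorm₂ (S t x - S t y) (S t x)
    have h7 := b.le_opNorm₂ (S t y) (S t x - S t y)
    have h8 : ‖b‖ * ‖S t x - S t y‖ * ‖S t x‖ ≤ ‖b‖ * (C * ‖x - y‖) * (C * |R|) := by
      gcongr
      exact h3 x hx
    have h9 : ‖b‖ * ‖S t y‖ * ‖S t x - S t y‖ ≤ ‖b‖ * (C * |R|) * (C * ‖x - y‖) := by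
      gcongr
      exact h3 y hy
    refine (norm_add_le _ _).trans ?_
    linarith
  refine ((S (-t)).le_of_opNorm_le_of_le h2 h5).trans (le_of_eq ?_)
  ring

end Duhamel

theorem IsShortRange.exists_interaction {V : 𝓢'(Pos d, ℂ)} {Vhat : Pos d → ℂ}
    (hV : IsShortRange V Vhat) (hm : (d : ℝ) / 2 < m) (hr : (d : ℝ) / 2 < r) (hε : 0 < ε) :
    ∃ b : HSpace d ε m r →L[ℂ] HSpace d ε m r →L[ℂ] HSpace d ε m r,
      (∀ p q, ∃ U : L1Phase d,
        (∀ᵐ y, U y = Vhat ((2 * Real.pi * ε) • y.1) * fourierL2 d (toL2 d ε m r p) y) ∧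
        toL2 d ε m r (b p q) = (Complex.I / ε) • (twistConv d (Real.pi * ε) U (toL2 d ε m r q) -
          twistConv d (-(Real.pi * ε)) U (toL2 d ε m r q))) ∧
      ∀ p, ∀ᵐ z, wignerB ε Vhat (densityL2 (toL2 d ε m r p)) (toL2 d ε m r p) z =
        toL2 d ε m r (b p p) z := by
  obtain ⟨C, hC⟩ := hV.bounded 0
  obtain ⟨b, hb⟩ := Wigner.exists_interaction (m := m) hε hr
    (k := fun ζ => Vhat ((2 * Real.pi * ε) • ζ)) (hV.smooth.continuous.comp (by fun_prop))
    (C := C) (fun ζ => by simpa using hC ((2 * Real.pi * ε) • ζ))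
  refine ⟨b, hb, fun p => ?_⟩
  obtain ⟨U, hU, e⟩ := hb p p
  rw [e]
  exact ae_wignerB_eq hm hr (memH_toL2 p) hU

/-- The weak form of the right-hand side of the Wigner equation. -/
theorem weak_rhs_eq {Vhat : Pos d → ℂ} {p q : HSpace d ε m r}
    (hq : ∀ᵐ z, wignerB ε Vhat (densityL2 (toL2 d ε m r p)) (toL2 d ε m r p) z =
      toL2 d ε m r q z) (φ : 𝓢(Phase d, ℂ)) :
    (∫ z, toL2 d ε m r p z * fderiv ℝ φ z (z.2, 0)) -
      ∫ z, wignerB ε Vhat (densityL2 (toL2 d ε m r p)) (toL2 d ε m r p) z * φ z =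
      pairL2 d (toL2 d ε m r p) (schwartzL2 d (freeDeriv d φ)) -
        pairL2 d (toL2 d ε m r q) (schwartzL2 d φ) := by
  rw [pairL2_schwartz, pairL2_schwartz, toDist_apply, toDist_apply]
  simp only [freeDeriv_apply]
  congr 1
  refine integral_congr_ae ?_
  filter_upwards [hq] with z hz
  rw [hz]

/-- Half of a product rule, in which f need only be continuous because y carries the whole
difference quotient. It allows transported test functions to be differentiated against a path not
known to be differentiable. -/
theorem hasDerivWithinAt_pairL2_sub {f y : ℝ → L2Phase d} {y' : L2Phase d} {s : Set ℝ} {t : ℝ}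
    (hf : ContinuousWithinAt f s t) (hy : HasDerivWithinAt y y' s t) :
    HasDerivWithinAt (fun τ => pairL2 d (f τ) (y τ - y t)) (pairL2 d (f t) y') s t := by
  rw [hasDerivWithinAt_iff_tendsto_slope] at hy ⊢
  have h1 : Filter.Tendsto f (𝓝[s \ {t}] t) (𝓝 (f t)) :=
    hf.mono_left (nhdsWithin_mono _ Set.sdiff_subset)
  have h2 := ((pairL2 d).continuous₂.tendsto (f t, y')).comp (h1.prodMk_nhds hy)
  refine h2.congr fun τ => ?_
  simp only [Function.comp_apply, Function.uncurry, slope, vsub_eq_sub, sub_self, map_zero,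
    sub_zero]
  exact (pairL2 d (f τ)).map_smul_of_tower _ _

/-- Free transport is moved onto the test function, where it can be differentiated in L², so v·∇_x f
never has to be formed. The remaining derivative is that of y, which supplies the interaction term.
-/
theorem isSolution_of_hasDerivWithinAt {Vhat : Pos d → ℂ}
    {b : HSpace d ε m r →L[ℂ] HSpace d ε m r →L[ℂ] HSpace d ε m r}
    (hb : ∀ p, ∀ᵐ z, wignerB ε Vhat (densityL2 (toL2 d ε m r p)) (toL2 d ε m r p) z =
        toL2 d ε m r (b p p) z) {T : ℝ} {y : ℝ → HSpace d ε m r}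
    (hy : ∀ t ∈ Set.Icc 0 T,
      HasDerivWithinAt y (interactionField (flowH d ε m r) b t (y t)) (Set.Icc 0 T) t) :
    IsSolution ε Vhat m r T (toL2 d ε m r (y 0)) fun t => toL2 d ε m r (flowH d ε m r t (y t)) := by
  have hyc : ContinuousOn y (Set.Icc 0 T) := fun t ht => (hy t ht).continuousWithinAt
  refine ⟨fun t ht => ⟨memH_toL2 _, tendsto_hNorm_iff.2 ?_⟩, by rw [flowH_zero], fun φ t ht => ?_⟩
  · have h1 : ContinuousOn (fun t => flowH d ε m r t (y t)) (Set.Icc 0 T) := by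
      rw [continuousOn_iff_continuous_domRestrict] at hyc ⊢
      exact continuous_flowH continuous_subtype_val hyc
    exact h1 t ht
  · rw [weak_rhs_eq (hb _)]
    have e : ∀ s, ∫ z, toL2 d ε m r (flowH d ε m r s (y s)) z * φ z =
        pairL2 d (toL2 d ε m r (y s)) (flowL2 d (-t) (schwartzL2 d φ)) +
        pairL2 d (toL2 d ε m r (y s))
          (flowL2 d (-s) (schwartzL2 d φ) - flowL2 d (-t) (schwartzL2 d φ)) := fun s => by
      rw [← map_add, add_sub_cancel, ← pairL2_flowL2, ← toL2_flowH, pairL2_schwartz, toDist_apply]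
    simp only [e]
    have h1 : HasDerivWithinAt (fun s => toL2 d ε m r (y s))
        (toL2 d ε m r (interactionField (flowH d ε m r) b t (y t))) (Set.Icc 0 T) t :=
      ((toL2 d ε m r).restrictScalars ℝ).hasFDerivAt.comp_hasDerivWithinAt t (hy t ht)
    have h2 : HasDerivWithinAt (fun s => pairL2 d (toL2 d ε m r (y s))
        (flowL2 d (-t) (schwartzL2 d φ)))
        (pairL2 d (toL2 d ε m r (interactionField (flowH d ε m r) b t (y t)))
          (flowL2 d (-t) (schwartzL2 d φ))) (Set.Icc 0 T) t := by
      simp only [pairL2_comm _ (flowL2 d (-t) (schwartzL2 d φ))]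
      exact ((pairL2 d (flowL2 d (-t) (schwartzL2 d φ))).restrictScalars
        ℝ).hasFDerivAt.comp_hasDerivWithinAt t h1
    have h3 := hasDerivWithinAt_pairL2_sub h1.continuousWithinAt
      (hasDerivAt_flowL2_schwartzL2 φ t).hasDerivWithinAt
    refine (h2.add h3).congr_deriv ?_
    rw [← pairL2_flowL2, ← pairL2_flowL2, ← toL2_flowH, ← toL2_flowH, interactionField, map_neg,
      flowH_flowH_neg, map_neg, map_neg, neg_apply]
    ring

/-- Uniqueness is reduced to the ordinary differential equation. Undoing free transport, the weak
equation gives the derivative of every pairing with a Schwartz function; these pairings separate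
points, and the proposed derivative is continuous in 𝓗^m_r, so y is differentiable there. -/
theorem IsSolution.exists_lift {Vhat : Pos d → ℂ}
    {b : HSpace d ε m r →L[ℂ] HSpace d ε m r →L[ℂ] HSpace d ε m r}
    (hb : ∀ p, ∀ᵐ z, wignerB ε Vhat (densityL2 (toL2 d ε m r p)) (toL2 d ε m r p) z =
        toL2 d ε m r (b p p) z) {T : ℝ} (hT : 0 ≤ T) {f0 : L2Phase d} {f : ℝ → L2Phase d}
    (hf : IsSolution ε Vhat m r T f0 f) :
    ∃ y : ℝ → HSpace d ε m r,
      (∀ t ∈ Set.Icc 0 T, f t = toL2 d ε m r (flowH d ε m r t (y t))) ∧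
      ∀ t ∈ Set.Icc 0 T,
        HasDerivWithinAt y (interactionField (flowH d ε m r) b t (y t)) (Set.Icc 0 T) t := by
  have hp : ∀ t, ∃ p, t ∈ Set.Icc 0 T → toL2 d ε m r p = f t := fun t => by
    by_cases ht : t ∈ Set.Icc 0 T
    · obtain ⟨p, hp⟩ := exists_toL2_eq (hf.continuousH t ht).1
      exact ⟨p, fun _ => hp⟩
    · exact ⟨0, fun h => absurd h ht⟩
  choose p hp using hp
  have hpc : ContinuousOn p (Set.Icc 0 T) := fun t ht => by
    refine tendsto_hNorm_iff.1 ((hf.continuousH t ht).2.congr' ?_)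
    filter_upwards [self_mem_nhdsWithin] with s hs
    rw [hp s hs, hp t ht]
  -- Constant extension beyond the end points gives a path continuous on all of ℝ, as the
  -- differentiability criterion requires.
  set P : ℝ → HSpace d ε m r := Set.IccExtend hT ((Set.Icc 0 T).domRestrict p) with hP
  have hPc : Continuous P := (continuousOn_iff_continuous_domRestrict.1 hpc).Icc_extend'
  have hPp : ∀ t ∈ Set.Icc 0 T, toL2 d ε m r (P t) = f t := fun t ht => by
    rw [hP, Set.IccExtend_of_mem hT _ ht]
    exact hp t ht
  refine ⟨fun t => flowH d ε m r (-t) (P t), fun t ht => by rw [flowH_flowH_neg, hPp t ht],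
    fun t ht => ?_⟩
  have hg : Continuous fun t => interactionField (flowH d ε m r) b t
      (flowH d ε m r (-t) (P t)) := by
    simp only [interactionField, flowH_flowH_neg]
    exact (continuous_flowH continuous_neg (b.continuous₂.comp (hPc.prodMk hPc))).neg
  refine hasDerivWithinAt_of_forall_clm
    (ℓ := fun φ : 𝓢(Phase d, ℂ) =>
      ((pairL2 d (schwartzL2 d φ)) ∘L toL2 d ε m r).restrictScalars ℝ)
    (fun x w h => toL2_injective (ext_pairL2 fun φ => ?_)) hg (fun φ s hs => ?_) ht
  · rw [pairL2_comm, pairL2_comm (toL2 d ε m r w)]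
    exact h φ
  · change HasDerivWithinAt (fun τ => pairL2 d (schwartzL2 d φ)
      (toL2 d ε m r (flowH d ε m r (-τ) (P τ)))) (pairL2 d (schwartzL2 d φ) (toL2 d ε m r
        (interactionField (flowH d ε m r) b s (flowH d ε m r (-s) (P s))))) _ _
    have hd : HasDerivAt (fun τ => flowL2 d τ (schwartzL2 d φ))
        (-flowL2 d s (schwartzL2 d (freeDeriv d φ))) s := by
      have h := (neg_neg s ▸ hasDerivAt_flowL2_schwartzL2 φ (-s) :).scomp s (hasDerivAt_neg s)
      simpa [Function.comp_def] using h
    have hfc : ContinuousWithinAt (fun τ => toL2 d ε m r (P τ)) (Set.Icc 0 T) s :=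
      ((toL2 d ε m r).continuous.comp hPc).continuousWithinAt
    have h1 := hasDerivWithinAt_pairL2_sub hfc hd.hasDerivWithinAt
    have h2 : HasDerivWithinAt (fun τ => pairL2 d (toL2 d ε m r (P τ))
        (flowL2 d s (schwartzL2 d φ))) (pairL2 d (toL2 d ε m r (P s))
        (flowL2 d s (schwartzL2 d (freeDeriv d φ))) -
        pairL2 d (toL2 d ε m r (b (P s) (P s))) (flowL2 d s (schwartzL2 d φ))) (Set.Icc 0 T) s := by
      have e : ∀ ψ : 𝓢(Phase d, ℂ), flowL2 d s (schwartzL2 d ψ) =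
          schwartzL2 d (shearS d (-s) ψ) := fun ψ => by
        rw [← flowL2_schwartzL2, neg_neg]
      rw [e, e, ← freeDeriv_shearS, ← weak_rhs_eq (hb (P s)), hPp s hs]
      -- The weak equation is used with the transported test function frozen at time s; the
      -- variation of the test function itself is accounted for by `h1`.
      refine (hf.equation (shearS d (-s) φ) s hs).congr (fun τ hτ => ?_) ?_
      · rw [hPp τ hτ, pairL2_schwartz, toDist_apply]
      · rw [hPp s hs, pairL2_schwartz, toDist_apply]
    have h3 := h2.add h1
    have e1 : ∀ τ, pairL2 d (schwartzL2 d φ) (toL2 d ε m r (flowH d ε m r (-τ) (P τ))) =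
        pairL2 d (toL2 d ε m r (P τ)) (flowL2 d s (schwartzL2 d φ)) +
        pairL2 d (toL2 d ε m r (P τ))
          (flowL2 d τ (schwartzL2 d φ) - flowL2 d s (schwartzL2 d φ)) := fun τ => by
      rw [← map_add, add_sub_cancel, toL2_flowH, pairL2_comm, pairL2_flowL2, neg_neg]
    simp only [e1]
    refine h3.congr_deriv ?_
    rw [interactionField, flowH_flowH_neg, map_neg, map_neg, toL2_flowH, map_neg,
      pairL2_comm (schwartzL2 d φ), pairL2_flowL2, neg_neg]
    ring

/-! ### Complex conjugation and reality -/

theorem rel_pow {A : Type*} [Ring A] [Algebra ℂ A] {R : Submodule ℂ A → Submodule ℂ A → Prop}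
    (h1 : R 1 1) (hmul : ∀ M M' N N', R M M' → R N N' → R (M * N) (M' * N'))
    {M M' : Submodule ℂ A} (h : R M M') (n : ℕ) : R (M ^ n) (M' ^ n) := by
  induction n with
  | zero => rwa [pow_zero, pow_zero]
  | succ n ih =>
    rw [pow_succ, pow_succ]
    exact hmul _ _ _ _ ih h

theorem pow_mul_pow_comm {A : Type*} [Ring A] [Algebra ℂ A] {K L K' L' : Submodule ℂ A}
    (h1 : Commute K L) (h2 : Commute K L') (h3 : Commute K' L) (h4 : Commute K' L') (n : ℕ) :
    (K + K') ^ n * (L + L') ^ n = (L + L') ^ n * (K + K') ^ n :=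
  (((h1.add_right h2).add_left (h3.add_right h4)).pow_pow n n).eq

/-- Complex conjugation of test functions. -/
def conjS (d : ℕ) : 𝓢(Phase d, ℂ) →L[ℝ] 𝓢(Phase d, ℂ) :=
  SchwartzMap.postcompCLM (Complex.conjCLE : ℂ →L[ℝ] ℂ)

theorem conjS_apply (φ : 𝓢(Phase d, ℂ)) (z : Phase d) :
    conjS d φ z = starRingEnd ℂ (φ z) := rfl

/-- Complex conjugation of square integrable functions. -/
def conjL2 (d : ℕ) : L2Phase d →L[ℝ] L2Phase d :=
  (Complex.conjCLE : ℂ →L[ℝ] ℂ).compLpL 2 volume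

theorem coeFn_conjL2 (f : L2Phase d) : ∀ᵐ z, conjL2 d f z = starRingEnd ℂ (f z) :=
  ContinuousLinearMap.coeFn_compLpL (Complex.conjCLE : ℂ →L[ℝ] ℂ) f

theorem conjL2_smul (c : ℂ) (f : L2Phase d) :
    conjL2 d (c • f) = starRingEnd ℂ c • conjL2 d f := by
  refine Lp.ext ?_
  filter_upwards [coeFn_conjL2 (c • f), coeFn_conjL2 f, Lp.coeFn_smul c f,
    Lp.coeFn_smul (starRingEnd ℂ c) (conjL2 d f)] with z h1 h2 h3 h4
  rw [h1, h3, h4, Pi.smul_apply, Pi.smul_apply, h2, smul_eq_mul, smul_eq_mul, map_mul]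

/-- Two tempered distributions are complex conjugate. -/
def IsConj (u u' : Dist d) : Prop := ∀ φ, u' φ = starRingEnd ℂ (u (conjS d φ))

theorem conjS_conjS (φ : 𝓢(Phase d, ℂ)) : conjS d (conjS d φ) = φ := by
  ext z
  rw [conjS_apply, conjS_apply, Complex.conj_conj]

theorem IsConj.eq {u u₁ u₂ : Dist d} (h₁ : IsConj u u₁) (h₂ : IsConj u u₂) : u₁ = u₂ := by
  ext φ
  rw [h₁, h₂]

theorem IsConj.symm {u u' : Dist d} (h : IsConj u u') : IsConj u' u := fun φ => by
  rw [h, conjS_conjS, Complex.conj_conj]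

theorem isConj_toDist (f : L2Phase d) : IsConj (toDist d f) (toDist d (conjL2 d f)) := fun φ => by
  rw [toDist_apply, toDist_apply, ← integral_conj]
  refine integral_congr_ae ?_
  filter_upwards [coeFn_conjL2 f] with z hz
  rw [hz, map_mul, conjS_apply, Complex.conj_conj]

/-- The operators whose complex conjugate is in `M`. -/
def conjOp (M : Submodule ℂ (DistOp d)) : Submodule ℂ (DistOp d) where
  carrier := {P | ∃ P' ∈ M, ∀ u u', IsConj u u' → IsConj (P u) (P' u')}
  add_mem' := by
    rintro P Q ⟨P', h1, h2⟩ ⟨Q', h3, h4⟩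
    refine ⟨P' + Q', M.add_mem h1 h3, fun u u' h φ => ?_⟩
    change P' u' φ + Q' u' φ = starRingEnd ℂ (P u (conjS d φ) + Q u (conjS d φ))
    rw [h2 u u' h, h4 u u' h, map_add]
  zero_mem' := ⟨0, M.zero_mem, fun u u' _ φ => (map_zero (starRingEnd ℂ)).symm⟩
  smul_mem' := by
    rintro c P ⟨P', h1, h2⟩
    refine ⟨starRingEnd ℂ c • P', M.smul_mem _ h1, fun u u' h φ => ?_⟩
    change starRingEnd ℂ c * P' u' φ = starRingEnd ℂ (c * P u (conjS d φ))
    rw [h2 u u' h, map_mul]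

theorem mul_le_conjOp {M N M' N' : Submodule ℂ (DistOp d)} (h : M ≤ conjOp M')
    (h' : N ≤ conjOp N') : M * N ≤ conjOp (M' * N') := by
  refine Submodule.mul_le.2 fun P hP Q hQ => ?_
  obtain ⟨P', h1, h2⟩ := h hP
  obtain ⟨Q', h3, h4⟩ := h' hQ
  exact ⟨P' * Q', Submodule.mul_mem_mul h1 h3, fun u u' hu => h2 _ _ (h4 _ _ hu)⟩

theorem pow_le_conjOp {M M' : Submodule ℂ (DistOp d)} (h : M ≤ conjOp M') (n : ℕ) :
    M ^ n ≤ conjOp (M' ^ n) :=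
  rel_pow (R := fun M M' : Submodule ℂ (DistOp d) => M ≤ conjOp M')
    (Submodule.one_le.2 ⟨1, Submodule.one_le.1 le_rfl, fun _ _ hu => hu⟩)
    (fun _ _ _ _ h h' => mul_le_conjOp h h') h n

theorem isConj_letter {u u' : Dist d} (h : IsConj u u') {a : ℂ} {e : Phase d} {b : ℂ}
    {L : Phase d →L[ℝ] ℂ} (hL : ∀ z, starRingEnd ℂ (L z) = L z) :
    IsConj (letter a e b L u) (letter (starRingEnd ℂ a) e (starRingEnd ℂ b) L u') := fun φ => by
  rw [letter_apply, letter_apply, h]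
  congr 2
  ext z
  have h1 : fderiv ℝ (conjS d φ) z e = starRingEnd ℂ (fderiv ℝ φ z e) := by
    have h2 := (Complex.conjCLE : ℂ →L[ℝ] ℂ).hasFDerivAt.comp z (φ.hasFDerivAt z)
    have h3 : (conjS d φ : Phase d → ℂ) = (Complex.conjCLE : ℂ →L[ℝ] ℂ) ∘ φ := rfl
    rw [h3, h2.fderiv]
    rfl
  rw [conjS_apply, letterT_apply, letterT_apply, h1, conjS_apply]
  simp only [map_add, map_neg, map_mul, Complex.conj_conj, hL]

theorem letterSpan_le_conjOp {ι : Type*} {p q : ι → DistOp d}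
    (h : ∀ i u u', IsConj u u' → IsConj (p i u) (q i u')) :
    letterSpan p ≤ conjOp (letterSpan q) := by
  refine Submodule.span_le.2 ?_
  rintro _ (rfl | ⟨i, rfl⟩)
  · exact ⟨1, one_mem_letterSpan q, fun _ _ hu => hu⟩
  · exact ⟨q i, mem_letterSpan q i, h i⟩

theorem conjOp_mono {M N : Submodule ℂ (DistOp d)} (h : M ≤ N) : conjOp M ≤ conjOp N :=
  fun _ ⟨P', h1, h2⟩ => ⟨P', h h1, h2⟩

/-- Conjugation exchanges V_+ with V_- and X_- with X_+, hence the first two factors of `opSpan`.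
These commute as submodules, so the original order can be restored. -/
theorem opSpan_le_conjOp : opSpan d ε m r ≤ conjOp (opSpan d ε m r) := by
  have hX : ∀ (j : Fin d) (z : Phase d), starRingEnd ℂ (coordX j z) = coordX j z := fun j z => by
    rw [coordX_apply, Complex.conj_ofReal]
  have hV : ∀ (j : Fin d) (z : Phase d), starRingEnd ℂ (coordV j z) = coordV j z := fun j z => by
    rw [coordV_apply, Complex.conj_ofReal]
  have h2 : starRingEnd ℂ (2 * Complex.I) = -(2 * Complex.I) := by
    rw [map_mul, Complex.conj_I, Complex.conj_ofNat]; ring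
  have h2' : starRingEnd ℂ (-(2 * Complex.I)) = 2 * Complex.I := by rw [map_neg, h2, neg_neg]
  have e1 : letterSpan (vPlus ε : Fin d → DistOp d) ≤ conjOp (letterSpan (vMinus ε)) :=
    letterSpan_le_conjOp fun j u u' hu => by
      have := isConj_letter hu (a := ε) (e := (EuclideanSpace.single j 1, 0))
        (b := 2 * Complex.I) (hV j)
      rwa [h2, Complex.conj_ofReal, ← vPlus_eq, ← vMinus_eq] at this
  have e2 : letterSpan (vMinus ε : Fin d → DistOp d) ≤ conjOp (letterSpan (vPlus ε)) :=
    letterSpan_le_conjOp fun j u u' hu => by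
      have := isConj_letter hu (a := ε) (e := (EuclideanSpace.single j 1, 0))
        (b := -(2 * Complex.I)) (hV j)
      rwa [h2', Complex.conj_ofReal, ← vPlus_eq, ← vMinus_eq] at this
  have e3 : letterSpan (xPlus ε : Fin d → DistOp d) ≤ conjOp (letterSpan (xMinus ε)) :=
    letterSpan_le_conjOp fun j u u' hu => by
      have := isConj_letter hu (a := ε) (e := (0, EuclideanSpace.single j 1))
        (b := 2 * Complex.I) (hX j)
      rwa [h2, Complex.conj_ofReal, ← xPlus_eq, ← xMinus_eq] at this
  have e4 : letterSpan (xMinus ε : Fin d → DistOp d) ≤ conjOp (letterSpan (xPlus ε)) :=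
    letterSpan_le_conjOp fun j u u' hu => by
      have := isConj_letter hu (a := ε) (e := (0, EuclideanSpace.single j 1))
        (b := -(2 * Complex.I)) (hX j)
      rwa [h2', Complex.conj_ofReal, ← xPlus_eq, ← xMinus_eq] at this
  have e5 : letterSpan (dX : Fin d → DistOp d) ≤ conjOp (letterSpan dX) :=
    letterSpan_le_conjOp fun j u u' hu => by
      have := isConj_letter hu (a := 1) (e := (EuclideanSpace.single j 1, 0)) (b := 0) (L := 0)
        (fun z => map_zero _)
      rwa [map_one, map_zero, ← dX_eq] at this
  have e6 : letterSpan (dV : Fin d → DistOp d) ≤ conjOp (letterSpan dV) :=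
    letterSpan_le_conjOp fun j u u' hu => by
      have := isConj_letter hu (a := 1) (e := (0, EuclideanSpace.single j 1)) (b := 0) (L := 0)
        (fun z => map_zero _)
      rwa [map_one, map_zero, ← dV_eq] at this
  have hadd : ∀ {K L K' L' : Submodule ℂ (DistOp d)}, K ≤ conjOp K' → L ≤ conjOp L' →
      K + L ≤ conjOp (K' + L') := fun h h' =>
    sup_le (h.trans (conjOp_mono le_sup_left)) (h'.trans (conjOp_mono le_sup_right))
  have key := mul_le_conjOp (mul_le_conjOp (pow_le_conjOp (hadd e1 e4) r)
    (pow_le_conjOp (hadd e2 e3) r)) (pow_le_conjOp (hadd e5 e6) m)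
  have hc := pow_mul_pow_comm ((isLetterFamily_vPlus (d := d) ε).commute (isLetterFamily_vMinus ε))
    ((isLetterFamily_vPlus ε).commute (isLetterFamily_xPlus ε))
    ((isLetterFamily_xMinus ε).commute (isLetterFamily_vMinus ε))
    ((isLetterFamily_xMinus ε).commute (isLetterFamily_xPlus ε)) r
  exact key.trans (conjOp_mono (mul_le_mul' hc.ge le_rfl))

theorem memH_conjL2 {f : L2Phase d} (hf : MemH ε m r f) : MemH ε m r (conjL2 d f) := by
  refine memH_iff.2 fun D hD => ?_
  obtain ⟨D', hD', h⟩ := opSpan_le_conjOp hD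
  obtain ⟨g, hg⟩ := memH_iff.1 hf D' hD'
  change toDist d g = _ at hg
  have h1 := (h _ _ (isConj_toDist f).symm).symm
  rw [← hg] at h1
  exact ⟨conjL2 d g, (isConj_toDist g).eq h1⟩

theorem exists_conjH (d : ℕ) (ε : ℝ) (m r : ℕ) : ∃ J : HSpace d ε m r →L[ℝ] HSpace d ε m r,
    ∀ p, toL2 d ε m r (J p) = conjL2 d (toL2 d ε m r p) :=
  exists_lift (J := (toL2 d ε m r).restrictScalars ℝ) toL2_injective
    (conjL2 d ∘L (toL2 d ε m r).restrictScalars ℝ) fun p =>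
      exists_toL2_eq (memH_conjL2 (memH_toL2 p))

theorem conjL2_flowL2 (t : ℝ) (f : L2Phase d) :
    conjL2 d (flowL2 d t f) = flowL2 d t (conjL2 d f) := by
  refine Lp.ext ?_
  filter_upwards [coeFn_conjL2 (flowL2 d t f), coeFn_flowL2 t f, coeFn_flowL2 t (conjL2 d f),
    (measurePreserving_shear (d := d) (-t)).quasiMeasurePreserving.ae (coeFn_conjL2 f)]
    with z h1 h2 h3 h4
  rw [h1, h2, h3, h4]

theorem measurableEmbedding_reflX : MeasurableEmbedding (reflX : Phase d → Phase d) :=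
  ((MeasurableEquiv.neg (Pos d)).prodCongr (MeasurableEquiv.refl (Pos d))).measurableEmbedding

theorem fourierL2_conjL2 (f : L2Phase d) : fourierL2 d (conjL2 d f) =
    compL2 reflX measurePreserving_reflX (conjL2 d (fourierL2 d f)) := by
  refine denseRange_schwartzL2.induction_on (p := fun f => fourierL2 d (conjL2 d f) =
    compL2 reflX measurePreserving_reflX (conjL2 d (fourierL2 d f))) f
    (isClosed_eq (by fun_prop) (by fun_prop)) fun φ => ?_
  have h0 : conjL2 d (schwartzL2 d φ) = schwartzL2 d (conjS d φ) := by
    refine Lp.ext ?_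
    filter_upwards [coeFn_conjL2 (schwartzL2 d φ), coeFn_schwartzL2 φ,
      coeFn_schwartzL2 (conjS d φ)] with z h1 h2 h3
    rw [h1, h2, h3, conjS_apply]
  rw [h0]
  refine Lp.ext ?_
  filter_upwards [coeFn_fourierL2_schwartz (conjS d φ),
    coeFn_compL2 _ measurePreserving_reflX (conjL2 d (fourierL2 d (schwartzL2 d φ))),
    measurePreserving_reflX.quasiMeasurePreserving.ae
      (coeFn_conjL2 (fourierL2 d (schwartzL2 d φ))),
    measurePreserving_reflX.quasiMeasurePreserving.ae (coeFn_fourierL2_schwartz φ)]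
    with z h1 h2 h3 h4
  rw [h1, h2, Function.comp_apply, h3, h4, fourierX, fourierX, Real.fourier_eq', Real.fourier_eq',
    ← integral_conj]
  refine integral_congr_ae (.of_forall fun x => ?_)
  simp only [smul_eq_mul, map_mul, ← Complex.exp_conj, Complex.conj_I, Complex.conj_ofReal, reflX,
    inner_neg_right, conjS_apply]
  congr 2
  push_cast
  ring

theorem conjL2_modL2 (ζ w : Pos d) (f : L2Phase d) :
    conjL2 d (modL2 ζ w f) = modL2 (-ζ) w (conjL2 d f) := by
  refine Lp.ext ?_
  filter_upwards [coeFn_conjL2 (modL2 ζ w f), coeFn_modL2 ζ w f, coeFn_modL2 (-ζ) w (conjL2 d f),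
    (measurePreserving_shiftV w).quasiMeasurePreserving.ae (coeFn_conjL2 f)] with z h1 h2 h3 h4
  rw [h1, h2, h3, h4, map_mul, character, character, ← Complex.exp_conj]
  simp only [map_mul, Complex.conj_I, Complex.conj_ofReal, Complex.conj_ofNat, inner_neg_right]
  congr 2
  push_cast
  ring

/-- Conjugation reverses the frequency of the character. The substitution ζ ↦ -ζ restores it, at the
price of reversing the velocity shift, hence the sign of c. -/
theorem twistConv_conjL2 (c : ℝ) {U U' : L1Phase d}
    (hU : ∀ᵐ y, U' y = starRingEnd ℂ (U (reflX y))) (f : L2Phase d) :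
    twistConv d c U' (conjL2 d f) = conjL2 d (twistConv d (-c) U f) := by
  rw [twistConv_apply, twistConv_apply,
    ← (conjL2 d).integral_comp_comm (integrable_twistConv (-c) U f),
    ← measurePreserving_reflX.integral_comp measurableEmbedding_reflX]
  refine integral_congr_ae ?_
  filter_upwards [measurePreserving_reflX.quasiMeasurePreserving.ae hU] with y hy
  have h2 : reflX (reflX y) = y := by simp only [reflX, neg_neg]
  rw [hy, h2, conjL2_smul, conjL2_modL2]
  simp only [reflX, smul_neg, neg_smul]

theorem IsShortRange.conj_eq {V : 𝓢'(Pos d, ℂ)} {Vhat : Pos d → ℂ} (hV : IsShortRange V Vhat)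
    (ξ : Pos d) : starRingEnd ℂ (Vhat ξ) = Vhat (-ξ) := by
  have hc := hV.smooth.continuous
  have h1 : ∀ᵐ ζ : Pos d, starRingEnd ℂ (Vhat ((2 * Real.pi) • ζ)) =
      Vhat (-((2 * Real.pi) • ζ)) := by
    refine ae_eq_of_integral_contDiff_smul_eq
      (Continuous.locallyIntegrable (by fun_prop))
      (Continuous.locallyIntegrable (by fun_prop)) fun g hg hgc => ?_
    have hg1 : HasCompactSupport (Complex.ofRealCLM ∘ g) := hgc.comp_left rfl
    have hg2 : ContDiff ℝ ∞ (Complex.ofRealCLM ∘ g) := by fun_prop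
    set G : 𝓢(Pos d, ℂ) := hg1.toSchwartzMap hg2
    set N : 𝓢(Pos d, ℂ) →L[ℂ] 𝓢(Pos d, ℂ) :=
      SchwartzMap.compCLMOfContinuousLinearEquiv ℂ (ContinuousLinearEquiv.neg ℝ (M := Pos d))
    have hN : ∀ (φ : 𝓢(Pos d, ℂ)) x, N φ x = φ (-x) := fun φ x => rfl
    have hG : ∀ x, G x = (g x : ℂ) := fun x => rfl
    have hf1 : ∀ x, starRingEnd ℂ ((𝓕 G : 𝓢(Pos d, ℂ)) x) = (𝓕 G : 𝓢(Pos d, ℂ)) (-x) := fun x => by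
      rw [SchwartzMap.fourier_coe, Real.fourier_eq', Real.fourier_eq', ← integral_conj]
      refine integral_congr_ae (.of_forall fun y => ?_)
      simp only [smul_eq_mul, map_mul, ← Complex.exp_conj, Complex.conj_I, Complex.conj_ofReal,
        inner_neg_right, hG]
      congr 2
      push_cast
      ring
    have hf2 : 𝓕 (N G) = N (𝓕 G) := by
      ext x
      rw [hN, SchwartzMap.fourier_coe, SchwartzMap.fourier_coe, Real.fourier_eq', Real.fourier_eq',
        ← integral_neg_eq_self]
      refine integral_congr_ae (.of_forall fun y => ?_)
      simp only [hN, inner_neg_left, inner_neg_right, neg_neg]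
    have hA : V (𝓕 G) = ∫ ζ, G ζ * Vhat ((2 * Real.pi) • ζ) := by
      rw [← hV.fourier, TemperedDistribution.fourier_apply]
    have hA' : V (N (𝓕 G)) = ∫ ζ, G ζ * Vhat (-((2 * Real.pi) • ζ)) := by
      rw [← hf2, ← TemperedDistribution.fourier_apply, hV.fourier, ← integral_neg_eq_self]
      simp only [hN, neg_neg, smul_neg]
    -- For real G, reflecting the Fourier transform conjugates it, so these two combinations are
    -- real test functions: twice its real part and a multiple of its imaginary part. Reality of V
    -- on both gives the Hermitian symmetry of Vhat in weak form.
    have r1 := hV.real (𝓕 G + N (𝓕 G)) fun x => by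
      rw [add_apply, hN, ← hf1, Complex.add_conj, Complex.ofReal_im]
    have r2 := hV.real (Complex.I • (𝓕 G - N (𝓕 G))) fun x => by
      rw [smul_apply, sub_apply, hN, ← hf1, Complex.sub_conj]
      simp
    rw [map_add, Complex.add_im] at r1
    rw [map_smul, map_sub, smul_eq_mul, Complex.I_mul_im, Complex.sub_re] at r2
    have r3 : starRingEnd ℂ (V (𝓕 G)) = V (N (𝓕 G)) :=
      Complex.ext (by rw [Complex.conj_re]; linarith) (by rw [Complex.conj_im]; linarith)
    rw [hA, hA', ← integral_conj] at r3
    simpa only [map_mul, hG, Complex.conj_ofReal, Complex.real_smul] using r3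
  have h2 : (fun ζ : Pos d => starRingEnd ℂ (Vhat ((2 * Real.pi) • ζ))) =
      fun ζ => Vhat (-((2 * Real.pi) • ζ)) :=
    (Continuous.ae_eq_iff_eq volume (by fun_prop) (by fun_prop)).1 h1
  have h3 := congrFun h2 ((2 * Real.pi)⁻¹ • ξ)
  simpa only [smul_inv_smul₀ Real.two_pi_pos.ne'] using h3

/-- Conjugation exchanges the shifts ±πε and so reverses the difference of twisted convolutions; the
conjugate of i supplies the compensating sign. Hermitian symmetry of Vhat makes the new U the
reflected conjugate of the old one. -/
theorem toL2_interaction_conj {V : 𝓢'(Pos d, ℂ)} {Vhat : Pos d → ℂ} (hV : IsShortRange V Vhat)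
    {b : HSpace d ε m r →L[ℂ] HSpace d ε m r →L[ℂ] HSpace d ε m r}
    (hb : ∀ p q, ∃ U : L1Phase d,
      (∀ᵐ y, U y = Vhat ((2 * Real.pi * ε) • y.1) * fourierL2 d (toL2 d ε m r p) y) ∧
      toL2 d ε m r (b p q) = (Complex.I / ε) • (twistConv d (Real.pi * ε) U (toL2 d ε m r q) -
        twistConv d (-(Real.pi * ε)) U (toL2 d ε m r q)))
    {J : HSpace d ε m r →L[ℝ] HSpace d ε m r}
    (hJ : ∀ p, toL2 d ε m r (J p) = conjL2 d (toL2 d ε m r p)) (p q : HSpace d ε m r) :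
    b (J p) (J q) = J (b p q) := by
  refine toL2_injective ?_
  obtain ⟨U, hU, e⟩ := hb p q
  obtain ⟨U', hU', e'⟩ := hb (J p) (J q)
  have h : ∀ᵐ y, U' y = starRingEnd ℂ (U (reflX y)) := by
    rw [hJ, fourierL2_conjL2] at hU'
    filter_upwards [hU', coeFn_compL2 _ measurePreserving_reflX
        (conjL2 d (fourierL2 d (toL2 d ε m r p))),
      measurePreserving_reflX.quasiMeasurePreserving.ae
        (coeFn_conjL2 (fourierL2 d (toL2 d ε m r p))),
      measurePreserving_reflX.quasiMeasurePreserving.ae hU] with y h1 h2 h3 h4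
    rw [h1, h2, Function.comp_apply, h3, h4, map_mul, hV.conj_eq]
    simp only [reflX, smul_neg, neg_neg]
  rw [e', hJ, hJ, e, twistConv_conjL2 _ h, twistConv_conjL2 _ h, neg_neg, conjL2_smul, map_sub,
    map_div₀, Complex.conj_I, Complex.conj_ofReal, neg_div, neg_smul, ← smul_neg, neg_sub]

theorem exists_solution {V : 𝓢'(Pos d, ℂ)} {Vhat : Pos d → ℂ} (hV : IsShortRange V Vhat)
    (hm : (d : ℝ) / 2 < m) (hr : (d : ℝ) / 2 < r) (hε : 0 < ε) {f0 : L2Phase d}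
    (hf0 : MemH ε m r f0) :
    ∃ T : ℝ, 0 < T ∧ ∃ f : ℝ → L2Phase d, IsSolution ε Vhat m r T f0 f ∧
      (∀ g : ℝ → L2Phase d, IsSolution ε Vhat m r T f0 g → ∀ t ∈ Set.Icc 0 T, g t = f t) ∧
      ((∀ᵐ z, (f0 z).im = 0) → ∀ t ∈ Set.Icc 0 T, ∀ᵐ z, (f t z).im = 0) := by
  obtain ⟨b, hbU, hb⟩ := hV.exists_interaction (m := m) hm hr hε
  obtain ⟨p, rfl⟩ := exists_toL2_eq hf0
  obtain ⟨C, hC0, hC⟩ := exists_norm_flowH_le d ε m r 1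
  have hlip := interactionField_lipschitz (S := flowH d ε m r) (b := b) hC0 hC
  have hcont : ∀ x, Continuous fun t => interactionField (flowH d ε m r) b t x := fun x => by
    have h1 : Continuous fun t => flowH d ε m r t x := continuous_flowH continuous_id continuous_const
    exact (continuous_flowH continuous_neg (b.continuous₂.comp (h1.prodMk h1))).neg
  obtain ⟨T, hT0, hT1, y, rfl, hy⟩ := exists_hasDerivWithinAt_of_locally_lipschitz hcont hlip p
  refine ⟨T, hT0, _, isSolution_of_hasDerivWithinAt hb hy, fun g hg t ht => ?_, fun hre t ht => ?_⟩
  · obtain ⟨y', h1, h2⟩ := hg.exists_lift hb hT0.le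
    have h0 : y' 0 = y 0 := by
      refine toL2_injective ?_
      have h3 := h1 0 ⟨le_rfl, hT0.le⟩
      rw [flowH_zero] at h3
      rw [← h3, hg.initial]
    rw [h1 t ht, eqOn_of_hasDerivWithinAt_of_locally_lipschitz hlip hT1 h2 hy h0 ht]
  -- The conjugate of y solves the same differential equation with the same initial value, so it
  -- equals y by uniqueness.
  · obtain ⟨J, hJ⟩ := exists_conjH d ε m r
    have hflow : ∀ s q, J (flowH d ε m r s q) = flowH d ε m r s (J q) := fun s q =>
      toL2_injective (by rw [hJ, toL2_flowH, toL2_flowH, hJ, conjL2_flowL2])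
    have hfield : ∀ s q, J (interactionField (flowH d ε m r) b s q) =
        interactionField (flowH d ε m r) b s (J q) := fun s q => by
      rw [interactionField, interactionField, map_neg, hflow, ← toL2_interaction_conj hV hbU hJ,
        hflow]
    have hJy : ∀ s ∈ Set.Icc 0 T, HasDerivWithinAt (fun s => J (y s))
        (interactionField (flowH d ε m r) b s (J (y s))) (Set.Icc 0 T) s := fun s hs => by
      rw [← hfield]
      exact J.hasFDerivAt.comp_hasDerivWithinAt s (hy s hs)
    have h0 : J (y 0) = y 0 := by
      refine toL2_injective ?_
      rw [hJ]
      refine Lp.ext ?_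
      filter_upwards [hre, coeFn_conjL2 (toL2 d ε m r (y 0))] with z h1 h2
      rw [h2, Complex.conj_eq_iff_im.2 h1]
    have h1 : J (y t) = y t :=
      eqOn_of_hasDerivWithinAt_of_locally_lipschitz hlip hT1 hJy hy h0 ht
    have h2 : conjL2 d (toL2 d ε m r (flowH d ε m r t (y t))) =
        toL2 d ε m r (flowH d ε m r t (y t)) := by rw [← hJ, hflow, h1]
    have h3 := coeFn_conjL2 (toL2 d ε m r (flowH d ε m r t (y t)))
    rw [h2] at h3
    filter_upwards [h3] with z hz
    exact Complex.conj_eq_iff_im.1 hz.symm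

end Wigner

end

theorem mainTheorem3 (d : ℕ) (hd : 1 ≤ d)
    (V : 𝓢'(Wigner.Pos d, ℂ)) (Vhat : Wigner.Pos d → ℂ) (hV : Wigner.IsShortRange V Vhat)
    (m r : ℕ) (hm : (d : ℝ) / 2 < m) (hr : (d : ℝ) / 2 < r)
    (ε : ℝ) (hε : 0 < ε)
    (f0 : Wigner.L2Phase d) (hf0 : Wigner.MemH ε m r f0) :
    ∃ T : ℝ, 0 < T ∧ ∃ f : ℝ → Wigner.L2Phase d,
      Wigner.IsSolution ε Vhat m r T f0 f ∧
      (∀ g : ℝ → Wigner.L2Phase d, Wigner.IsSolution ε Vhat m r T f0 g →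
        ∀ t ∈ Set.Icc 0 T, g t = f t) ∧
      ((∀ᵐ z, (f0 z).im = 0) → ∀ t ∈ Set.Icc 0 T, ∀ᵐ z, (f t z).im = 0) :=
  Wigner.exists_solution hV hm hr hε hf0
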